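/- \textbf{Setting.} Consider $x_{k+1}=Ax_k+Bu_k+w_k$, $y_k=Cx_k+v_k$ with $x_k\in\mathbb R^{n_x}$, $u_k\in\mathbb R^{n_u}$, $y_k\in\mathbb R^{n_y}$, where $x_0\sim\mathcal N(\bar x_0,\Omega_{x_0})$, $w_k\sim\mathcal N(0,\Omega_w)$ and $v_k\sim\mathcal N(0,\Omega_v)$, $k\ge 0$, are mutually independent, $\Omega_w,\Omega_v\succ0$, $\Omega_{x_0}\succeq0$, and $(A,B)$ is controllable. Let $R\succ0$, $\theta>0$, and let $p,h\ge1$ be integers with $p\mid h$. At time $k$ a controller chooses $\delta_k\in\{0,1\}$ and $u_k$ (with $u_k=0$ if $\delta_k=0$) from $\mathcal I_k=\{y_0,\dots,y_k,u_0,\dots,u_{k-1},\delta_0,\dots,\delta_{k-1}\}$; put $\hat x_k=\mathbb E[x_k\mid\sigma(\mathcal I_k)]$. Its average cost is $$J^a=\limsup_{N\to\infty}\frac1N\mathbb E\Big[\sum_{k=0}^{N-1}x_k^\top Qx_k+u_k^\top Ru_k\Big]+\theta\limsup_{N\to\infty}\frac1N\mathbb E\Big[\sum_{k=0}^{N-1}\delta_k\Big].$$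 Let $\Sigma^-_0=\Omega_{x_0}$, $\Sigma_k=\Sigma_k^--\Sigma_k^-C^\top(C\Sigma_k^-C^\top+\Omega_v)^{-1}C\Sigma_k^-$ and $\Sigma_{k+1}^-=A\Sigma_kA^\top+\Omega_w$. \textbf{Optimal periodic policy.} Let $B_p=A^{p-1}B$, $Q_p=\sum_{i=0}^{p-1}(A^i)^\top QA^i$, $S_p=\sum_{i=1}^{p-1}(A^i)^\top QA^{i-1}B$, $R_p=R+\sum_{i=1}^{p-1}B^\top(A^{i-1})^\top QA^{i-1}B$, and let $\tilde P_p$ be the positive definite solution of $$\tilde P_p=Q_p+(A^p)^\top\tilde P_pA^p-\tilde F_p^\top(B_p^\top\tilde P_pB_p+R_p)\tilde F_p,\qquad \tilde F_p=-(B_p^\top\tilde P_pB_p+R_p)^{-1}(B_p^\top\tilde P_pA^p+S_p^\top).$$ The policy $(\mu^{u,\mathrm{per}},\mu^{\delta,\mathrm{per}})$ uses $\delta_k=1$, $u_k=\tilde F_p\hat x_k$ if $p\mid k$, and $\delta_k=0$, $u_k=0$ otherwise. \textbf{Rollout policy.} For a schedule $m=(\rho_0,\dots,\rho_{h-1})\in\{0,1\}^h$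 let $P^{(m)}_h=\tilde P_p$ and, for $s=h-1,\dots,0$, $$F^{(m)}_s=-(B^\top P^{(m)}_{s+1}B+R)^{-1}B^\top P^{(m)}_{s+1}A,\qquad P^{(m)}_s=Q+A^\top P^{(m)}_{s+1}A-M^{(m)}_s,$$ $$M^{(m)}_s=\rho_s\,(F^{(m)}_s)^\top(B^\top P^{(m)}_{s+1}B+R)F^{(m)}_s,$$ and let $\beta^{(m)}_k=\sum_{s=0}^{h-1}\big(\operatorname{tr}(P^{(m)}_{s+1}\Omega_w)+\operatorname{tr}(M^{(m)}_s\Sigma_{k+s})\big)$, $\gamma^{(m)}=\theta\sum_{s=0}^{h-1}\rho_s$. At each time $\ell h$, $\ell\ge0$, the policy $(\mu^{u,\mathrm{ro}},\mu^{\delta,\mathrm{ro}})$ selects a schedule $m=(\rho_0,\dots,\rho_{h-1})$ that minimizes $$\hat x_{\ell h}^\top P^{(m)}_0\hat x_{\ell h}+\operatorname{tr}(P^{(m)}_0\Sigma_{\ell h})+\beta^{(m)}_{\ell h}+\gamma^{(m)},$$ ties being broken by any fixed measurable rule, so that the selected schedule is one and the same measurable function of $\hat x_{\ell h}$ for all $\ell$;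 then $\delta_{\ell h+s}=\rho_s$ and $u_{\ell h+s}=\rho_sF^{(m)}_s\hat x_{\ell h+s}$ for $0\le s<h$. \textbf{Theorem.} Assume that 1. any two distinct eigenvalues $\lambda_1\ne\lambda_2$ of $A$ satisfy $\lambda_1\neq\lambda_2e^{2\pi q\sqrt{-1}/p}$ for all $q\in\mathbb Z$; 2. $\operatorname{rank}C=n_x$, $Q\succ0$, and the Kalman filter is stationary: $\Omega_{x_0}=\Omega_w+A\Omega_{x_0}A^\top-A\Omega_{x_0}C^\top(C\Omega_{x_0}C^\top+\Omega_v)^{-1}C\Omega_{x_0}A^\top$. Then $J^a(\mu^{u,\mathrm{per}},\mu^{\delta,\mathrm{per}})$ is finite and $$J^a(\mu^{u,\mathrm{ro}},\mu^{\delta,\mathrm{ro}})\le J^a(\mu^{u,\mathrm{per}},\mu^{\delta,\mathrm{per}})+\frac1h.$$ -/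

import Mathlib

open MeasureTheory ProbabilityTheory Filter Matrix
open scoped ENNReal

noncomputable section

/-- Real column vectors of length `n`. -/
abbrev Vec (n : ℕ) : Type := EuclideanSpace ℝ (Fin n)

/-- The action `x ↦ M x` of a real matrix on column vectors. -/
def Matrix.act {m n : ℕ} (M : Matrix (Fin m) (Fin n) ℝ) (x : Vec n) : Vec m :=
  WithLp.toLp 2 (M *ᵥ x.ofLp)

/-- The quadratic form `xᵀ M x`. -/
def Matrix.quad {n : ℕ} (M : Matrix (Fin n) (Fin n) ℝ) (x : Vec n) : ℝ :=
  x.ofLp ⬝ᵥ (M *ᵥ x.ofLp)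

/-- The pair `(A, B)` is controllable: `[B, AB, …, A^(n-1) B]` has rank `n`. -/
def IsControllable {n m : ℕ} (A : Matrix (Fin n) (Fin n) ℝ) (B : Matrix (Fin n) (Fin m) ℝ) :
    Prop :=
  (Matrix.of fun (i : Fin n) (jk : Fin n × Fin m) => (A ^ (jk.1 : ℕ) * B) i jk.2).rank = n

/-- No two distinct complex eigenvalues of `A` have as quotient a `p`-th root of unity. -/
def EigenvalueNonresonant {n : ℕ} (A : Matrix (Fin n) (Fin n) ℝ) (p : ℕ) : Prop :=
  ∀ z₁ ∈ spectrum ℂ (A.map (fun r : ℝ => (r : ℂ))),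
    ∀ z₂ ∈ spectrum ℂ (A.map (fun r : ℝ => (r : ℂ))), z₁ ≠ z₂ →
      ∀ q : ℤ, z₁ ≠ z₂ * Complex.exp (2 * Real.pi * q * Complex.I / p)

/-- The data of the co-design problem: the plant `x⁺ = A x + B u + w`, `y = C x + v`, the covariance
matrices of `w`, `v` and of the initial state, the mean of the initial state, the weights `Q`, `R`,
`θ` of the cost, the period `p` of the base policy and the lookahead horizon `h`. -/
structure CodesignProblem (nx nu ny : ℕ) where
  A : Matrix (Fin nx) (Fin nx) ℝ
  B : Matrix (Fin nx) (Fin nu) ℝ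
  C : Matrix (Fin ny) (Fin nx) ℝ
  covW : Matrix (Fin nx) (Fin nx) ℝ
  covV : Matrix (Fin ny) (Fin ny) ℝ
  covX : Matrix (Fin nx) (Fin nx) ℝ
  meanX : Vec nx
  Q : Matrix (Fin nx) (Fin nx) ℝ
  R : Matrix (Fin nu) (Fin nu) ℝ
  θ : ℝ
  p : ℕ
  h : ℕ

namespace CodesignProblem

variable {nx nu ny : ℕ} (S : CodesignProblem nx nu ny)

/-! ### Kalman error covariances -/

/-- `Σ⁻ ↦ Σ⁻ - Σ⁻ Cᵀ (C Σ⁻ Cᵀ + Ω_v)⁻¹ C Σ⁻`: from the a priori to the a posteriori error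
covariance. -/
def measurementUpdate (T : Matrix (Fin nx) (Fin nx) ℝ) : Matrix (Fin nx) (Fin nx) ℝ :=
  T - T * S.Cᵀ * (S.C * T * S.Cᵀ + S.covV)⁻¹ * S.C * T

/-- The a priori error covariances `Σ⁻_k`. -/
def priorCov : ℕ → Matrix (Fin nx) (Fin nx) ℝ
  | 0 => S.covX
  | k + 1 => S.A * S.measurementUpdate (priorCov k) * S.Aᵀ + S.covW

/-- The a posteriori error covariances `Σ_k`. -/
def postCov (k : ℕ) : Matrix (Fin nx) (Fin nx) ℝ := S.measurementUpdate (S.priorCov k)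

/-- The covariance of the initial state solves the filter Riccati equation, so that the Kalman filter
is stationary from time `0` on. -/
def FilterStationary : Prop :=
  S.covX = S.covW + S.A * S.covX * S.Aᵀ
    - S.A * S.covX * S.Cᵀ * (S.C * S.covX * S.Cᵀ + S.covV)⁻¹ * S.C * S.covX * S.Aᵀ

/-! ### The optimal periodic policy for the average cost -/

/-- `B_p = A^(p-1) B`. -/
def Bp : Matrix (Fin nx) (Fin nu) ℝ := S.A ^ (S.p - 1) * S.B

/-- `Q_p = ∑_{i=0}^{p-1} (A^i)ᵀ Q A^i`. -/
def Qp : Matrix (Fin nx) (Fin nx) ℝ :=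
  ∑ i ∈ Finset.range S.p, (S.A ^ i)ᵀ * S.Q * S.A ^ i

/-- `S_p = ∑_{i=1}^{p-1} (A^i)ᵀ Q A^(i-1) B`. -/
def Sp : Matrix (Fin nx) (Fin nu) ℝ :=
  ∑ i ∈ Finset.Ico 1 S.p, (S.A ^ i)ᵀ * S.Q * S.A ^ (i - 1) * S.B

/-- `R_p = R + ∑_{i=1}^{p-1} Bᵀ (A^(i-1))ᵀ Q A^(i-1) B`. -/
def Rp : Matrix (Fin nu) (Fin nu) ℝ :=
  S.R + ∑ i ∈ Finset.Ico 1 S.p, S.Bᵀ * (S.A ^ (i - 1))ᵀ * S.Q * S.A ^ (i - 1) * S.B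

/-- The periodic feedback gain built from a cost matrix `P`:
`-(B_pᵀ P B_p + R_p)⁻¹ (B_pᵀ P A^p + S_pᵀ)`. -/
def periodicGainOf (P : Matrix (Fin nx) (Fin nx) ℝ) : Matrix (Fin nu) (Fin nx) ℝ :=
  -((S.Bpᵀ * P * S.Bp + S.Rp)⁻¹ * (S.Bpᵀ * P * S.A ^ S.p + S.Spᵀ))

/-- `P` is a positive definite solution of the periodic algebraic Riccati equation
`P = Q_p + (A^p)ᵀ P A^p - Fᵀ (B_pᵀ P B_p + R_p) F`, where `F` is the gain built from `P`. -/
def IsPeriodicRiccatiSolution (P : Matrix (Fin nx) (Fin nx) ℝ) : Prop :=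
  P.PosDef ∧
    P = S.Qp + (S.A ^ S.p)ᵀ * P * S.A ^ S.p
      - (S.periodicGainOf P)ᵀ * (S.Bpᵀ * P * S.Bp + S.Rp) * S.periodicGainOf P

open Classical in
/-- The positive definite solution `P̃_p` of the periodic algebraic Riccati equation (and `0` if there
is none). -/
def Pper : Matrix (Fin nx) (Fin nx) ℝ :=
  if hP : ∃ P, S.IsPeriodicRiccatiSolution P then hP.choose else 0

/-- The gain `F̃_p` of the optimal periodic policy. -/
def periodicGain : Matrix (Fin nu) (Fin nx) ℝ := S.periodicGainOf S.Pper

/-! ### Controllers and closed loop -/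

end CodesignProblem

/-- A controller: from the time `k` and the sequence of state estimates (of which only the entries
`x̂_0, …, x̂_k` are available to it at time `k`, see the closed loop below), it computes the pair
`(u_k, δ_k)` of the control input and the triggering variable. -/
abbrev Controller (nx nu : ℕ) : Type := ℕ → (ℕ → Vec nx) → Vec nu × Bool

/-- What the closed loop is at one time `k`: the state `x_k`, the `σ`-algebra `σ(I_k)` of the
information available to the controller, and the estimates `x̂_0, …, x̂_k`. -/
structure LoopStage (Ω : Type*) (nx : ℕ) where
  state : Ω → Vec nx
  info : MeasurableSpace Ω
  est : ℕ → Ω → Vec nx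

namespace CodesignProblem

variable {nx nu ny : ℕ} (S : CodesignProblem nx nu ny)

/-- The optimal periodic policy: `u_k = F̃_p x̂_k` and `δ_k = 1` if `p ∣ k`, otherwise `u_k = 0` and
`δ_k = 0`. -/
def periodicController : Controller nx nu := fun k xhat =>
  if k % S.p = 0 then (S.periodicGain.act (xhat k), true) else (0, false)

/-! ### The rollout algorithm -/

/-- The candidate triggering schedules over one horizon: all `2^h` sequences in `{0,1}^h`. -/
abbrev Schedule : Type := Fin S.h → Bool

/-- The `s`-th entry of a schedule (and `0` beyond the horizon). -/
def entry (m : S.Schedule) (s : ℕ) : Bool := if hs : s < S.h then m ⟨s, hs⟩ else false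

/-- The one-step feedback gain `-(Bᵀ P B + R)⁻¹ Bᵀ P A`. -/
def stepGain (P : Matrix (Fin nx) (Fin nx) ℝ) : Matrix (Fin nu) (Fin nx) ℝ :=
  -((S.Bᵀ * P * S.B + S.R)⁻¹ * S.Bᵀ * P * S.A)

/-- One backward Riccati step: with actuation
`Q + Aᵀ P A - Aᵀ P B (Bᵀ P B + R)⁻¹ Bᵀ P A`, without actuation `Q + Aᵀ P A`. -/
def riccatiStep (δ : Bool) (P : Matrix (Fin nx) (Fin nx) ℝ) : Matrix (Fin nx) (Fin nx) ℝ :=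
  if δ then
    S.Q + S.Aᵀ * P * S.A - S.Aᵀ * P * S.B * (S.Bᵀ * P * S.B + S.R)⁻¹ * S.Bᵀ * P * S.A
  else S.Q + S.Aᵀ * P * S.A

/-- The cost matrix with `j` steps to go: `P^(m)_(h-j)`. -/
def costMatrixToGo (m : S.Schedule) : ℕ → Matrix (Fin nx) (Fin nx) ℝ
  | 0 => S.Pper
  | j + 1 => S.riccatiStep (S.entry m (S.h - (j + 1))) (costMatrixToGo m j)

/-- The cost matrices `P^(m)_s`, `0 ≤ s ≤ h`. -/
def costMatrix (m : S.Schedule) (s : ℕ) : Matrix (Fin nx) (Fin nx) ℝ :=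
  S.costMatrixToGo m (S.h - s)

/-- The gains `F^(m)_s`, `0 ≤ s < h`. -/
def rolloutGain (m : S.Schedule) (s : ℕ) : Matrix (Fin nu) (Fin nx) ℝ :=
  S.stepGain (S.costMatrix m (s + 1))

/-- `M^(m)_s = ρ^(m)_s (F^(m)_s)ᵀ (Bᵀ P^(m)_(s+1) B + R) F^(m)_s`. -/
def estimationPenalty (m : S.Schedule) (s : ℕ) : Matrix (Fin nx) (Fin nx) ℝ :=
  if S.entry m s then
    (S.rolloutGain m s)ᵀ * (S.Bᵀ * S.costMatrix m (s + 1) * S.B + S.R) * S.rolloutGain m s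
  else 0

/-- `β^(m)_k`, the part of the lookahead cost that is due to the noise and the estimation errors. -/
def noiseCost (k : ℕ) (m : S.Schedule) : ℝ :=
  ∑ s ∈ Finset.range S.h,
    ((S.costMatrix m (s + 1) * S.covW).trace + (S.estimationPenalty m s * S.postCov (k + s)).trace)

/-- `γ^(m)`, the actuation cost of a schedule. -/
def actuationCost (m : S.Schedule) : ℝ :=
  S.θ * ∑ s ∈ Finset.range S.h, (if S.entry m s then 1 else 0)

/-- The lookahead cost at time `k`, as a function of the schedule `m` and of the estimate `x̂_k`:
`x̂ᵀ P^(m)_0 x̂ + tr (P^(m)_0 Σ_k) + β^(m)_k + γ^(m)`. -/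
def lookaheadCost (k : ℕ) (m : S.Schedule) (xhat : Vec nx) : ℝ :=
  (S.costMatrix m 0).quad xhat + (S.costMatrix m 0 * S.postCov k).trace
    + S.noiseCost k m + S.actuationCost m

/-- `φ` is a measurable rule that selects, at each time `ℓ h` and for each value of the estimate, a
schedule of minimal lookahead cost. -/
def IsArgminRule (φ : Vec nx → S.Schedule) : Prop :=
  Measurable φ ∧
    ∀ (l : ℕ) (xhat : Vec nx) (m : S.Schedule),
      S.lookaheadCost (l * S.h) (φ xhat) xhat ≤ S.lookaheadCost (l * S.h) m xhat

/-- The rollout policy: for `ℓ h ≤ k < (ℓ+1) h`, with `m = φ(x̂_(ℓh))` and `s = k - ℓ h`,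
`u_k = ρ^(m)_s F^(m)_s x̂_k` and `δ_k = ρ^(m)_s`. -/
def rolloutController (φ : Vec nx → S.Schedule) : Controller nx nu := fun k xhat =>
  let m := φ (xhat (k / S.h * S.h))
  let s := k % S.h
  (if S.entry m s then (S.rolloutGain m s).act (xhat k) else 0, S.entry m s)

/-! ### The closed loop and its cost -/

section ClosedLoop

variable {Ω : Type*} [MeasurableSpace Ω] (μ : Measure Ω)
  (x₀ : Ω → Vec nx) (w : ℕ → Ω → Vec nx) (v : ℕ → Ω → Vec ny) (K : Controller nx nu)

/-- The closed loop of the plant with a controller, built up in time. The information at time `k` is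
`I_k = {y_0, …, y_k, u_0, …, u_(k-1), δ_0, …, δ_(k-1)}`, and the estimate is
`x̂_k = E[x_k | σ(I_k)]`. -/
def loop : ℕ → LoopStage Ω nx
  | 0 =>
    let y : Ω → Vec ny := fun ω => S.C.act (x₀ ω) + v 0 ω
    let I : MeasurableSpace Ω := MeasurableSpace.comap y inferInstance
    { state := x₀
      info := I
      est := Function.update (fun _ _ => 0) 0 (condExp I μ x₀) }
  | k + 1 =>
    let c := loop k
    let a : Ω → Vec nu × Bool := fun ω => K k (fun i => c.est i ω)
    let x : Ω → Vec nx := fun ω => S.A.act (c.state ω) + S.B.act (a ω).1 + w k ω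
    let y : Ω → Vec ny := fun ω => S.C.act (x ω) + v (k + 1) ω
    let I : MeasurableSpace Ω :=
      c.info ⊔ MeasurableSpace.comap a inferInstance ⊔ MeasurableSpace.comap y inferInstance
    { state := x
      info := I
      est := Function.update c.est (k + 1) (condExp I μ x) }

/-- The state `x_k` of the closed loop. -/
def state (k : ℕ) (ω : Ω) : Vec nx := (S.loop μ x₀ w v K k).state ω

/-- The control input `u_k` of the closed loop. -/
def input (k : ℕ) (ω : Ω) : Vec nu := (K k (fun i => (S.loop μ x₀ w v K k).est i ω)).1

/-- The triggering variable `δ_k` of the closed loop. -/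
def trigger (k : ℕ) (ω : Ω) : Bool := (K k (fun i => (S.loop μ x₀ w v K k).est i ω)).2

/-- The average control cost
`limsup_N (1/N) E[∑_{k<N} (x_kᵀ Q x_k + u_kᵀ R u_k)]`, as an extended nonnegative number. -/
def averageControlCost : ℝ≥0∞ :=
  limsup (fun N : ℕ =>
    (∫⁻ ω, ENNReal.ofReal (∑ k ∈ Finset.range N,
      (S.Q.quad (S.state μ x₀ w v K k ω) + S.R.quad (S.input μ x₀ w v K k ω))) ∂μ) / N) atTop

/-- The average actuation rate `limsup_N (1/N) E[∑_{k<N} δ_k]`. -/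
def averageActuationRate : ℝ≥0∞ :=
  limsup (fun N : ℕ =>
    (∫⁻ ω, ∑ k ∈ Finset.range N, (if S.trigger μ x₀ w v K k ω then 1 else 0) ∂μ) / N) atTop

/-- The average cost: control cost plus `θ` times the actuation rate. -/
def averageCost : ℝ≥0∞ :=
  S.averageControlCost μ x₀ w v K + ENNReal.ofReal S.θ * S.averageActuationRate μ x₀ w v K

end ClosedLoop

/-- The initial state and the noises are jointly independent Gaussian vectors: `x₀` with mean `meanX`
and covariance `covX`, the `w k` centred with covariance `covW`, the `v k` centred with covariance
`covV`. -/
structure IsGaussianNoise {Ω : Type*} [MeasurableSpace Ω] (μ : Measure Ω)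
    (x₀ : Ω → Vec nx) (w : ℕ → Ω → Vec nx) (v : ℕ → Ω → Vec ny) : Prop where
  measurable_x₀ : Measurable x₀
  measurable_w : ∀ k, Measurable (w k)
  measurable_v : ∀ k, Measurable (v k)
  law_x₀ : μ.map x₀ = multivariateGaussian S.meanX S.covX
  law_w : ∀ k, μ.map (w k) = multivariateGaussian 0 S.covW
  law_v : ∀ k, μ.map (v k) = multivariateGaussian 0 S.covV
  indep_w : iIndepFun w μ
  indep_v : iIndepFun v μ
  indep_w_v : IndepFun (fun ω k => w k ω) (fun ω k => v k ω) μ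
  indep_x₀ : IndepFun x₀ (fun ω => ((fun k => w k ω), (fun k => v k ω))) μ

end CodesignProblem

end

/-!
The periodic policy is a rollout policy: it selects the periodic schedule in every block. The cost
matrices of this schedule come from backward Riccati steps that start at the positive definite
solution `Pper` of the periodic Riccati equation, and `Pper` is a fixed point of one period of such
steps (`periodStep_eq`, `posDef_Pper_and_periodStep_Pper`), so that its first cost matrix is `Pper`
again and its gains are the periodic gain (`rolloutController_periodicSchedule`). The existence of
`Pper` rests on the null controllability of the sampled pair `(A ^ p, A ^ (p - 1) B)`, which follows
from the controllability of `(A, B)` and the nonresonance of the eigenvalues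
(`IsControllable.exists_null_control`): value iteration of the periodic problem is increasing, and
bounded by the cost of steering to the origin.

For any rollout policy the estimation error is Gaussian and independent of the information, and the
estimate moves according to the selected schedule, driven by independent Gaussian innovations of a
constant covariance `innovCov`, which is positive definite because `C` has full column rank
(`exists_innovation`, `loopInvariant`, `isRolloutEstimate`). Consequently the expected cost of a
block, plus the expectation of `x̂ᵀ Pper x̂` at its end, is the expectation of `blockCost`, the
lookahead cost without a term that is the same for all schedules (`sum_stageCost_add`,
`lookaheadCost_eq`). For the periodic schedule this is `x̂ᵀ Pper x̂ + C` with a constant `C`, and the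
minimizing schedule costs at most as much. With `V l` the expectation of `x̂ᵀ Pper x̂` at time `l h`,
a block of the rollout policy thus costs at most `V l - V (l + 1) + C`, with equality for the
periodic policy, and telescoping suggests the average cost `C / h` as an upper bound for the one and
as a lower bound for the other.

What separates this from the claim is that the average cost is a sum of two upper limits, which can
exceed the upper limit of the sum. This is excluded by the convergence of the actuation rate. The
estimates at the times `l h` form a Markov chain, for which `x̂ᵀ Pper x̂` is a Lyapunov function and
whose transition laws from a bounded set dominate a common multiple of Lebesgue measure on a ball,
since the innovations are nondegenerate (`exists_integral_quad_blockKernel_le`,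
`exists_le_blockKernel`). By Harris' theorem (`exists_tendsto_integral`) the expected number of
actuations in a block converges (`exists_tendsto_sum_actuationProb`). The two bounds then hold for
the average cost (`limsup_average_add_le`, `le_limsup_average_add`), and the average cost of the
rollout policy is at most that of the periodic policy, even without the term `1 / h`.
-/

/-! ### Bilinear and quadratic forms of a matrix -/

section Forms

variable {m n l : ℕ}

/-- The bilinear form `xᵀ M y`. -/
def Matrix.bil (M : Matrix (Fin m) (Fin n) ℝ) (x : Vec m) (y : Vec n) : ℝ :=
  x.ofLp ⬝ᵥ (M *ᵥ y.ofLp)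

theorem Matrix.quad_eq_bil (M : Matrix (Fin n) (Fin n) ℝ) (x : Vec n) : M.quad x = M.bil x x := rfl

theorem Matrix.bil_add_left (M : Matrix (Fin m) (Fin n) ℝ) (x x' : Vec m) (y : Vec n) :
    M.bil (x + x') y = M.bil x y + M.bil x' y := by
  simp [Matrix.bil, add_dotProduct]

theorem Matrix.bil_add_right (M : Matrix (Fin m) (Fin n) ℝ) (x : Vec m) (y y' : Vec n) :
    M.bil x (y + y') = M.bil x y + M.bil x y' := by
  simp [Matrix.bil, dotProduct_add, mulVec_add]

theorem Matrix.bil_sub_left (M : Matrix (Fin m) (Fin n) ℝ) (x x' : Vec m) (y : Vec n) :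
    M.bil (x - x') y = M.bil x y - M.bil x' y := by
  simp [Matrix.bil, sub_dotProduct]

theorem Matrix.bil_sub_right (M : Matrix (Fin m) (Fin n) ℝ) (x : Vec m) (y y' : Vec n) :
    M.bil x (y - y') = M.bil x y - M.bil x y' := by
  simp [Matrix.bil, dotProduct_sub, mulVec_sub]

theorem Matrix.add_bil (M N : Matrix (Fin m) (Fin n) ℝ) (x : Vec m) (y : Vec n) :
    (M + N).bil x y = M.bil x y + N.bil x y := by
  simp [Matrix.bil, add_mulVec, dotProduct_add]

theorem Matrix.sub_bil (M N : Matrix (Fin m) (Fin n) ℝ) (x : Vec m) (y : Vec n) :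
    (M - N).bil x y = M.bil x y - N.bil x y := by
  simp [Matrix.bil, sub_mulVec, dotProduct_sub]

theorem Matrix.neg_bil (M : Matrix (Fin m) (Fin n) ℝ) (x : Vec m) (y : Vec n) :
    (-M).bil x y = -M.bil x y := by
  simp [Matrix.bil, neg_mulVec]

theorem Matrix.bil_act_right (M : Matrix (Fin m) (Fin n) ℝ) (N : Matrix (Fin n) (Fin l) ℝ)
    (x : Vec m) (y : Vec l) : M.bil x (N.act y) = (M * N).bil x y := by
  simp [Matrix.bil, Matrix.act, mulVec_mulVec]

theorem Matrix.bil_comm (M : Matrix (Fin m) (Fin n) ℝ) (x : Vec m) (y : Vec n) :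
    M.bil x y = Mᵀ.bil y x := by
  rw [Matrix.bil, Matrix.bil, mulVec_transpose, dotProduct_mulVec, dotProduct_comm]

theorem Matrix.bil_act_left (M : Matrix (Fin m) (Fin n) ℝ) (N : Matrix (Fin m) (Fin l) ℝ)
    (x : Vec l) (y : Vec n) : M.bil (N.act x) y = (Nᵀ * M).bil x y := by
  rw [bil_comm, bil_act_right, bil_comm]; simp

theorem Matrix.act_mul (M : Matrix (Fin m) (Fin n) ℝ) (N : Matrix (Fin n) (Fin l) ℝ) (x : Vec l) :
    (M * N).act x = M.act (N.act x) := by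
  simp [Matrix.act, mulVec_mulVec]

theorem Matrix.act_one (x : Vec n) : (1 : Matrix (Fin n) (Fin n) ℝ).act x = x := by
  simp [Matrix.act]

theorem Matrix.act_add (M : Matrix (Fin m) (Fin n) ℝ) (x y : Vec n) :
    M.act (x + y) = M.act x + M.act y := by
  simp [Matrix.act, mulVec_add]

theorem Matrix.act_sub (M : Matrix (Fin m) (Fin n) ℝ) (x y : Vec n) :
    M.act (x - y) = M.act x - M.act y := by
  simp [Matrix.act, mulVec_sub]

theorem Matrix.act_neg (M : Matrix (Fin m) (Fin n) ℝ) (x : Vec n) :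
    M.act (-x) = -M.act x := by
  simp [Matrix.act, mulVec_neg]

theorem Matrix.act_smul (M : Matrix (Fin m) (Fin n) ℝ) (c : ℝ) (x : Vec n) :
    M.act (c • x) = c • M.act x := by
  simp [Matrix.act, mulVec_smul]

theorem Matrix.act_zero (M : Matrix (Fin m) (Fin n) ℝ) : M.act (0 : Vec n) = 0 := by
  simp [Matrix.act]

theorem Matrix.add_act (M N : Matrix (Fin m) (Fin n) ℝ) (x : Vec n) :
    (M + N).act x = M.act x + N.act x := by
  simp [Matrix.act, add_mulVec]

theorem Matrix.sub_act (M N : Matrix (Fin m) (Fin n) ℝ) (x : Vec n) :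
    (M - N).act x = M.act x - N.act x := by
  simp [Matrix.act, sub_mulVec]

theorem Matrix.neg_act (M : Matrix (Fin m) (Fin n) ℝ) (x : Vec n) : (-M).act x = -M.act x := by
  ext i
  simp [Matrix.act, neg_mulVec]

theorem Matrix.zero_act (x : Vec n) : (0 : Matrix (Fin m) (Fin n) ℝ).act x = 0 := by
  simp [Matrix.act]

theorem Matrix.continuous_act (M : Matrix (Fin m) (Fin n) ℝ) : Continuous M.act := by
  unfold Matrix.act; fun_prop

theorem Matrix.measurable_act (M : Matrix (Fin m) (Fin n) ℝ) : Measurable M.act :=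
  M.continuous_act.measurable

theorem Matrix.continuous_quad (M : Matrix (Fin n) (Fin n) ℝ) : Continuous M.quad := by
  unfold Matrix.quad dotProduct; fun_prop

theorem Matrix.quad_add (M : Matrix (Fin n) (Fin n) ℝ) (hM : Mᵀ = M) (x y : Vec n) :
    M.quad (x + y) = M.quad x + M.quad y + 2 * M.bil x y := by
  rw [quad_eq_bil, bil_add_left, bil_add_right, bil_add_right, M.bil_comm y x, hM, quad_eq_bil,
    quad_eq_bil]
  ring

theorem Matrix.quad_sub (M : Matrix (Fin n) (Fin n) ℝ) (hM : Mᵀ = M) (x y : Vec n) :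
    M.quad (x - y) = M.quad x + M.quad y - 2 * M.bil x y := by
  rw [quad_eq_bil, bil_sub_left, bil_sub_right, bil_sub_right, M.bil_comm y x, hM, quad_eq_bil,
    quad_eq_bil]
  ring

theorem Matrix.quad_act (M : Matrix (Fin m) (Fin m) ℝ) (N : Matrix (Fin m) (Fin n) ℝ) (x : Vec n) :
    M.quad (N.act x) = (Nᵀ * M * N).quad x := by
  rw [quad_eq_bil, bil_act_left, bil_act_right]; rfl

theorem Matrix.quad_zero (M : Matrix (Fin n) (Fin n) ℝ) : M.quad 0 = 0 := by
  simp [Matrix.quad]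

theorem Matrix.quad_smul (M : Matrix (Fin n) (Fin n) ℝ) (c : ℝ) (x : Vec n) :
    M.quad (c • x) = c ^ 2 * M.quad x := by
  simp [Matrix.quad, mulVec_smul]; ring

theorem Matrix.add_quad (M N : Matrix (Fin n) (Fin n) ℝ) (x : Vec n) :
    (M + N).quad x = M.quad x + N.quad x := M.add_bil N x x

theorem Matrix.PosSemidef.quad_nonneg {M : Matrix (Fin n) (Fin n) ℝ} (hM : M.PosSemidef)
    (x : Vec n) : 0 ≤ M.quad x := by
  simpa [Matrix.quad] using hM.dotProduct_mulVec_nonneg x.ofLp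

theorem Matrix.PosDef.quad_pos {M : Matrix (Fin n) (Fin n) ℝ} (hM : M.PosDef)
    {x : Vec n} (hx : x ≠ 0) : 0 < M.quad x := by
  have : x.ofLp ≠ 0 := by simpa using hx
  simpa [Matrix.quad] using hM.dotProduct_mulVec_pos this

theorem Matrix.PosSemidef.transpose_eq {M : Matrix (Fin n) (Fin n) ℝ} (hM : M.PosSemidef) :
    Mᵀ = M := by simpa [Matrix.IsHermitian] using hM.1

theorem Matrix.posSemidef_of_quad {M : Matrix (Fin n) (Fin n) ℝ} (hM : Mᵀ = M)
    (h : ∀ x, 0 ≤ M.quad x) : M.PosSemidef := by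
  refine PosSemidef.of_dotProduct_mulVec_nonneg (by simpa [Matrix.IsHermitian] using hM) fun x => ?_
  simpa [Matrix.quad] using h (WithLp.toLp 2 x)

theorem Matrix.posDef_of_quad {M : Matrix (Fin n) (Fin n) ℝ} (hM : Mᵀ = M)
    (h : ∀ x, x ≠ 0 → 0 < M.quad x) : M.PosDef := by
  refine PosDef.of_dotProduct_mulVec_pos (by simpa [Matrix.IsHermitian] using hM) fun x hx => ?_
  simpa [Matrix.quad] using h (WithLp.toLp 2 x) (by simpa using hx)

/-- Symmetric matrices are determined by their quadratic forms. -/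
theorem Matrix.eq_of_quad {M N : Matrix (Fin n) (Fin n) ℝ} (hM : Mᵀ = M) (hN : Nᵀ = N)
    (h : ∀ x, M.quad x = N.quad x) : M = N := by
  have hb : ∀ x y, M.bil x y = N.bil x y := fun x y => by
    have := h (x + y)
    rw [quad_add M hM, quad_add N hN, h, h] at this
    linarith
  ext i j
  have := hb (WithLp.toLp 2 (Pi.single i 1)) (WithLp.toLp 2 (Pi.single j 1))
  simpa [Matrix.bil] using this

/-- A positive definite quadratic form dominates a multiple of the squared norm, and hence of any
other quadratic form. -/
theorem Matrix.PosDef.exists_mul_norm_sq_le {M : Matrix (Fin n) (Fin n) ℝ} (hM : M.PosDef) :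
    ∃ c, 0 < c ∧ ∀ x : Vec n, c * ‖x‖ ^ 2 ≤ M.quad x := by
  by_cases hn : ∃ z : Vec n, z ≠ 0
  · obtain ⟨z, hz⟩ := hn
    have : Nontrivial (Vec n) := ⟨z, 0, hz⟩
    obtain ⟨y, hy, hmin⟩ := (isCompact_sphere (0 : Vec n) 1).exists_isMinOn
      (NormedSpace.sphere_nonempty.2 zero_le_one) M.continuous_quad.continuousOn
    have hy1 : ‖y‖ = 1 := by simpa using hy
    refine ⟨M.quad y, hM.quad_pos (by rintro rfl; simp at hy1), fun x => ?_⟩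
    by_cases hx : x = 0
    · simp [hx, quad_zero]
    have hx' : ‖x‖ ≠ 0 := by simpa using hx
    have h1 : M.quad y ≤ M.quad (‖x‖⁻¹ • x) := hmin (by simp [norm_smul, hx'])
    rw [quad_smul] at h1
    calc M.quad y * ‖x‖ ^ 2 ≤ (‖x‖⁻¹ ^ 2 * M.quad x) * ‖x‖ ^ 2 := by gcongr
      _ = M.quad x := by field_simp
  · push Not at hn
    exact ⟨1, one_pos, fun x => by simp [hn x, quad_zero]⟩

theorem Matrix.exists_norm_act_le (M : Matrix (Fin m) (Fin n) ℝ) :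
    ∃ c, 0 ≤ c ∧ ∀ x : Vec n, ‖M.act x‖ ≤ c * ‖x‖ := by
  let L : Vec n →L[ℝ] Vec m :=
    { toFun := M.act, map_add' := M.act_add, map_smul' := M.act_smul, cont := M.continuous_act }
  exact ⟨‖L‖, norm_nonneg _, L.le_opNorm⟩

theorem Matrix.inner_act (M : Matrix (Fin m) (Fin n) ℝ) (x : Vec m) (y : Vec n) :
    inner ℝ x (M.act y) = M.bil x y := by
  simp [Matrix.bil, Matrix.act, PiLp.inner_apply, dotProduct, mul_comm]

theorem Matrix.exists_abs_quad_le (M : Matrix (Fin n) (Fin n) ℝ) :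
    ∃ c, 0 ≤ c ∧ ∀ x : Vec n, |M.quad x| ≤ c * ‖x‖ ^ 2 := by
  obtain ⟨c, hc, h⟩ := M.exists_norm_act_le
  refine ⟨c, hc, fun x => ?_⟩
  rw [quad_eq_bil, ← inner_act]
  calc |inner ℝ x (M.act x)| ≤ ‖x‖ * ‖M.act x‖ := abs_real_inner_le_norm _ _
    _ ≤ ‖x‖ * (c * ‖x‖) := by gcongr; exact h x
    _ = c * ‖x‖ ^ 2 := by ring

end Forms

/-! ### Backward Riccati steps -/

namespace CodesignProblem

variable {nx nu ny : ℕ} (S : CodesignProblem nx nu ny)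

theorem posDef_inputWeight (hR : S.R.PosDef) {P : Matrix (Fin nx) (Fin nx) ℝ} (hP : P.PosSemidef) :
    (S.Bᵀ * P * S.B + S.R).PosDef := by
  have := hP.conjTranspose_mul_mul_same S.B
  exact PosDef.posSemidef_add (by simpa using this) hR

theorem riccatiStep_transpose (hR : S.R.PosDef) (hQ : S.Q.PosDef) (δ : Bool)
    {P : Matrix (Fin nx) (Fin nx) ℝ} (hP : P.PosSemidef) :
    (S.riccatiStep δ P)ᵀ = S.riccatiStep δ P := by
  have h1 := hP.transpose_eq
  have h2 := hQ.posSemidef.transpose_eq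
  have h3 := hR.posSemidef.transpose_eq
  cases δ <;> simp [riccatiStep, transpose_nonsing_inv, h1, h2, h3, Matrix.mul_assoc]

/-- Completion of the square: the cost of applying the input `u` at `x`, with cost-to-go `P`. -/
theorem stage_add_costToGo (hR : S.R.PosDef)
    {P : Matrix (Fin nx) (Fin nx) ℝ} (hP : P.PosSemidef) (x : Vec nx) (u : Vec nu) :
    S.Q.quad x + S.R.quad u + P.quad (S.A.act x + S.B.act u)
      = (S.riccatiStep true P).quad x
        + (S.Bᵀ * P * S.B + S.R).quad (u - (S.stepGain P).act x) := by
  have hH := S.posDef_inputWeight hR hP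
  have hPt := hP.transpose_eq
  have hHt := hH.posSemidef.transpose_eq
  obtain ⟨H, hHdef⟩ : ∃ H, H = S.Bᵀ * P * S.B + S.R := ⟨_, rfl⟩
  rw [← hHdef] at hH hHt ⊢
  have hu : IsUnit H.det := hH.det_pos.ne'.isUnit
  rw [quad_add P hPt, quad_sub H hHt, quad_act, quad_act, quad_act, bil_act_left, bil_act_right,
    bil_act_right]
  have hHF : H * S.stepGain P = -(S.Bᵀ * P * S.A) := by
    simp only [stepGain, ← hHdef, Matrix.mul_neg, ← Matrix.mul_assoc, mul_nonsing_inv _ hu,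
      Matrix.one_mul]
  have hFt : (S.stepGain P)ᵀ = -(S.Aᵀ * P * S.B * H⁻¹) := by
    rw [stepGain, ← hHdef]
    simp [transpose_nonsing_inv, hHt, hPt, Matrix.mul_assoc]
  have hFHF : (S.stepGain P)ᵀ * H * S.stepGain P = S.Aᵀ * P * S.B * H⁻¹ * (S.Bᵀ * P * S.A) := by
    rw [Matrix.mul_assoc, hHF, hFt]; simp
  rw [hHF, hFHF, neg_bil]
  have e1 : (S.Aᵀ * P * S.B).bil x u = (S.Bᵀ * P * S.A).bil u x := by
    rw [bil_comm]; simp [hPt, Matrix.mul_assoc]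
  rw [e1]
  have e2 : S.riccatiStep true P
      = S.Q + S.Aᵀ * P * S.A - S.Aᵀ * P * S.B * H⁻¹ * (S.Bᵀ * P * S.A) := by
    rw [hHdef]; simp [riccatiStep, Matrix.mul_assoc]
  have e3 : (S.Bᵀ * P * S.B).bil u u = H.bil u u - S.R.bil u u := by rw [hHdef, add_bil]; ring
  simp only [e2, quad_eq_bil, sub_bil, add_bil, e3]
  ring

theorem riccatiStep_false_quad (P : Matrix (Fin nx) (Fin nx) ℝ) (x : Vec nx) :
    (S.riccatiStep false P).quad x = S.Q.quad x + P.quad (S.A.act x) := by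
  rw [quad_act]; simp [riccatiStep, Matrix.add_quad]

/-- The cost of one step under the optimal input. -/
theorem riccatiStep_quad (hR : S.R.PosDef) (δ : Bool)
    {P : Matrix (Fin nx) (Fin nx) ℝ} (hP : P.PosSemidef) (x : Vec nx) :
    (S.riccatiStep δ P).quad x
      = S.Q.quad x + S.R.quad (if δ then (S.stepGain P).act x else 0)
        + P.quad (S.A.act x + S.B.act (if δ then (S.stepGain P).act x else 0)) := by
  cases δ
  · simp [riccatiStep_false_quad, act_zero, quad_zero]
  · simp [stage_add_costToGo S hR hP, quad_zero]

/-- One actuated Riccati step gives the minimum over all inputs of the stage cost plus the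
cost-to-go. -/
theorem riccatiStep_true_quad_le (hR : S.R.PosDef)
    {P : Matrix (Fin nx) (Fin nx) ℝ} (hP : P.PosSemidef) (x : Vec nx) (u : Vec nu) :
    (S.riccatiStep true P).quad x ≤ S.Q.quad x + S.R.quad u + P.quad (S.A.act x + S.B.act u) := by
  rw [stage_add_costToGo S hR hP]
  have := (S.posDef_inputWeight hR hP).posSemidef.quad_nonneg (u - (S.stepGain P).act x)
  linarith

theorem quad_le_riccatiStep_quad (hR : S.R.PosDef) (δ : Bool)
    {P : Matrix (Fin nx) (Fin nx) ℝ} (hP : P.PosSemidef) (x : Vec nx) :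
    S.Q.quad x ≤ (S.riccatiStep δ P).quad x := by
  rw [riccatiStep_quad S hR δ hP]
  have h1 := hR.posSemidef.quad_nonneg (if δ then (S.stepGain P).act x else 0)
  have h2 := hP.quad_nonneg (S.A.act x + S.B.act (if δ then (S.stepGain P).act x else 0))
  linarith

theorem posDef_riccatiStep (hR : S.R.PosDef) (hQ : S.Q.PosDef) (δ : Bool)
    {P : Matrix (Fin nx) (Fin nx) ℝ} (hP : P.PosSemidef) : (S.riccatiStep δ P).PosDef :=
  posDef_of_quad (S.riccatiStep_transpose hR hQ δ hP) fun x hx =>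
    (hQ.quad_pos hx).trans_le (S.quad_le_riccatiStep_quad hR δ hP x)

theorem riccatiStep_mono (hR : S.R.PosDef) (δ : Bool)
    {P P' : Matrix (Fin nx) (Fin nx) ℝ} (hP : P.PosSemidef) (hP' : P'.PosSemidef)
    (h : ∀ x, P.quad x ≤ P'.quad x) (x : Vec nx) :
    (S.riccatiStep δ P).quad x ≤ (S.riccatiStep δ P').quad x := by
  cases δ
  · rw [riccatiStep_false_quad, riccatiStep_false_quad]
    gcongr
    exact h _
  · rw [riccatiStep_quad S hR true hP']
    exact (S.riccatiStep_true_quad_le hR hP x _).trans (by gcongr; exact h _)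

theorem posSemidef_iterate_riccatiStep (hR : S.R.PosDef) (hQ : S.Q.PosDef)
    {P : Matrix (Fin nx) (Fin nx) ℝ} (hP : P.PosSemidef) (j : ℕ) :
    ((S.riccatiStep false)^[j] P).PosSemidef := by
  induction j with
  | zero => exact hP
  | succ j ih =>
    rw [Function.iterate_succ_apply']
    exact (S.posDef_riccatiStep hR hQ false ih).posSemidef

theorem iterate_riccatiStep_false (P : Matrix (Fin nx) (Fin nx) ℝ) (j : ℕ) :
    (S.riccatiStep false)^[j] P
      = ∑ i ∈ Finset.range j, (S.A ^ i)ᵀ * S.Q * S.A ^ i + (S.A ^ j)ᵀ * P * S.A ^ j := by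
  induction j with
  | zero => simp
  | succ j ih =>
    rw [Function.iterate_succ_apply', ih, Finset.sum_range_succ']
    simp only [riccatiStep, Bool.false_eq_true, if_false, pow_succ, transpose_mul, Matrix.mul_add,
      Matrix.add_mul, Finset.mul_sum, Finset.sum_mul, pow_zero, transpose_one, Matrix.one_mul,
      Matrix.mul_one, Matrix.mul_assoc]
    abel

/-- One period of the backward Riccati recursion for the schedule that actuates only at the start of
the period. -/
noncomputable def periodStep (P : Matrix (Fin nx) (Fin nx) ℝ) : Matrix (Fin nx) (Fin nx) ℝ :=
  S.riccatiStep true ((S.riccatiStep false)^[S.p - 1] P)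

end CodesignProblem

/-! ### Null controllability of the sampled pair -/

section Controllability

open Polynomial in
/-- An endomorphism over `ℂ` without nonzero eigenvalue is nilpotent. -/
theorem Module.End.isNilpotent_of_forall_hasEigenvalue {V : Type*} [AddCommGroup V] [Module ℂ V]
    [FiniteDimensional ℂ V] (f : Module.End ℂ V) (h : ∀ z, f.HasEigenvalue z → z = 0) :
    IsNilpotent f := by
  have hmon := minpoly.monic (Algebra.IsIntegral.isIntegral (R := ℂ) f)
  have hroots : (minpoly ℂ f).roots = Multiset.replicate (Multiset.card (minpoly ℂ f).roots) 0 :=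
    Multiset.eq_replicate_card.2 fun z hz =>
      h z (Module.End.hasEigenvalue_iff_isRoot.2 (isRoot_of_mem_roots hz))
  have hprod := (IsAlgClosed.splits (minpoly ℂ f)).eq_prod_roots_of_monic hmon
  rw [hroots] at hprod
  refine ⟨Multiset.card (minpoly ℂ f).roots, ?_⟩
  have := minpoly.aeval ℂ f
  rw [hprod] at this
  simpa using this

variable {n m : ℕ}

open Polynomial in
/-- A left eigenvector of `A ^ p` for a nonzero eigenvalue `c` is a left eigenvector of `A`, if
`A` has at most one eigenvalue that is a `p`-th root of `c`: this root is a simple root of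
`X ^ p - c`, and the cofactor does not vanish on the spectrum, so that it is invertible at `A`. -/
theorem Matrix.exists_vecMul_eq_smul_of_pow {A : Matrix (Fin n) (Fin n) ℂ} {p : ℕ} (hp : 0 < p)
    (heig : ∀ z₁ ∈ spectrum ℂ A, ∀ z₂ ∈ spectrum ℂ A, z₁ ^ p = z₂ ^ p → z₁ = z₂)
    {q : Fin n → ℂ} {c : ℂ} (hc : c ≠ 0) (hq : q ᵥ* A ^ p = c • q) :
    ∃ z : ℂ, q ᵥ* A = z • q := by
  -- a monic polynomial without root in the spectrum is injective on row vectors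
  have key : ∀ (f : ℂ[X]), f.Monic → (∀ z ∈ spectrum ℂ A, f.eval z ≠ 0) → ∀ r : Fin n → ℂ,
      r ᵥ* (aeval A f) = 0 → r = 0 := by
    intro f hf hz r hr
    have hu : IsUnit (aeval A f) := by
      by_contra hnu
      rw [(IsAlgClosed.splits f).eq_prod_roots_of_monic hf] at hnu
      obtain ⟨k, hk, hk0⟩ := spectrum.exists_mem_of_not_isUnit_aeval_prod hnu
      exact hz k hk hk0
    have h1 : r ᵥ* (aeval A f) ᵥ* (aeval A f)⁻¹ = r := by
      rw [vecMul_vecMul, mul_nonsing_inv _ ((isUnit_iff_isUnit_det _).1 hu), vecMul_one]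
    rw [← h1, hr, zero_vecMul]
  set f : ℂ[X] := X ^ p - C c with hf
  have hfm : f.Monic := monic_X_pow_sub_C c hp.ne'
  have hfq : q ᵥ* (aeval A f) = 0 := by
    simp [hf, vecMul_sub, hq, Algebra.algebraMap_eq_smul_one, vecMul_smul]
  by_cases hex : ∃ z ∈ spectrum ℂ A, f.eval z = 0
  · obtain ⟨z, hz, hz0⟩ := hex
    refine ⟨z, ?_⟩
    have hdiv : (X - C z) * (f /ₘ (X - C z)) = f := mul_divByMonic_eq_iff_isRoot.2 hz0
    set g := f /ₘ (X - C z) with hg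
    have hgm : g.Monic := (monic_X_sub_C z).of_mul_monic_left (hdiv ▸ hfm)
    have hzp : z ^ p = c := by simpa [hf, sub_eq_zero] using hz0
    have hz' : z ≠ 0 := by rintro rfl; rw [zero_pow hp.ne'] at hzp; exact hc hzp.symm
    have hgz : g.eval z ≠ 0 := by
      intro h0
      have hd : (derivative f).eval z = 0 := by rw [← hdiv]; simp [h0]
      simp [hf, derivative_X_pow, hp.ne', hz'] at hd
    have := key g hgm (fun k hk hk0 => by
      have hfk : f.eval k = 0 := by rw [← hdiv]; simp [hk0]
      have hkp : k ^ p = c := by simpa [hf, sub_eq_zero] using hfk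
      exact hgz (heig k hk z hz (hkp.trans hzp.symm) ▸ hk0)) (q ᵥ* (aeval A (X - C z)))
      (by rw [vecMul_vecMul, ← map_mul, hdiv, hfq])
    rw [map_sub, aeval_X, aeval_C, vecMul_sub, sub_eq_zero] at this
    rw [this, Algebra.algebraMap_eq_smul_one, vecMul_smul, vecMul_one]
  · push Not at hex
    exact ⟨0, by simp [key f hfm hex q hfq]⟩

/-- The rows that annihilate all `A ^ (p j) B` are annihilated by a power of `A ^ p`. -/
theorem Matrix.exists_vecMul_pow_eq_zero {A : Matrix (Fin n) (Fin n) ℂ}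
    {B : Matrix (Fin n) (Fin m) ℂ} {p : ℕ} (hp : 0 < p)
    (heig : ∀ z₁ ∈ spectrum ℂ A, ∀ z₂ ∈ spectrum ℂ A, z₁ ^ p = z₂ ^ p → z₁ = z₂)
    (hAB : ∀ q : Fin n → ℂ, (∀ j : ℕ, q ᵥ* (A ^ j * B) = 0) → q = 0) :
    ∃ N : ℕ, ∀ q : Fin n → ℂ, (∀ j : ℕ, q ᵥ* ((A ^ p) ^ j * B) = 0) → q ᵥ* (A ^ p) ^ N = 0 := by
  -- `O` consists of the rows that annihilate all `(A ^ p) ^ j * B`; it is invariant under the right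
  -- action `T` of `A ^ p`. An eigenvector of `T` in `O` with nonzero eigenvalue would be a left
  -- eigenvector of `A` that annihilates `B`, against the controllability. So `T` is nilpotent on
  -- `O`.
  let T : Module.End ℂ (Fin n → ℂ) := (A ^ p).vecMulLinear
  have hTpow : ∀ (N : ℕ) q, (T ^ N) q = q ᵥ* (A ^ p) ^ N := by
    intro N
    induction N with
    | zero => intro q; simp
    | succ N ih =>
      intro q
      rw [pow_succ', Module.End.mul_apply, ih]
      simp [T, pow_succ]
  let O : Submodule ℂ (Fin n → ℂ) :=
    { carrier := {q | ∀ j : ℕ, q ᵥ* ((A ^ p) ^ j * B) = 0}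
      zero_mem' := fun j => zero_vecMul _
      add_mem' := fun ha hb j => by rw [add_vecMul, ha j, hb j, add_zero]
      smul_mem' := fun c q hq j => by rw [smul_vecMul, hq j, smul_zero] }
  have hTO : ∀ q ∈ O, T q ∈ O := fun q hq j => by
    have := hq (j + 1)
    rw [pow_succ', Matrix.mul_assoc] at this
    simpa [T, vecMul_vecMul] using this
  have hnil : IsNilpotent (T.restrict hTO) := by
    refine Module.End.isNilpotent_of_forall_hasEigenvalue _ fun c hc => ?_
    by_contra hc0
    obtain ⟨⟨q, hqO⟩, hq⟩ := hc.exists_hasEigenvector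
    have h1 : q ᵥ* A ^ p = c • q := congrArg Subtype.val hq.apply_eq_smul
    obtain ⟨z, hz⟩ := exists_vecMul_eq_smul_of_pow hp heig hc0 h1
    have hzj : ∀ j : ℕ, q ᵥ* A ^ j = z ^ j • q := fun j => by
      induction j with
      | zero => simp
      | succ j ih => rw [pow_succ, ← vecMul_vecMul, ih, smul_vecMul, hz, smul_smul, pow_succ]
    have hB : q ᵥ* B = 0 := by simpa using hqO 0
    refine hq.2 (Subtype.ext (hAB q fun j => ?_))
    rw [← vecMul_vecMul, hzj, smul_vecMul, hB, smul_zero]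
  obtain ⟨N, hN⟩ := hnil
  refine ⟨N, fun q hq => ?_⟩
  have h2 : (T.restrict hTO ^ N) ⟨q, hq⟩ = 0 := by rw [hN]; rfl
  rw [Module.End.pow_restrict] at h2
  rw [← hTpow]
  exact congrArg Subtype.val h2

/-- A row that annihilates all `A ^ j * B` is zero: those with `j < n` are the blocks of the
controllability matrix, whose rows are linearly independent. -/
theorem IsControllable.eq_zero {A : Matrix (Fin n) (Fin n) ℝ} {B : Matrix (Fin n) (Fin m) ℝ}
    (h : IsControllable A B) {q : Fin n → ℝ} (hq : ∀ j : ℕ, q ᵥ* (A ^ j * B) = 0) : q = 0 := by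
  set M := Matrix.of fun (i : Fin n) (jk : Fin n × Fin m) => (A ^ (jk.1 : ℕ) * B) i jk.2 with hM
  have hr : M.rank = n := h
  have hli : LinearIndependent ℝ M.row := by
    rw [linearIndependent_iff_card_eq_finrank_span, Set.finrank, ← rank_eq_finrank_span_row, hr]
    simp
  refine vecMul_injective_iff.2 hli ?_
  ext jk
  simpa [vecMul, dotProduct, hM] using congrFun (hq jk.1) jk.2

/-- Nonresonance says that `z ↦ z ^ p` is injective on the spectrum. -/
theorem EigenvalueNonresonant.eq_of_pow_eq {A : Matrix (Fin n) (Fin n) ℝ} {p : ℕ} (hp : 0 < p)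
    (h : EigenvalueNonresonant A p) :
    ∀ z₁ ∈ spectrum ℂ (A.map (fun r : ℝ => (r : ℂ))),
      ∀ z₂ ∈ spectrum ℂ (A.map (fun r : ℝ => (r : ℂ))), z₁ ^ p = z₂ ^ p → z₁ = z₂ := by
  intro z₁ h₁ z₂ h₂ hpow
  by_contra hne
  by_cases hz : z₂ = 0
  · subst hz
    rw [zero_pow hp.ne'] at hpow
    exact hne (pow_eq_zero_iff hp.ne' |>.1 hpow)
  · have hq : (z₁ / z₂) ^ p = 1 := by rw [div_pow, hpow, div_self (pow_ne_zero _ hz)]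
    have : NeZero p := ⟨hp.ne'⟩
    obtain ⟨i, -, hi⟩ := (Complex.isPrimitiveRoot_exp p hp.ne').eq_pow_of_pow_eq_one hq
    refine h z₁ h₁ z₂ h₂ hne i ?_
    rw [← Complex.exp_nat_mul] at hi
    have hexp : Complex.exp (2 * Real.pi * (i : ℤ) * Complex.I / p) = z₁ / z₂ := by
      rw [← hi]
      congr 1
      push_cast
      ring
    rw [hexp, mul_div_cancel₀ _ hz]

/-- The real form of `Matrix.exists_vecMul_pow_eq_zero`. -/
theorem IsControllable.exists_vecMul_pow_eq_zero {A : Matrix (Fin n) (Fin n) ℝ}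
    {B : Matrix (Fin n) (Fin m) ℝ} (h : IsControllable A B) {p : ℕ} (hp : 0 < p)
    (heig : EigenvalueNonresonant A p) :
    ∃ N : ℕ, ∀ q : Fin n → ℝ, (∀ j : ℕ, q ᵥ* ((A ^ p) ^ j * B) = 0) → q ᵥ* (A ^ p) ^ N = 0 := by
  have hmap : ∀ {k l : ℕ} (M : Matrix (Fin k) (Fin l) ℝ),
      M.map (fun r : ℝ => (r : ℂ)) = M.map Complex.ofRealHom := fun M => rfl
  -- if a complex row annihilates a real matrix, so do its real and imaginary parts
  have hre : ∀ {k l : ℕ} (M : Matrix (Fin k) (Fin l) ℝ) (q : Fin k → ℂ),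
      q ᵥ* M.map Complex.ofRealHom = 0 →
        (fun i => (q i).re) ᵥ* M = 0 ∧ (fun i => (q i).im) ᵥ* M = 0 := by
    intro k l M q hq
    constructor <;> ext j
    · simpa [vecMul, dotProduct] using congrArg Complex.re (congrFun hq j)
    · simpa [vecMul, dotProduct] using congrArg Complex.im (congrFun hq j)
  have hC : ∀ {k l : ℕ} (M : Matrix (Fin k) (Fin l) ℝ) (q : Fin k → ℝ),
      (fun i => (q i : ℂ)) ᵥ* M.map Complex.ofRealHom = fun j => (((q ᵥ* M) j : ℝ) : ℂ) := by
    intro k l M q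
    ext j
    simp [vecMul, dotProduct]
  have hmp : ∀ j : ℕ, (A.map Complex.ofRealHom) ^ j = (A ^ j).map Complex.ofRealHom := fun j =>
    (Complex.ofRealHom.mapMatrix.map_pow A j).symm
  obtain ⟨N, hN⟩ := Matrix.exists_vecMul_pow_eq_zero (A := A.map Complex.ofRealHom)
    (B := B.map Complex.ofRealHom) hp (heig.eq_of_pow_eq hp) (fun q hq => by
      have h0 : ∀ j, _ := fun j => hre (A ^ j * B) q (by
        rw [Matrix.map_mul, ← hmp]; exact hq j)
      have h1 := h.eq_zero fun j => (h0 j).1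
      have h2 := h.eq_zero fun j => (h0 j).2
      ext i
      exact Complex.ext (congrFun h1 i) (congrFun h2 i))
  refine ⟨N, fun q hq => ?_⟩
  have := hN (fun i => (q i : ℂ)) (fun j => by
    rw [← pow_mul, hmp, ← Matrix.map_mul, hC, pow_mul, hq]; simp; rfl)
  rw [← pow_mul, hmp, hC, pow_mul] at this
  ext j
  simpa using congrFun this j

/-- Under nonresonant sampling, every state is steered to the origin by the sampled pair
`(A ^ p, A ^ (p - 1) B)` in a finite number of steps, the same number for all states. The pair need
not be controllable when `A` is singular. -/
theorem IsControllable.exists_null_control {A : Matrix (Fin n) (Fin n) ℝ}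
    {B : Matrix (Fin n) (Fin m) ℝ} (h : IsControllable A B) {p : ℕ} (hp : 0 < p)
    (heig : EigenvalueNonresonant A p) :
    ∃ K : ℕ, ∀ x : Fin n → ℝ, ∃ u : ℕ → Fin m → ℝ,
      (A ^ p) ^ K *ᵥ x = ∑ i ∈ Finset.range K, ((A ^ p) ^ i * (A ^ (p - 1) * B)) *ᵥ u i := by
  obtain ⟨N, hN⟩ := h.exists_vecMul_pow_eq_zero hp heig
  -- `f K` maps `K` inputs to the state reached by the pair `(A ^ p, B)`; its ranges increase with
  -- `K`, and are constant from `K₀` on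
  let f : ℕ → (ℕ → Fin m → ℝ) →ₗ[ℝ] (Fin n → ℝ) := fun K =>
    ∑ i ∈ Finset.range K, ((A ^ p) ^ i * B).mulVecLin ∘ₗ LinearMap.proj i
  have hf : ∀ K u, f K u = ∑ i ∈ Finset.range K, ((A ^ p) ^ i * B) *ᵥ u i := fun K u => by
    simp [f, LinearMap.sum_apply]
  have hmono : Monotone fun K => LinearMap.range (f K) := by
    rintro K L hKL _ ⟨u, rfl⟩
    refine ⟨fun i => if i < K then u i else 0, ?_⟩
    rw [hf, hf]
    refine (Finset.sum_subset (Finset.range_mono hKL) fun i _ hi => ?_).symm.trans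
      (Finset.sum_congr rfl fun i hi => ?_)
    · rw [Finset.mem_range] at hi
      simp [hi]
    · rw [Finset.mem_range] at hi
      simp [hi]
  obtain ⟨K₀, hK₀⟩ := monotone_stabilizes_iff_noetherian.2
    (inferInstance : IsNoetherian ℝ (Fin n → ℝ)) ⟨_, hmono⟩
  have hall : ∀ L, LinearMap.range (f L) ≤ LinearMap.range (f K₀) := fun L => by
    rcases le_total L K₀ with hL | hL
    · exact hmono hL
    · exact (hK₀ L hL).ge
  -- otherwise some functional vanishes on the states that can be reached, but not at this state; as
  -- a row it annihilates all `(A ^ p) ^ j * B`, so it is annihilated by `(A ^ p) ^ N`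
  have hmem : ∀ x, (A ^ p) ^ N *ᵥ x ∈ LinearMap.range (f K₀) := by
    intro x
    by_contra hx
    obtain ⟨g, hg, hker⟩ := Submodule.exists_le_ker_of_notMem hx
    have hgq : ∀ y, g y = (fun i => g (Pi.single i 1)) ⬝ᵥ y := fun y => by
      conv_lhs => rw [pi_eq_sum_univ' y]
      simp only [map_sum, map_smul, dotProduct, smul_eq_mul, mul_comm]
    set q : Fin n → ℝ := fun i => g (Pi.single i 1)
    have hq := hN q fun j => by
      refine dotProduct_eq_zero _ fun v => ?_
      rw [← dotProduct_mulVec, ← hgq]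
      refine hker (hall (j + 1) ⟨fun i => if i = j then v else 0, ?_⟩)
      rw [hf, Finset.sum_range_succ, Finset.sum_eq_zero]
      · simp
      · intro i hi
        simp [(Finset.mem_range.1 hi).ne]
    exact hg (by rw [hgq, dotProduct_mulVec, hq, zero_dotProduct])
  -- the input acts through `A ^ (p - 1) * B`: the state `A x` is steered by `B`, and `A ^ (p - 1)`
  -- is applied to both sides, which costs one more step
  refine ⟨max K₀ N + 1, fun x => ?_⟩
  obtain ⟨u, hu⟩ : (A ^ p) ^ (max K₀ N) *ᵥ (A *ᵥ x) ∈ LinearMap.range (f (max K₀ N + 1)) := by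
    have := hmono (show K₀ ≤ max K₀ N + 1 by omega)
      (hmem ((A ^ p) ^ (max K₀ N - N) *ᵥ (A *ᵥ x)))
    rwa [mulVec_mulVec _ ((A ^ p) ^ N), ← pow_add, Nat.add_sub_cancel' (le_max_right _ _)] at this
  refine ⟨u, ?_⟩
  obtain ⟨p, rfl⟩ : ∃ p', p = p' + 1 := ⟨p - 1, by omega⟩
  have h1 := congrArg (A ^ p *ᵥ ·) hu
  simp only [hf] at h1
  rw [mulVec_sum] at h1
  simp only [Nat.add_sub_cancel]
  calc (A ^ (p + 1)) ^ (max K₀ N + 1) *ᵥ x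
      = A ^ p *ᵥ ((A ^ (p + 1)) ^ (max K₀ N) *ᵥ (A *ᵥ x)) := by
        rw [mulVec_mulVec, mulVec_mulVec]
        congr 1
        simp only [← pow_mul, ← pow_add, ← pow_succ]
        congr 1
        ring
    _ = _ := by
        rw [← h1]
        refine Finset.sum_congr rfl fun i _ => ?_
        rw [mulVec_mulVec]
        congr 1
        simp only [← Matrix.mul_assoc, ← pow_mul, ← pow_add]
        congr 2
        ring

end Controllability

/-! ### The periodic Riccati equation -/

namespace CodesignProblem

variable {nx nu ny : ℕ} (S : CodesignProblem nx nu ny)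

theorem iterate_riccatiStep_false_quad (P : Matrix (Fin nx) (Fin nx) ℝ) (j : ℕ) (x : Vec nx) :
    ((S.riccatiStep false)^[j] P).quad x
      = ((S.riccatiStep false)^[j] 0).quad x + P.quad ((S.A ^ j).act x) := by
  rw [iterate_riccatiStep_false, iterate_riccatiStep_false, quad_act]
  simp [add_quad]

theorem posDef_periodStep (hR : S.R.PosDef) (hQ : S.Q.PosDef)
    {P : Matrix (Fin nx) (Fin nx) ℝ} (hP : P.PosSemidef) : (S.periodStep P).PosDef :=
  S.posDef_riccatiStep hR hQ true (S.posSemidef_iterate_riccatiStep hR hQ hP _)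

theorem periodStep_mono (hR : S.R.PosDef) (hQ : S.Q.PosDef)
    {P P' : Matrix (Fin nx) (Fin nx) ℝ} (hP : P.PosSemidef) (hP' : P'.PosSemidef)
    (h : ∀ x, P.quad x ≤ P'.quad x) (x : Vec nx) :
    (S.periodStep P).quad x ≤ (S.periodStep P').quad x := by
  refine S.riccatiStep_mono hR true (S.posSemidef_iterate_riccatiStep hR hQ hP _)
    (S.posSemidef_iterate_riccatiStep hR hQ hP' _) (fun y => ?_) x
  rw [iterate_riccatiStep_false_quad, S.iterate_riccatiStep_false_quad P']
  gcongr
  exact h _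

/-- The cost of a period, with cost-to-go `P` at its end, is at most that of applying the input `u`
at its start. The third term is the running cost of the uncontrolled remainder of the period. -/
theorem periodStep_quad_le (hR : S.R.PosDef) (hQ : S.Q.PosDef)
    {P : Matrix (Fin nx) (Fin nx) ℝ} (hP : P.PosSemidef) (x : Vec nx) (u : Vec nu) :
    (S.periodStep P).quad x ≤ S.Q.quad x + S.R.quad u
      + ((S.riccatiStep false)^[S.p - 1] 0).quad (S.A.act x + S.B.act u)
      + P.quad ((S.A ^ (S.p - 1)).act (S.A.act x + S.B.act u)) := by
  rw [add_assoc _ (quad _ _), ← iterate_riccatiStep_false_quad]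
  exact S.riccatiStep_true_quad_le hR (S.posSemidef_iterate_riccatiStep hR hQ hP _) x u

theorem posSemidef_iterate_periodStep (hR : S.R.PosDef) (hQ : S.Q.PosDef) (k : ℕ) :
    (S.periodStep^[k] 0).PosSemidef := by
  induction k with
  | zero => exact PosSemidef.zero
  | succ k ih =>
    rw [Function.iterate_succ_apply']
    exact (S.posDef_periodStep hR hQ ih).posSemidef

/-- Value iteration from the zero cost increases. -/
theorem iterate_periodStep_quad_le_succ (hR : S.R.PosDef) (hQ : S.Q.PosDef) (k : ℕ) (x : Vec nx) :
    (S.periodStep^[k] 0).quad x ≤ (S.periodStep^[k + 1] 0).quad x := by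
  induction k generalizing x with
  | zero =>
    have := (S.posSemidef_iterate_periodStep hR hQ 1).quad_nonneg x
    simpa [Matrix.quad] using this
  | succ k ih =>
    rw [Function.iterate_succ_apply', Function.iterate_succ_apply' _ (k + 1)]
    exact S.periodStep_mono hR hQ (S.posSemidef_iterate_periodStep hR hQ k)
      (S.posSemidef_iterate_periodStep hR hQ (k + 1)) ih x

/-- Value iteration is bounded at a state that can be steered to the origin: the cost of the
steering inputs, with no input applied afterwards, is a bound. -/
theorem bddAbove_iterate_periodStep_quad (hR : S.R.PosDef) (hQ : S.Q.PosDef) (hp : 0 < S.p) (K : ℕ)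
    (x : Vec nx) (u : ℕ → Vec nu)
    (h : ((S.A ^ S.p) ^ K).act x
      = ∑ i ∈ Finset.range K, ((S.A ^ S.p) ^ i * (S.A ^ (S.p - 1) * S.B)).act (u i)) :
    ∃ c, ∀ k, (S.periodStep^[k] 0).quad x ≤ c := by
  induction K generalizing x with
  | zero =>
    refine ⟨0, fun k => ?_⟩
    have hx : x = 0 := by simpa [act_one] using h
    simp [hx, quad_zero]
  | succ K ih =>
    set y := S.A.act x + S.B.act (-u K) with hy
    obtain ⟨c, hc⟩ := ih ((S.A ^ (S.p - 1)).act y) (by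
      have hA : S.A ^ S.p = S.A ^ (S.p - 1) * S.A := by
        rw [← pow_succ, Nat.sub_add_cancel hp]
      rw [Finset.sum_range_succ, pow_succ, act_mul] at h
      rw [hy, act_add, act_add, ← act_mul _ S.A, ← hA, h, ← act_mul _ S.B, act_neg, act_neg,
        ← act_mul]
      abel)
    refine ⟨max 0 (S.Q.quad x + S.R.quad (-u K) + ((S.riccatiStep false)^[S.p - 1] 0).quad y + c),
      fun k => ?_⟩
    cases k with
    | zero => simp [Matrix.quad]
    | succ k =>
      refine le_max_of_le_right ?_
      rw [Function.iterate_succ_apply']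
      exact (S.periodStep_quad_le hR hQ (S.posSemidef_iterate_periodStep hR hQ k) x (-u K)).trans
        (by gcongr; exact hc k)

theorem continuous_riccatiStep_false : Continuous (S.riccatiStep false) := by
  change Continuous fun P => S.riccatiStep false P
  simp only [riccatiStep, Bool.false_eq_true, if_false]
  fun_prop

theorem riccatiStep_continuousAt (hR : S.R.PosDef) (δ : Bool)
    {P : Matrix (Fin nx) (Fin nx) ℝ} (hP : P.PosSemidef) : ContinuousAt (S.riccatiStep δ) P := by
  cases δ
  · exact S.continuous_riccatiStep_false.continuousAt
  · have hH : Continuous fun P : Matrix (Fin nx) (Fin nx) ℝ => S.Bᵀ * P * S.B + S.R := by fun_prop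
    have hinv : ContinuousAt
        (fun P : Matrix (Fin nx) (Fin nx) ℝ => (S.Bᵀ * P * S.B + S.R)⁻¹) P := by
      simp only [inv_def, Ring.inverse_eq_inv']
      exact (hH.matrix_det.continuousAt.inv₀ (S.posDef_inputWeight hR hP).det_pos.ne').smul
        hH.matrix_adjugate.continuousAt
    have hl : ContinuousAt (fun P : Matrix (Fin nx) (Fin nx) ℝ => S.Aᵀ * P * S.B) P := by fun_prop
    have hr : ContinuousAt (fun P : Matrix (Fin nx) (Fin nx) ℝ => S.Bᵀ * P * S.A) P := by fun_prop
    have hq : ContinuousAt (fun P : Matrix (Fin nx) (Fin nx) ℝ => S.Q + S.Aᵀ * P * S.A) P := by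
      fun_prop
    have hlH : ContinuousAt (fun P : Matrix (Fin nx) (Fin nx) ℝ =>
        S.Aᵀ * P * S.B * (S.Bᵀ * P * S.B + S.R)⁻¹) P :=
      ((continuous_fst.matrix_mul continuous_snd).tendsto _).comp (hl.prodMk_nhds hinv)
    have hlHr : ContinuousAt (fun P : Matrix (Fin nx) (Fin nx) ℝ =>
        S.Aᵀ * P * S.B * (S.Bᵀ * P * S.B + S.R)⁻¹ * (S.Bᵀ * P * S.A)) P :=
      ((continuous_fst.matrix_mul continuous_snd).tendsto _).comp (hlH.prodMk_nhds hr)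
    have := hq.sub hlHr
    refine this.congr (Eventually.of_forall fun P => ?_)
    simp [riccatiStep, Matrix.mul_assoc]

theorem periodStep_continuousAt (hR : S.R.PosDef) (hQ : S.Q.PosDef)
    {P : Matrix (Fin nx) (Fin nx) ℝ} (hP : P.PosSemidef) : ContinuousAt S.periodStep P := by
  have hc : Continuous (S.riccatiStep false)^[S.p - 1] :=
    S.continuous_riccatiStep_false.iterate _
  exact ContinuousAt.comp (f := (S.riccatiStep false)^[S.p - 1]) (x := P)
    (S.riccatiStep_continuousAt hR true (S.posSemidef_iterate_riccatiStep hR hQ hP _))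
    hc.continuousAt

/-- Value iteration from the zero cost increases and is bounded, because every state can be steered
to the origin. Its limit is a fixed point, by continuity. -/
theorem exists_periodStep_eq (hR : S.R.PosDef) (hQ : S.Q.PosDef) (hp : 0 < S.p)
    (hAB : IsControllable S.A S.B) (heig : EigenvalueNonresonant S.A S.p) :
    ∃ P, P.PosDef ∧ P = S.periodStep P := by
  obtain ⟨K, hK⟩ := hAB.exists_null_control hp heig
  have hlim : ∀ x, ∃ l, Tendsto (fun k => (S.periodStep^[k] 0).quad x) atTop (nhds l) := by
    intro x
    obtain ⟨u, hu⟩ := hK x.ofLp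
    obtain ⟨c, hc⟩ := S.bddAbove_iterate_periodStep_quad hR hQ hp K x
      (fun i => WithLp.toLp 2 (u i)) (by
        refine WithLp.ofLp_injective 2 ?_
        simpa [Matrix.act] using hu)
    exact ⟨_, tendsto_atTop_ciSup
      (monotone_nat_of_le_succ fun k => S.iterate_periodStep_quad_le_succ hR hQ k x)
      ⟨c, by rintro _ ⟨k, rfl⟩; exact hc k⟩⟩
  choose l hl using hlim
  have hsym := fun k => (S.posSemidef_iterate_periodStep hR hQ k).transpose_eq
  -- the entries converge by polarization
  let e : Fin nx → Vec nx := fun i => WithLp.toLp 2 (Pi.single i 1)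
  have hent : ∀ i j, Tendsto (fun k => (S.periodStep^[k] 0) i j) atTop
      (nhds ((l (e i + e j) - l (e i) - l (e j)) / 2)) := by
    intro i j
    refine ((((hl (e i + e j)).sub (hl (e i))).sub (hl (e j))).div_const 2).congr fun k => ?_
    rw [quad_add _ (hsym k)]
    have : (S.periodStep^[k] 0).bil (e i) (e j) = (S.periodStep^[k] 0) i j := by
      simp [bil, e]
    rw [this]
    ring
  set P : Matrix (Fin nx) (Fin nx) ℝ :=
    Matrix.of fun i j => (l (e i + e j) - l (e i) - l (e j)) / 2
  have hP : Tendsto (fun k => S.periodStep^[k] 0) atTop (nhds P) :=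
    tendsto_pi_nhds.2 fun i => tendsto_pi_nhds.2 fun j => hent i j
  have hPt : Pᵀ = P := by
    ext i j
    simp only [P, transpose_apply, of_apply, add_comm (e j)]
    ring
  have hquad : ∀ x, Tendsto (fun k => (S.periodStep^[k] 0).quad x) atTop (nhds (P.quad x)) := by
    intro x
    have hc : Continuous fun M : Matrix (Fin nx) (Fin nx) ℝ => M.quad x := by
      unfold Matrix.quad
      fun_prop
    exact (hc.tendsto P).comp hP
  have hPs : P.PosSemidef := posSemidef_of_quad hPt fun x =>
    ge_of_tendsto' (hquad x) fun k => (S.posSemidef_iterate_periodStep hR hQ k).quad_nonneg x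
  have hfix : P = S.periodStep P := by
    refine tendsto_nhds_unique (hP.comp (tendsto_add_atTop_nat 1)) ?_
    refine ((S.periodStep_continuousAt hR hQ hPs).tendsto.comp hP).congr fun k => ?_
    simp [Function.iterate_succ_apply']
  exact ⟨P, hfix ▸ S.posDef_periodStep hR hQ hPs, hfix⟩

/-- The terms of a Riccati step at the start of a period, with the cost-to-go that results from the
uncontrolled remainder of the period, are those of the lifted system: the weights `Q_p`, `S_p`,
`R_p` and the pair `(A ^ p, B_p)`. -/
theorem periodStep_terms (hQ : S.Q.PosDef) (hp : 0 < S.p) (P : Matrix (Fin nx) (Fin nx) ℝ) :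
    S.Q + S.Aᵀ * (S.riccatiStep false)^[S.p - 1] P * S.A = S.Qp + (S.A ^ S.p)ᵀ * P * S.A ^ S.p ∧
    S.Bᵀ * (S.riccatiStep false)^[S.p - 1] P * S.B + S.R = S.Bpᵀ * P * S.Bp + S.Rp ∧
    S.Bᵀ * (S.riccatiStep false)^[S.p - 1] P * S.A = S.Bpᵀ * P * S.A ^ S.p + S.Spᵀ := by
  have hQt := hQ.posSemidef.transpose_eq
  obtain ⟨r, hr⟩ : ∃ r, S.p = r + 1 := ⟨S.p - 1, by omega⟩
  rw [iterate_riccatiStep_false]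
  simp only [Qp, Bp, Rp, Sp, hr, Nat.add_sub_cancel]
  refine ⟨?_, ?_, ?_⟩
  · rw [Finset.sum_range_succ']
    simp only [pow_succ, transpose_mul, Matrix.mul_add,
      Matrix.add_mul, Matrix.mul_sum, Matrix.sum_mul, pow_zero, transpose_one, Matrix.one_mul,
      Matrix.mul_one, Matrix.mul_assoc]
    abel
  · rw [Finset.sum_Ico_eq_sum_range]
    simp only [transpose_mul, Matrix.mul_add, Matrix.add_mul, Matrix.mul_sum, Matrix.sum_mul,
      Matrix.mul_assoc, Nat.add_sub_cancel_left, Nat.add_sub_cancel]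
    abel
  · rw [Finset.sum_Ico_eq_sum_range, transpose_sum]
    simp only [transpose_mul, Matrix.mul_add, Matrix.add_mul, Matrix.mul_sum, Matrix.sum_mul,
      Matrix.mul_assoc, Nat.add_sub_cancel_left, Nat.add_sub_cancel, transpose_transpose, hQt,
      pow_succ, pow_add, pow_zero, Matrix.one_mul]
    rw [add_comm]
    congr 1
    refine Finset.sum_congr rfl fun i _ => ?_
    rw [← pow_succ', pow_succ]

/-- The gain of the periodic policy is the one-step gain at the start of a period. -/
theorem stepGain_iterate_eq (hQ : S.Q.PosDef) (hp : 0 < S.p) (P : Matrix (Fin nx) (Fin nx) ℝ) :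
    S.stepGain ((S.riccatiStep false)^[S.p - 1] P) = S.periodicGainOf P := by
  obtain ⟨-, h2, h3⟩ := S.periodStep_terms hQ hp P
  rw [stepGain, periodicGainOf, h2, Matrix.mul_assoc, Matrix.mul_assoc, ← Matrix.mul_assoc S.Bᵀ, h3]

/-- The lifted periodic Riccati equation is the fixed point equation of one period of the backward
Riccati recursion. -/
theorem periodStep_eq (hR : S.R.PosDef) (hQ : S.Q.PosDef) (hp : 0 < S.p)
    {P : Matrix (Fin nx) (Fin nx) ℝ} (hP : P.PosSemidef) :
    S.periodStep P = S.Qp + (S.A ^ S.p)ᵀ * P * S.A ^ S.p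
      - (S.periodicGainOf P)ᵀ * (S.Bpᵀ * P * S.Bp + S.Rp) * S.periodicGainOf P := by
  obtain ⟨h1, h2, h3⟩ := S.periodStep_terms hQ hp P
  have hP' := S.posSemidef_iterate_riccatiStep hR hQ hP (S.p - 1)
  have hH := S.posDef_inputWeight hR hP'
  rw [h2] at hH
  have hHt := hH.posSemidef.transpose_eq
  have h4 : S.Aᵀ * (S.riccatiStep false)^[S.p - 1] P * S.B = (S.Bpᵀ * P * S.A ^ S.p + S.Spᵀ)ᵀ := by
    rw [← h3]
    simp [hP'.transpose_eq, Matrix.mul_assoc]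
  have h5 : S.periodStep P = S.Qp + (S.A ^ S.p)ᵀ * P * S.A ^ S.p
      - (S.Bpᵀ * P * S.A ^ S.p + S.Spᵀ)ᵀ * (S.Bpᵀ * P * S.Bp + S.Rp)⁻¹
        * (S.Bpᵀ * P * S.A ^ S.p + S.Spᵀ) := by
    rw [← h4, ← h1, ← h2, ← h3]
    simp [periodStep, riccatiStep, Matrix.mul_assoc]
  rw [h5, periodicGainOf]
  generalize S.Bpᵀ * P * S.Bp + S.Rp = H at hH hHt ⊢
  generalize S.Bpᵀ * P * S.A ^ S.p + S.Spᵀ = G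
  have hu : IsUnit H.det := hH.det_pos.ne'.isUnit
  congr 1
  simp only [transpose_neg, transpose_mul, transpose_nonsing_inv, hHt, Matrix.neg_mul,
    Matrix.mul_neg, neg_neg]
  rw [Matrix.mul_assoc _ H, ← Matrix.mul_assoc H, mul_nonsing_inv _ hu, Matrix.one_mul]

/-- A positive definite solution of the lifted Riccati equation exists, so that `Pper` is not the
default value in its definition, and it is reproduced by one period of backward Riccati steps. -/
theorem posDef_Pper_and_periodStep_Pper (hR : S.R.PosDef) (hQ : S.Q.PosDef) (hp : 0 < S.p)
    (hAB : IsControllable S.A S.B) (heig : EigenvalueNonresonant S.A S.p) :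
    S.Pper.PosDef ∧ S.periodStep S.Pper = S.Pper := by
  have hex : ∃ P, S.IsPeriodicRiccatiSolution P := by
    obtain ⟨P, hP, hfix⟩ := S.exists_periodStep_eq hR hQ hp hAB heig
    exact ⟨P, hP, by rw [← S.periodStep_eq hR hQ hp hP.posSemidef]; exact hfix⟩
  have : S.Pper = hex.choose := dif_pos hex
  obtain ⟨h1, h2⟩ := hex.choose_spec
  rw [← this] at h1 h2
  exact ⟨h1, by rw [S.periodStep_eq hR hQ hp h1.posSemidef, ← h2]⟩

/-! ### The periodic policy as a rollout policy -/

/-- The schedule of the periodic policy. -/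
def periodicSchedule : S.Schedule := fun s => decide ((s : ℕ) % S.p = 0)

/-- Under the periodic schedule the cost matrices are periodic in the number of steps to go. -/
theorem costMatrixToGo_periodicSchedule (hp : 0 < S.p) (hph : S.p ∣ S.h)
    (hfix : S.periodStep S.Pper = S.Pper) (i r : ℕ) (hr : r < S.p) (hi : S.p * i + r ≤ S.h) :
    S.costMatrixToGo S.periodicSchedule (S.p * i + r) = (S.riccatiStep false)^[r] S.Pper := by
  have hentry : ∀ j, j + 1 ≤ S.h →
      S.entry S.periodicSchedule (S.h - (j + 1)) = decide ((j + 1) % S.p = 0) := by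
    intro j hj
    rw [entry, dif_pos (by omega), periodicSchedule]
    simp only [decide_eq_decide]
    rw [← Nat.dvd_iff_mod_eq_zero, ← Nat.dvd_iff_mod_eq_zero]
    exact Nat.dvd_sub_iff_right hj hph
  induction i generalizing r with
  | zero =>
    induction r with
    | zero => rfl
    | succ r ih =>
      rw [← add_assoc, costMatrixToGo, ih (by omega) (by omega), Function.iterate_succ_apply',
        hentry _ (by omega), Nat.mul_zero, Nat.zero_add, Nat.mod_eq_of_lt hr]
      simp
  | succ i ih =>
    induction r with
    | zero =>
      obtain ⟨q, hq⟩ : ∃ q, S.p = q + 1 := ⟨S.p - 1, by omega⟩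
      have e : S.p * (i + 1) + 0 = (S.p * i + (S.p - 1)) + 1 := by rw [Nat.mul_succ]; omega
      rw [e] at hi ⊢
      rw [costMatrixToGo, ih (S.p - 1) (by omega) (by omega), hentry _ hi, ← e]
      simpa [periodStep] using hfix
    | succ r ih' =>
      rw [← add_assoc, costMatrixToGo, ih' (by omega) (by omega), Function.iterate_succ_apply',
        hentry _ (by omega), add_assoc, Nat.mul_add_mod, Nat.mod_eq_of_lt hr]
      simp

theorem costMatrix_periodicSchedule_zero (hp : 0 < S.p) (hph : S.p ∣ S.h)
    (hfix : S.periodStep S.Pper = S.Pper) : S.costMatrix S.periodicSchedule 0 = S.Pper := by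
  obtain ⟨i, hi⟩ := hph
  have := S.costMatrixToGo_periodicSchedule hp ⟨i, hi⟩ hfix i 0 hp hi.ge
  rw [costMatrix, Nat.sub_zero, hi]
  exact this

/-- The periodic policy is the rollout policy that always selects the periodic schedule. -/
theorem rolloutController_periodicSchedule (hQ : S.Q.PosDef) (hp : 0 < S.p) (hh : 0 < S.h)
    (hph : S.p ∣ S.h) (hfix : S.periodStep S.Pper = S.Pper) :
    S.rolloutController (fun _ => S.periodicSchedule) = S.periodicController := by
  funext k xhat
  have hlt := Nat.mod_lt k hh
  have hmod : k % S.h % S.p = k % S.p := Nat.mod_mod_of_dvd k hph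
  have he : S.entry S.periodicSchedule (k % S.h) = decide (k % S.p = 0) := by
    rw [entry, dif_pos hlt, periodicSchedule]
    simp [hmod]
  simp only [rolloutController, periodicController, he]
  by_cases hk : k % S.p = 0
  · obtain ⟨i, hi⟩ : S.p ∣ S.h - k % S.h :=
      (Nat.dvd_sub_iff_right hlt.le hph).2 (Nat.dvd_of_mod_eq_zero (hmod.trans hk))
    obtain ⟨i, rfl⟩ : ∃ i', i = i' + 1 :=
      Nat.exists_eq_succ_of_ne_zero (by rintro rfl; omega)
    rw [Nat.mul_succ] at hi
    have e : S.h - (k % S.h + 1) = S.p * i + (S.p - 1) := by omega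
    simp only [hk, if_true, decide_true, rolloutGain, costMatrix, e]
    rw [S.costMatrixToGo_periodicSchedule hp hph hfix i (S.p - 1) (by omega) (by omega),
      S.stepGain_iterate_eq hQ hp, periodicGain]
  · simp [hk]

end CodesignProblem

/-! ### Harris' ergodic theorem -/

/-- A function whose oscillation is bounded by a sum of weights deviates from some constant by at
most the weight. -/
theorem exists_forall_abs_sub_le {E : Type*} {g W : E → ℝ} [Nonempty E]
    (h : ∀ x y, |g x - g y| ≤ W x + W y) : ∃ c, ∀ x, |g x - c| ≤ W x := by
  have hle : ∀ x y, g x - W x ≤ g y + W y := fun x y => by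
    have := (abs_le.1 (h x y)).2
    linarith
  have hbdd : BddAbove (Set.range fun x => g x - W x) := by
    obtain ⟨y⟩ := ‹Nonempty E›
    exact ⟨g y + W y, by rintro _ ⟨x, rfl⟩; exact hle x y⟩
  refine ⟨⨆ x, g x - W x, fun x => abs_le.2 ⟨?_, ?_⟩⟩
  · have := ciSup_le fun y => hle y x
    linarith
  · have := le_ciSup hbdd x
    linarith

section Harris

variable {E : Type*} [MeasurableSpace E]

/-- A Markov kernel with a Lyapunov function `V` whose sublevel sets are small contracts the
oscillation of functions, measured with the weight `2 + β V(x) + β V(y)` (Hairer and Mattingly). -/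
theorem exists_contraction (κ : Kernel E E) [IsMarkovKernel κ] {V : E → ℝ}
    (hV0 : ∀ x, 0 ≤ V x) {γ K : ℝ} (hγ0 : 0 < γ) (hγ1 : γ < 1) (hK : 0 ≤ K)
    (hint : ∀ x, Integrable V (κ x)) (hdrift : ∀ x, ∫ y, V y ∂κ x ≤ γ * V x + K)
    (hsmall : ∀ r, ∃ ρ : Measure E, IsFiniteMeasure ρ ∧ ρ ≠ 0 ∧ ∀ x, V x ≤ r → ρ ≤ κ x) :
    ∃ α β : ℝ, 0 < α ∧ α < 1 ∧ 0 < β ∧ ∀ g : E → ℝ, (∀ x, Integrable g (κ x)) → ∀ D : ℝ, 0 ≤ D →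
      (∀ x y, |g x - g y| ≤ D * (2 + β * V x + β * V y)) →
      ∀ x y, |∫ z, g z ∂κ x - ∫ z, g z ∂κ y| ≤ α * (D * (2 + β * V x + β * V y)) := by
  -- `R` is so large that the drift beats the constant `K` where `V x + V y ≥ R`; `ε` is the mass
  -- that the transition laws from `{V ≤ R}` have in common; `β` is so small that the growth `2 β K`
  -- of the weight is at most half the gain `2 ε`. The factor `1 - δ` of `α` comes from the drift,
  -- the factor `1 - ε / 2` from the common mass.
  set R : ℝ := 4 * K / (1 - γ) + 1 with hR
  have hγ' : 0 < 1 - γ := by linarith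
  have hRpos : 0 < R := by positivity
  have hRK : 4 * K ≤ (1 - γ) * R := by
    rw [hR, mul_add, mul_div_cancel₀ _ hγ'.ne']; linarith
  obtain ⟨ρ, hρfin, hρ0, hρ⟩ := hsmall R
  set ε : ℝ := ρ.real Set.univ with hε
  have hεpos : 0 < ε := by
    rw [hε, measureReal_def]
    exact ENNReal.toReal_pos (by simpa using hρ0) (measure_ne_top _ _)
  set β : ℝ := ε / (2 * K + 1) with hβ
  have hβpos : 0 < β := by positivity
  have hβK : 2 * β * K ≤ ε := by
    rw [hβ]
    have : 2 * (ε / (2 * K + 1)) * K = ε * (2 * K / (2 * K + 1)) := by ring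
    rw [this]
    exact mul_le_of_le_one_right hεpos.le ((div_le_one (by positivity)).2 (by linarith))
  set δ : ℝ := β * R * (1 - γ) / (2 * (2 + β * R)) with hδ
  have hδpos : 0 < δ := by positivity
  set α : ℝ := max (1 - δ) (max (1 - ε / 2) γ) with hα
  have hα1 : 1 - δ ≤ α := le_max_left _ _
  have hα2 : 1 - ε / 2 ≤ α := (le_max_left _ _).trans (le_max_right _ _)
  have hα3 : γ ≤ α := (le_max_right _ _).trans (le_max_right _ _)
  refine ⟨α, β, hγ0.trans_le hα3, max_lt (by linarith) (max_lt (by linarith) hγ1), hβpos, ?_⟩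
  intro g hg D hD hosc
  suffices key : ∀ x y, ∫ z, g z ∂κ x - ∫ z, g z ∂κ y ≤ α * (D * (2 + β * V x + β * V y)) by
    intro x y
    rw [abs_le]
    have := key y x
    constructor
    · have e : D * (2 + β * V x + β * V y) = D * (2 + β * V y + β * V x) := by ring
      rw [e]; linarith
    · exact key x y
  intro x y
  have : Nonempty E := ⟨x⟩
  obtain ⟨c, hc⟩ := exists_forall_abs_sub_le (g := g) (W := fun x => D * (1 + β * V x))
    (fun x y => (hosc x y).trans (by ring_nf; rfl))
  -- `c` is a centre of `g`, so that `f₁ = W - (g - c)` and `f₂ = W + (g - c)` are nonnegative; the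
  -- integrals of `W` minus those of `f₁`, `f₂` give the difference of the integrals of `g`
  set W : E → ℝ := fun z => D * (1 + β * V z) with hW
  have hWint : ∀ x, Integrable W (κ x) := fun x =>
    ((integrable_const 1).add ((hint x).const_mul β)).const_mul D
  have hWle : ∀ x, ∫ z, W z ∂κ x ≤ D * (1 + β * (γ * V x + K)) := fun x => by
    simp only [hW]
    rw [integral_const_mul, integral_add (integrable_const 1) ((hint x).const_mul β),
      integral_const_mul]
    simp only [integral_const, probReal_univ, smul_eq_mul, mul_one]
    have := hdrift x
    gcongr
  set f₁ : E → ℝ := fun z => W z - (g z - c) with hf₁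
  set f₂ : E → ℝ := fun z => W z + (g z - c) with hf₂
  have h₁ : ∀ z, 0 ≤ f₁ z := fun z => by have := (abs_le.1 (hc z)).2; simp only [hf₁]; linarith
  have h₂ : ∀ z, 0 ≤ f₂ z := fun z => by have := (abs_le.1 (hc z)).1; simp only [hf₂]; linarith
  have hgc : ∀ x, Integrable (fun z => g z - c) (κ x) := fun x => (hg x).sub (integrable_const c)
  have hi₁ : Integrable f₁ (κ x) := (hWint x).sub (hgc x)
  have hi₂ : Integrable f₂ (κ y) := (hWint y).add (hgc y)
  have e₁ : ∫ z, f₁ z ∂κ x = ∫ z, W z ∂κ x - ∫ z, g z ∂κ x + c := by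
    simp only [hf₁]
    rw [integral_sub (hWint x) (hgc x), integral_sub (hg x) (integrable_const c)]
    simp; ring
  have e₂ : ∫ z, f₂ z ∂κ y = ∫ z, W z ∂κ y + ∫ z, g z ∂κ y - c := by
    simp only [hf₂]
    rw [integral_add (hWint y) (hgc y), integral_sub (hg y) (integrable_const c)]
    simp; ring
  have hx := hWle x
  have hy := hWle y
  rcases le_total R (V x + V y) with hs | hs
  · -- far from the small set, the drift is enough
    have p₁ : 0 ≤ ∫ z, f₁ z ∂κ x := integral_nonneg h₁
    have p₂ : 0 ≤ ∫ z, f₂ z ∂κ y := integral_nonneg h₂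
    rw [e₁] at p₁
    rw [e₂] at p₂
    have hδs : δ * (2 + β * (V x + V y)) ≤ β * (V x + V y) * (1 - γ) / 2 := by
      rw [hδ, div_mul_eq_mul_div, div_le_div_iff₀ (by positivity) two_pos]
      have : R * (2 + β * (V x + V y)) ≤ (V x + V y) * (2 + β * R) := by nlinarith
      have h3 : 0 ≤ 2 * (β * (1 - γ)) := by positivity
      nlinarith [mul_le_mul_of_nonneg_left this h3]
    have hmain : 2 + β * (γ * V x + K) + β * (γ * V y + K) ≤ α * (2 + β * V x + β * V y) := by
      have h4 : 0 ≤ 2 + β * V x + β * V y := by have := hV0 x; have := hV0 y; positivity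
      have h5 := mul_le_mul_of_nonneg_right hα1 h4
      have h6 : β * (4 * K) ≤ β * ((1 - γ) * (V x + V y)) :=
        mul_le_mul_of_nonneg_left (hRK.trans (by gcongr)) hβpos.le
      nlinarith
    have hm := mul_le_mul_of_nonneg_left hmain hD
    linarith
  · -- on the small set, the common part `ρ` of the two transition laws cancels
    have hVx : V x ≤ R := by have := hV0 y; linarith
    have hVy : V y ≤ R := by have := hV0 x; linarith
    have p₁ := integral_mono_measure (hρ x hVx) (ae_of_all _ h₁) hi₁
    have p₂ := integral_mono_measure (hρ y hVy) (ae_of_all _ h₂) hi₂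
    have p₃ : 2 * D * ε ≤ ∫ z, f₁ z ∂ρ + ∫ z, f₂ z ∂ρ := by
      rw [← integral_add (hi₁.mono_measure (hρ x hVx)) (hi₂.mono_measure (hρ y hVy))]
      calc 2 * D * ε = ∫ _, 2 * D ∂ρ := by simp [hε]; ring
        _ ≤ _ := by
          refine integral_mono (integrable_const _)
            ((hi₁.mono_measure (hρ x hVx)).add (hi₂.mono_measure (hρ y hVy))) fun z => ?_
          have : 0 ≤ D * (β * V z) := by have := hV0 z; positivity
          simp only [hf₁, hf₂, hW]
          linarith
    rw [e₁] at p₁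
    rw [e₂] at p₂
    have hmain : 2 + β * (γ * V x + K) + β * (γ * V y + K) - 2 * ε
        ≤ α * (2 + β * V x + β * V y) := by
      have h7 : 0 ≤ β * V x + β * V y := by have := hV0 x; have := hV0 y; positivity
      nlinarith [mul_le_mul_of_nonneg_right hα3 h7]
    have hm := mul_le_mul_of_nonneg_left hmain hD
    linarith

/-- Along a Markov chain with a Lyapunov function whose sublevel sets are small, the expectation of
every bounded measurable function converges. -/
theorem exists_tendsto_integral (κ : Kernel E E) [IsMarkovKernel κ] {V : E → ℝ}
    (hV0 : ∀ x, 0 ≤ V x) {γ K : ℝ} (hγ0 : 0 < γ) (hγ1 : γ < 1) (hK : 0 ≤ K)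
    (hint : ∀ x, Integrable V (κ x)) (hdrift : ∀ x, ∫ y, V y ∂κ x ≤ γ * V x + K)
    (hsmall : ∀ r, ∃ ρ : Measure E, IsFiniteMeasure ρ ∧ ρ ≠ 0 ∧ ∀ x, V x ≤ r → ρ ≤ κ x)
    (π : ℕ → Measure E) [∀ n, IsProbabilityMeasure (π n)] (hπ : ∀ n, π (n + 1) = (π n).bind κ)
    (hπV : Integrable V (π 0)) {g : E → ℝ} (hg : Measurable g) {M : ℝ} (hgM : ∀ x, |g x| ≤ M) :
    ∃ l, Tendsto (fun n => ∫ x, g x ∂π n) atTop (nhds l) := by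
  obtain ⟨α, β, hα0, hα1, hβ, hcontr⟩ :=
    exists_contraction κ hV0 hγ0 hγ1 hK hint hdrift hsmall
  have hbdint : ∀ (f : E → ℝ) (ρ : Measure E) [IsFiniteMeasure ρ], Measurable f →
      (∀ x, |f x| ≤ M) → Integrable f ρ := fun f ρ _ hf hfM =>
    Integrable.of_bound hf.aestronglyMeasurable M (ae_of_all _ fun x => by simpa using hfM x)
  -- `G n x` is the expectation of `g` after `n` steps from `x`; its oscillation decays like `α ^ n`
  let G : ℕ → E → ℝ := fun n => (fun f x => ∫ y, f y ∂κ x)^[n] g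
  have hGs : ∀ n x, G (n + 1) x = ∫ y, G n y ∂κ x := fun n x => by
    simp only [G, Function.iterate_succ_apply']
  have hGm : ∀ n, Measurable (G n) ∧ ∀ x, |G n x| ≤ M := by
    intro n
    induction n with
    | zero => exact ⟨hg, hgM⟩
    | succ n ih =>
      refine ⟨?_, fun x => ?_⟩
      · have : G (n + 1) = fun x => ∫ y, G n y ∂κ x := funext (hGs n)
        rw [this]
        exact (ih.1.stronglyMeasurable.integral_kernel (κ := κ)).measurable
      · rw [hGs]
        have := norm_integral_le_of_norm_le_const (μ := κ x) (f := G n) (C := M)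
          (ae_of_all _ fun y => by simpa using ih.2 y)
        simpa using this
  have hbind : ∀ n k, ∫ x, G k x ∂π (n + 1) = ∫ x, G (k + 1) x ∂π n := by
    intro n k
    have e : π (n + 1) = (κ ∘ₖ Kernel.const Unit (π n)) () := by
      rw [hπ, Kernel.comp_apply, Kernel.const_apply]
    have hi := hbdint _ (π (n + 1)) (hGm k).1 (hGm k).2
    rw [e] at hi ⊢
    rw [Kernel.integral_comp hi, Kernel.const_apply]
    simp only [hGs]
  have hpush : ∀ n k, ∫ x, G k x ∂π n = ∫ x, G (n + k) x ∂π 0 := by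
    intro n
    induction n with
    | zero => intro k; simp
    | succ n ih => intro k; rw [hbind, ih, add_right_comm, add_assoc]
  have hosc : ∀ n x y, |G n x - G n y| ≤ (α ^ n * M) * (2 + β * V x + β * V y) := by
    intro n
    induction n with
    | zero =>
      intro x y
      have h1 := abs_sub (g x) (g y)
      have h2 := hgM x
      have h3 := hgM y
      have h4 : 0 ≤ M := (abs_nonneg _).trans h2
      have h5 : 0 ≤ M * (β * V x + β * V y) := by have := hV0 x; have := hV0 y; positivity
      simp only [G, Function.iterate_zero, id, pow_zero]
      linarith
    | succ n ih =>
      intro x y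
      have hM : 0 ≤ M := (abs_nonneg _).trans (hgM x)
      rw [hGs, hGs]
      refine (hcontr (G n) (fun x => hbdint _ _ (hGm n).1 (hGm n).2) (α ^ n * M) (by positivity)
        ih x y).trans (le_of_eq (by ring))
  have hWint : Integrable (fun x => 2 + β * V x + β * (γ * V x + K)) (π 0) :=
    ((integrable_const _).add (hπV.const_mul β)).add
      (((hπV.const_mul γ).add (integrable_const K)).const_mul β)
  have hdiff : ∀ n x, |G n x - G (n + 1) x|
      ≤ (α ^ n * M) * (2 + β * V x + β * (γ * V x + K)) := by
    intro n x
    have hM : 0 ≤ M := (abs_nonneg _).trans (hgM x)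
    have e : G n x - G (n + 1) x = ∫ y, (G n x - G n y) ∂κ x := by
      rw [integral_sub (integrable_const _) (hbdint _ _ (hGm n).1 (hGm n).2), hGs]
      simp
    have hi : Integrable (fun y => (α ^ n * M) * (2 + β * V x + β * V y)) (κ x) :=
      ((integrable_const _).add ((hint x).const_mul β)).const_mul _
    rw [e]
    calc |∫ y, (G n x - G n y) ∂κ x| ≤ ∫ y, |G n x - G n y| ∂κ x := abs_integral_le_integral_abs
      _ ≤ ∫ y, (α ^ n * M) * (2 + β * V x + β * V y) ∂κ x :=
        integral_mono ((integrable_const _).sub (hbdint _ _ (hGm n).1 (hGm n).2)).abs hi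
          fun y => hosc n x y
      _ = (α ^ n * M) * (2 + β * V x + β * ∫ y, V y ∂κ x) := by
        rw [integral_const_mul, integral_add (integrable_const _) ((hint x).const_mul β),
          integral_const_mul]
        simp
      _ ≤ _ := by gcongr; exact hdrift x
  have hcauchy : CauchySeq fun n => ∫ x, G n x ∂π 0 := by
    refine cauchySeq_of_le_geometric α (M * ∫ x, (2 + β * V x + β * (γ * V x + K)) ∂π 0) hα1
      fun n => ?_
    rw [Real.dist_eq, ← integral_sub (hbdint _ _ (hGm n).1 (hGm n).2)
      (hbdint _ _ (hGm (n + 1)).1 (hGm (n + 1)).2)]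
    calc _ ≤ ∫ x, |G n x - G (n + 1) x| ∂π 0 := abs_integral_le_integral_abs
      _ ≤ ∫ x, (α ^ n * M) * (2 + β * V x + β * (γ * V x + K)) ∂π 0 :=
        integral_mono ((hbdint _ _ (hGm n).1 (hGm n).2).sub
          (hbdint _ _ (hGm (n + 1)).1 (hGm (n + 1)).2)).abs (hWint.const_mul _) (hdiff n)
      _ = _ := by rw [integral_const_mul]; ring
  obtain ⟨l, hl⟩ := cauchySeq_tendsto_of_complete hcauchy
  refine ⟨l, hl.congr fun n => ?_⟩
  have := hpush n 0
  rw [add_zero] at this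
  exact this.symm

end Harris

/-! ### Gaussian vectors -/

section Gaussian

variable {n m l : ℕ}

/-- On compact sets the Gaussian measure dominates a multiple of Lebesgue measure. -/
theorem exists_smul_volume_restrict_le_pi_gaussianReal (r : ℝ) :
    ∃ c : ℝ≥0∞, c ≠ 0 ∧
      c • (volume : Measure (Fin n → ℝ)).restrict (Set.univ.pi fun _ => Set.Icc (-r) r)
        ≤ Measure.pi fun _ => gaussianReal 0 1 := by
  obtain ⟨c, hc, hcle⟩ : ∃ c : ℝ≥0∞, c ≠ 0 ∧
      ∀ s : Set ℝ, c * volume (s ∩ Set.Icc (-r) r) ≤ gaussianReal 0 1 s := by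
    refine ⟨gaussianPDF 0 1 r, (gaussianPDF_pos 0 one_ne_zero r).ne', fun s => ?_⟩
    rw [gaussianReal_of_var_ne_zero _ one_ne_zero]
    calc gaussianPDF 0 1 r * volume (s ∩ Set.Icc (-r) r)
        = ∫⁻ _ in s ∩ Set.Icc (-r) r, gaussianPDF 0 1 r := by simp
      _ ≤ ∫⁻ x in s ∩ Set.Icc (-r) r, gaussianPDF 0 1 x := by
        refine lintegral_mono_ae ((ae_restrict_of_ae_restrict_of_subset Set.inter_subset_right
          (ae_restrict_of_forall_mem measurableSet_Icc fun x hx => ?_)))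
        have hx2 : x ^ 2 ≤ r ^ 2 := sq_le_sq' hx.1 hx.2
        simp only [gaussianPDF, gaussianPDFReal]
        refine ENNReal.ofReal_le_ofReal ?_
        refine mul_le_mul_of_nonneg_left (Real.exp_le_exp.2 ?_) (by positivity)
        simp only [sub_zero]
        gcongr
      _ ≤ (volume.withDensity (gaussianPDF 0 1)) (s ∩ Set.Icc (-r) r) :=
        withDensity_apply_le _ _
      _ ≤ _ := measure_mono Set.inter_subset_left
  refine ⟨c ^ n, pow_ne_zero _ hc, Measure.le_iff.2 fun s hs => ?_⟩
  have hle : (c ^ n • (volume : Measure (Fin n → ℝ)).restrict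
      (Set.univ.pi fun _ => Set.Icc (-r) r)).toOuterMeasure
      ≤ OuterMeasure.pi fun _ => (gaussianReal 0 1).toOuterMeasure := by
    rw [OuterMeasure.le_pi]
    intro t _
    rw [Measure.coe_toOuterMeasure, Measure.smul_apply,
      Measure.restrict_apply' (MeasurableSet.univ_pi fun _ => measurableSet_Icc),
      ← Set.pi_inter_distrib, volume_pi, Measure.pi_pi, smul_eq_mul]
    calc c ^ n * ∏ i, volume (t i ∩ Set.Icc (-r) r)
        = ∏ i, c * volume (t i ∩ Set.Icc (-r) r) := by
          rw [Finset.prod_mul_distrib]; simp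
      _ ≤ _ := Finset.prod_le_prod' fun i _ => hcle (t i)
  rw [Measure.pi_def]
  exact (hle s).trans (le_toMeasure_apply _ _ _)

open scoped MatrixOrder in
/-- Bounded sets are small for a nondegenerate Gaussian transition: the laws of `z + w`, with `w`
Gaussian and `z` in a bounded set, have a common part, a multiple of Lebesgue measure on a ball. -/
theorem exists_smul_volume_restrict_le_map_add {Γ : Matrix (Fin n) (Fin n) ℝ} (hΓ : Γ.PosDef)
    (r : ℝ) : ∃ c : ℝ≥0∞, c ≠ 0 ∧ ∀ z : Vec n, ‖z‖ ≤ r →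
      c • (volume : Measure (Vec n)).restrict (Metric.ball 0 1)
        ≤ (multivariateGaussian 0 Γ).map (z + ·) := by
  -- the Gaussian vector is `L` applied to a standard one, with the invertible `L = √Γ`; the points
  -- that `z + L x` sends to the unit ball lie in a ball of a radius `r'` that depends on `r` only
  set L : Vec n →L[ℝ] Vec n := toEuclideanCLM (𝕜 := ℝ) (CFC.sqrt Γ) with hL
  have hunit : IsUnit L := by
    have h1 : CFC.sqrt Γ * CFC.sqrt Γ = Γ := by
      exact CFC.sqrt_mul_sqrt_self _ hΓ.posSemidef.nonneg
    have h2 : IsUnit (CFC.sqrt Γ) := by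
      rw [isUnit_iff_isUnit_det]
      have := hΓ.det_pos.ne'
      rw [← h1, det_mul] at this
      exact (left_ne_zero_of_mul this).isUnit
    exact h2.map (toEuclideanCLM (𝕜 := ℝ) (n := Fin n))
  obtain ⟨Li, hLL, hLL'⟩ : ∃ Li, L * Li = 1 ∧ Li * L = 1 :=
    ⟨↑hunit.unit⁻¹, hunit.mul_val_inv, hunit.val_inv_mul⟩
  have hinv : ∀ x, Li (L x) = x := fun x => by
    exact congrArg (fun T : Vec n →L[ℝ] Vec n => T x) hLL'
  have hdet : LinearMap.det (L : Vec n →ₗ[ℝ] Vec n) ≠ 0 := by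
    have : LinearMap.det ((L : Vec n →ₗ[ℝ] Vec n) * (Li : Vec n →ₗ[ℝ] Vec n)) = 1 := by
      rw [show (L : Vec n →ₗ[ℝ] Vec n) * (Li : Vec n →ₗ[ℝ] Vec n) = 1 from
        congrArg ContinuousLinearMap.toLinearMap hLL, map_one]
    rw [map_mul] at this
    exact left_ne_zero_of_mul_eq_one this
  set r' := ‖Li‖ * (1 + r)
  obtain ⟨c, hc, hcle⟩ := exists_smul_volume_restrict_le_pi_gaussianReal (n := n) r'
  set d : ℝ≥0∞ := ENNReal.ofReal |(LinearMap.det (L : Vec n →ₗ[ℝ] Vec n))⁻¹| with hd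
  have hd0 : d ≠ 0 := by
    rw [hd]; simpa using hdet
  refine ⟨c * d, mul_ne_zero hc hd0, fun z hz => Measure.le_iff.2 fun s hs => ?_⟩
  have hmap : (multivariateGaussian 0 Γ).map (z + ·)
      = (Measure.pi fun _ : Fin n => gaussianReal 0 1).map
        (fun x => z + L (WithLp.toLp 2 x)) := by
    rw [multivariateGaussian, ← map_pi_eq_stdGaussian, Measure.map_map (by fun_prop) (by fun_prop),
      Measure.map_map (by fun_prop) (by fun_prop)]
    congr 1
    funext x
    simp [L]
  have hmeas2 : Measurable fun x : Fin n → ℝ => z + L (WithLp.toLp 2 x) := by fun_prop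
  rw [hmap, Measure.map_apply hmeas2 hs, Measure.smul_apply,
    Measure.restrict_apply' Metric.isOpen_ball.measurableSet, smul_eq_mul]
  set t : Set (Vec n) := s ∩ Metric.ball 0 1 with ht
  have htm : MeasurableSet t := hs.inter Metric.isOpen_ball.measurableSet
  have htz : MeasurableSet ((fun x : Vec n => z + x) ⁻¹' t) := htm.preimage (by fun_prop)
  have htL : MeasurableSet ((L : Vec n →ₗ[ℝ] Vec n) ⁻¹' ((fun x : Vec n => z + x) ⁻¹' t)) :=
    htz.preimage L.measurable
  have hvol : d * volume t = volume ((fun x : Fin n → ℝ => z + L (WithLp.toLp 2 x)) ⁻¹' t) := by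
    have h1 : (fun x : Fin n → ℝ => z + L (WithLp.toLp 2 x)) ⁻¹' t
        = WithLp.toLp 2 ⁻¹' ((L : Vec n →ₗ[ℝ] Vec n) ⁻¹' ((fun x : Vec n => z + x) ⁻¹' t)) := rfl
    rw [h1, (PiLp.volume_preserving_toLp (Fin n)).measure_preimage
      htL.nullMeasurableSet,
      Measure.addHaar_preimage_linearMap _ hdet, measure_preimage_add]
  calc c * d * volume t = c * volume ((fun x : Fin n → ℝ => z + L (WithLp.toLp 2 x)) ⁻¹' t) := by
        rw [mul_assoc, hvol]
    _ = (c • (volume : Measure (Fin n → ℝ)).restrict (Set.univ.pi fun _ => Set.Icc (-r') r'))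
        ((fun x : Fin n → ℝ => z + L (WithLp.toLp 2 x)) ⁻¹' t) := by
        rw [Measure.smul_apply,
          Measure.restrict_apply' (MeasurableSet.univ_pi fun _ => measurableSet_Icc), smul_eq_mul]
        congr 2
        refine (Set.inter_eq_left.2 fun x hx i _ => ?_).symm
        have h1 : ‖z + L (WithLp.toLp 2 x)‖ < 1 := by simpa using hx.2
        have h2 : ‖L (WithLp.toLp 2 x)‖ ≤ 1 + r := by
          calc ‖L (WithLp.toLp 2 x)‖ = ‖(z + L (WithLp.toLp 2 x)) - z‖ := by simp
            _ ≤ ‖z + L (WithLp.toLp 2 x)‖ + ‖z‖ := norm_sub_le _ _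
            _ ≤ 1 + r := by gcongr
        have h3 : ‖(WithLp.toLp 2 x : Vec n)‖ ≤ r' := by
          rw [← hinv (WithLp.toLp 2 x)]
          exact (Li.le_opNorm _).trans (mul_le_mul_of_nonneg_left h2 (norm_nonneg _))
        have h4 : ‖x i‖ ≤ r' := (PiLp.norm_apply_le (WithLp.toLp 2 x : Vec n) i).trans h3
        exact abs_le.1 h4
    _ ≤ (Measure.pi fun _ => gaussianReal 0 1)
        ((fun x : Fin n → ℝ => z + L (WithLp.toLp 2 x)) ⁻¹' t) := hcle _
    _ ≤ _ := measure_mono (Set.preimage_mono Set.inter_subset_left)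

end Gaussian

/-! ### Independence of sigma-algebras -/

section Independence

variable {Ω : Type*} {𝓖 mΩ : MeasurableSpace Ω} {μ : Measure Ω}

/-- If `a` and `b` are independent, and `c` is independent of both together, then `a` and `c`
together are independent of `b`. -/
theorem ProbabilityTheory.Indep.sup_left_of_sup [IsProbabilityMeasure μ]
    {a b c : MeasurableSpace Ω} (ha : a ≤ mΩ) (hb : b ≤ mΩ)
    (hc : c ≤ mΩ) (hab : Indep a b μ) (habc : Indep (a ⊔ b) c μ) :
    Indep (a ⊔ c) b μ := by
  let p : Set (Set Ω) := {u | ∃ s t, MeasurableSet[a] s ∧ MeasurableSet[c] t ∧ u = s ∩ t}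
  have hp : IsPiSystem p := by
    rintro _ ⟨s, t, hs, ht, rfl⟩ _ ⟨s', t', hs', ht', rfl⟩ -
    exact ⟨s ∩ s', t ∩ t', hs.inter hs', ht.inter ht', by ac_rfl⟩
  have hgen : a ⊔ c = MeasurableSpace.generateFrom p := by
    refine le_antisymm (sup_le (fun s hs => ?_) fun t ht => ?_)
      (MeasurableSpace.generateFrom_le ?_)
    · exact MeasurableSpace.measurableSet_generateFrom
        ⟨s, Set.univ, hs, MeasurableSet.univ, by simp⟩
    · exact MeasurableSpace.measurableSet_generateFrom
        ⟨Set.univ, t, MeasurableSet.univ, ht, by simp⟩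
    · rintro _ ⟨s, t, hs, ht, rfl⟩
      exact ((le_sup_left : a ≤ a ⊔ c) s hs).inter ((le_sup_right : c ≤ a ⊔ c) t ht)
  refine IndepSets.indep (sup_le ha hc) hb hp (@MeasurableSpace.isPiSystem_measurableSet Ω b)
    hgen (@MeasurableSpace.generateFrom_measurableSet Ω b).symm ?_
  rw [IndepSets_iff]
  rintro _ u ⟨s, t, hs, ht, rfl⟩ hu
  have h1 := (Indep_iff _ _ _).1 hab s u hs hu
  have hsa : MeasurableSet[a ⊔ b] s := (le_sup_left : a ≤ a ⊔ b) s hs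
  have hub : MeasurableSet[a ⊔ b] u := (le_sup_right : b ≤ a ⊔ b) u hu
  have h2 := (Indep_iff _ _ _).1 habc (s ∩ u) t (hsa.inter hub) ht
  have h3 := (Indep_iff _ _ _).1 habc s t hsa ht
  rw [show s ∩ t ∩ u = s ∩ u ∩ t by ac_rfl, h2, h1, h3]
  ring

theorem ProbabilityTheory.Indep.comap_congr {E : Type*} [MeasurableSpace E] {f g : Ω → E}
    (h : Indep (MeasurableSpace.comap f inferInstance) 𝓖 μ) (hfg : f =ᵐ[μ] g) :
    Indep (MeasurableSpace.comap g inferInstance) 𝓖 μ := by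
  rw [Indep_iff] at h ⊢
  rintro _ t ⟨A, hA, rfl⟩ ht
  have h1 : (g ⁻¹' A : Set Ω) =ᵐ[μ] (f ⁻¹' A : Set Ω) := by
    filter_upwards [hfg] with ω hω
    exact congrArg (· ∈ A) hω.symm
  rw [measure_congr (h1.inter (ae_eq_refl t)), measure_congr h1]
  exact h _ t ⟨A, hA, rfl⟩ ht

theorem integral_mul_of_indep {E : Type*} [MeasurableSpace E] (h𝓖 : 𝓖 ≤ mΩ)
    {w : Ω → E} (hw : Measurable w) (hind : Indep (MeasurableSpace.comap w inferInstance) 𝓖 μ)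
    {f : Ω → ℝ} (hf : Measurable[𝓖] f) {g : E → ℝ} (hg : Measurable g) :
    ∫ ω, f ω * g (w ω) ∂μ = (∫ ω, f ω ∂μ) * ∫ ω, g (w ω) ∂μ := by
  have hi : IndepFun f (fun ω => g (w ω)) μ := by
    rw [IndepFun_iff_Indep]
    refine indep_of_indep_of_le hind.symm hf.comap_le ?_
    exact (hg.comp (comap_measurable w)).comap_le
  exact hi.integral_fun_mul_eq_mul_integral (hf.mono h𝓖 le_rfl).aestronglyMeasurable
    (hg.comp hw).aestronglyMeasurable

end Independence

/-! ### Moments of Gaussian vectors -/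

section Gaussian

variable {n m l : ℕ} {Ω : Type*} {𝓖 mΩ : MeasurableSpace Ω} {μ : Measure Ω}

theorem memLp_two_of_map_eq {w : Ω → Vec n} (hw : Measurable w) {a : Vec n}
    {T : Matrix (Fin n) (Fin n) ℝ} (hl : μ.map w = multivariateGaussian a T) : MemLp w 2 μ := by
  have : MemLp id 2 (μ.map w) := by rw [hl]; exact IsGaussian.memLp_two_id
  exact (memLp_map_measure_iff (by fun_prop) hw.aemeasurable).1 this

theorem integral_eq_of_map_eq {w : Ω → Vec n} (hw : Measurable w) {a : Vec n}
    {T : Matrix (Fin n) (Fin n) ℝ} (hl : μ.map w = multivariateGaussian a T) :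
    ∫ ω, w ω ∂μ = a := by
  rw [← integral_map (f := fun x => x) hw.aemeasurable (by fun_prop), hl,
    integral_id_multivariateGaussian]

theorem MeasureTheory.MemLp.integrable_quad {z : Ω → Vec n} (hz : MemLp z 2 μ)
    (M : Matrix (Fin n) (Fin n) ℝ) : Integrable (fun ω => M.quad (z ω)) μ := by
  obtain ⟨c, hc, h⟩ := M.exists_abs_quad_le
  refine (hz.integrable_norm_pow (by norm_num)).const_mul c |>.mono'
    (M.continuous_quad.comp_aestronglyMeasurable hz.1) (ae_of_all _ fun ω => ?_)
  simpa using h (z ω)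

theorem MeasureTheory.MemLp.act {z : Ω → Vec n} {q : ℝ≥0∞} (hz : MemLp z q μ)
    (M : Matrix (Fin m) (Fin n) ℝ) : MemLp (fun ω => M.act (z ω)) q μ := by
  obtain ⟨c, hc, h⟩ := M.exists_norm_act_le
  exact hz.of_le_mul (M.continuous_act.comp_aestronglyMeasurable hz.1) (ae_of_all _ fun ω => h _)

theorem Matrix.bil_eq_sum (M : Matrix (Fin m) (Fin n) ℝ) (x : Vec m) (y : Vec n) :
    M.bil x y = ∑ i, ∑ j, M i j * (x i * y j) := by
  simp only [bil, dotProduct, mulVec, Finset.mul_sum]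
  exact Finset.sum_congr rfl fun i _ => Finset.sum_congr rfl fun j _ => by ring

theorem integral_sum_sum_mul {f : Fin m → Fin n → Ω → ℝ} (hf : ∀ i j, Integrable (f i j) μ)
    (M : Matrix (Fin m) (Fin n) ℝ) :
    ∫ ω, ∑ i, ∑ j, M i j * f i j ω ∂μ = ∑ i, ∑ j, M i j * ∫ ω, f i j ω ∂μ := by
  refine (integral_finsetSum _ fun i _ => integrable_finsetSum _ fun j _ =>
    (hf i j).const_mul (M i j)).trans (Finset.sum_congr rfl fun i _ => ?_)
  refine (integral_finsetSum _ fun j _ => (hf i j).const_mul (M i j)).trans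
    (Finset.sum_congr rfl fun j _ => ?_)
  exact integral_const_mul _ _

theorem charFun_multivariateGaussian_zero {T : Matrix (Fin n) (Fin n) ℝ} (hT : T.PosSemidef)
    (a : Vec n) : charFun (multivariateGaussian 0 T) a = Complex.exp (-(T.quad a : ℝ) / 2) := by
  rw [charFun_multivariateGaussian hT]
  congr 1
  simp [Matrix.quad, neg_div]

/-- The joint characteristic function of two independent centred Gaussian vectors. -/
theorem integral_cexp_inner_add_inner {e : Ω → Vec n} {v : Ω → Vec m} (he : Measurable e)
    (hv : Measurable v) {T : Matrix (Fin n) (Fin n) ℝ} {V : Matrix (Fin m) (Fin m) ℝ}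
    (hT : T.PosSemidef) (hV : V.PosSemidef) (hle : μ.map e = multivariateGaussian 0 T)
    (hlv : μ.map v = multivariateGaussian 0 V) (hind : IndepFun e v μ) (a : Vec n) (b : Vec m) :
    ∫ ω, Complex.exp ((inner ℝ (e ω) a + inner ℝ (v ω) b : ℝ) * Complex.I) ∂μ
      = Complex.exp (-(T.quad a + V.quad b : ℝ) / 2) := by
  have hi : IndepFun (fun ω => Complex.exp ((inner ℝ (e ω) a : ℝ) * Complex.I))
      (fun ω => Complex.exp ((inner ℝ (v ω) b : ℝ) * Complex.I)) μ :=
    hind.comp (φ := fun x => Complex.exp ((inner ℝ x a : ℝ) * Complex.I))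
      (ψ := fun x => Complex.exp ((inner ℝ x b : ℝ) * Complex.I)) (by fun_prop) (by fun_prop)
  have h1 : ∫ ω, Complex.exp ((inner ℝ (e ω) a : ℝ) * Complex.I) ∂μ
      = Complex.exp (-(T.quad a : ℝ) / 2) := by
    rw [← charFun_multivariateGaussian_zero hT, ← hle, charFun_apply,
      integral_map he.aemeasurable (by fun_prop)]
  have h2 : ∫ ω, Complex.exp ((inner ℝ (v ω) b : ℝ) * Complex.I) ∂μ
      = Complex.exp (-(V.quad b : ℝ) / 2) := by
    rw [← charFun_multivariateGaussian_zero hV, ← hlv, charFun_apply,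
      integral_map hv.aemeasurable (by fun_prop)]
  calc _ = ∫ ω, Complex.exp ((inner ℝ (e ω) a : ℝ) * Complex.I)
        * Complex.exp ((inner ℝ (v ω) b : ℝ) * Complex.I) ∂μ := by
        refine integral_congr_ae (ae_of_all _ fun ω => ?_)
        simp only
        rw [← Complex.exp_add]
        congr 1
        push_cast
        ring
    _ = _ := by
        rw [hi.integral_fun_mul_eq_mul_integral (by fun_prop) (by fun_prop), h1, h2,
          ← Complex.exp_add]
        congr 1
        push_cast
        ring

variable [IsProbabilityMeasure μ]

theorem integral_apply_eq_zero_of_map_eq {w : Ω → Vec n} (hw : Measurable w)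
    {T : Matrix (Fin n) (Fin n) ℝ} (hl : μ.map w = multivariateGaussian 0 T) (i : Fin n) :
    ∫ ω, w ω i ∂μ = 0 := by
  have h := (EuclideanSpace.proj (𝕜 := ℝ) i).integral_comp_comm
    ((memLp_two_of_map_eq hw hl).integrable one_le_two)
  rw [integral_eq_of_map_eq hw hl] at h
  simpa using h

theorem integral_mul_apply_of_map_eq {w : Ω → Vec n} (hw : Measurable w)
    {T : Matrix (Fin n) (Fin n) ℝ} (hT : T.PosSemidef)
    (hl : μ.map w = multivariateGaussian 0 T) (i j : Fin n) :
    ∫ ω, w ω i * w ω j ∂μ = T i j := by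
  have hm : ∀ i, MemLp (fun x : Vec n => x i) 2 (multivariateGaussian 0 T) := fun i =>
    (IsGaussian.memLp_two_id (μ := multivariateGaussian (0 : Vec n) T)).continuousLinearMap_comp
      (EuclideanSpace.proj (𝕜 := ℝ) i)
  have h0 : ∀ i, ∫ x, x i ∂(multivariateGaussian (0 : Vec n) T) = 0 := fun i => by
    have := integral_apply_eq_zero_of_map_eq hw hl i
    rwa [← integral_map (f := fun x : Vec n => x i) hw.aemeasurable (by fun_prop), hl] at this
  rw [← integral_map (f := fun x : Vec n => x i * x j) hw.aemeasurable (by fun_prop), hl,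
    ← covariance_eval_multivariateGaussian (μ := 0) hT i j, covariance_eq_sub (hm i) (hm j), h0, h0]
  simp

theorem integral_quad_of_map_eq {w : Ω → Vec n} (hw : Measurable w)
    {T : Matrix (Fin n) (Fin n) ℝ} (hT : T.PosSemidef)
    (hl : μ.map w = multivariateGaussian 0 T) (M : Matrix (Fin n) (Fin n) ℝ) :
    ∫ ω, M.quad (w ω) ∂μ = (M * T).trace := by
  have hi : ∀ i j, Integrable (fun ω => w ω i * w ω j) μ := fun i j =>
    MemLp.integrable_mul
      ((memLp_two_of_map_eq hw hl).continuousLinearMap_comp (EuclideanSpace.proj (𝕜 := ℝ) i))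
      ((memLp_two_of_map_eq hw hl).continuousLinearMap_comp (EuclideanSpace.proj (𝕜 := ℝ) j))
  simp only [quad_eq_bil, bil_eq_sum]
  refine (integral_sum_sum_mul hi M).trans ?_
  simp only [trace, diag, mul_apply]
  refine Finset.sum_congr rfl fun i _ => Finset.sum_congr rfl fun j _ => ?_
  rw [integral_mul_apply_of_map_eq hw hT hl, ← hT.transpose_eq,
    transpose_apply, hT.transpose_eq]

/-- Adding an independent centred Gaussian vector adds the trace term to a quadratic cost, also on
an event of the past. -/
theorem setIntegral_quad_add (h𝓖 : 𝓖 ≤ mΩ)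
    {w : Ω → Vec n} (hw : Measurable w) {T : Matrix (Fin n) (Fin n) ℝ} (hT : T.PosSemidef)
    (hl : μ.map w = multivariateGaussian 0 T)
    (hind : Indep (MeasurableSpace.comap w inferInstance) 𝓖 μ)
    {M : Matrix (Fin n) (Fin n) ℝ} (hM : Mᵀ = M) {z : Ω → Vec n} (hz : Measurable[𝓖] z)
    (hz2 : MemLp z 2 μ) {D : Set Ω} (hD : MeasurableSet[𝓖] D) :
    ∫ ω in D, M.quad (z ω + w ω) ∂μ = ∫ ω in D, M.quad (z ω) ∂μ + μ.real D * (M * T).trace := by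
  have hw2 := memLp_two_of_map_eq hw hl
  have hzi : ∀ i j, Integrable (fun ω => z ω i * w ω j) μ := fun i j =>
    MemLp.integrable_mul (hz2.continuousLinearMap_comp (EuclideanSpace.proj (𝕜 := ℝ) i))
      (hw2.continuousLinearMap_comp (EuclideanSpace.proj (𝕜 := ℝ) j))
  have hbil : Integrable (fun ω => M.bil (z ω) (w ω)) μ := by
    simp only [bil_eq_sum]
    exact integrable_finsetSum _ fun i _ => integrable_finsetSum _ fun j _ =>
      (hzi i j).const_mul _
  have hcross : ∫ ω in D, M.bil (z ω) (w ω) ∂μ = 0 := by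
    simp only [bil_eq_sum]
    refine (integral_sum_sum_mul (fun i j => (hzi i j).integrableOn) M).trans
      (Finset.sum_eq_zero fun i _ => Finset.sum_eq_zero fun j _ => ?_)
    rw [← integral_indicator (h𝓖 _ hD)]
    have : (D.indicator fun ω => z ω i * w ω j)
        = fun ω => D.indicator (fun ω => z ω i) ω * w ω j := by
      funext ω
      by_cases hω : ω ∈ D <;> simp [hω]
    have hzm : Measurable[𝓖] (D.indicator fun ω => z ω i) :=
      Measurable.indicator (m := 𝓖)
        ((by fun_prop : Measurable fun x : Vec n => x i).comp hz) hD
    rw [this, integral_mul_of_indep h𝓖 hw hind hzm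
      (g := fun x : Vec n => x j) (by fun_prop), integral_apply_eq_zero_of_map_eq hw hl]
    simp
  have hsq : ∫ ω in D, M.quad (w ω) ∂μ = μ.real D * (M * T).trace := by
    rw [← integral_indicator (h𝓖 _ hD)]
    have : (D.indicator fun ω => M.quad (w ω))
        = fun ω => D.indicator (fun _ => (1 : ℝ)) ω * M.quad (w ω) := by
      funext ω
      by_cases hω : ω ∈ D <;> simp [hω]
    rw [this, integral_mul_of_indep h𝓖 hw hind
      (Measurable.indicator (m := 𝓖) measurable_const hD) M.continuous_quad.measurable,
      integral_quad_of_map_eq hw hT hl, integral_indicator (h𝓖 _ hD)]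
    simp
  have hzw : Integrable (fun ω => M.quad (z ω) + M.quad (w ω)) μ :=
    (hz2.integrable_quad M).add (hw2.integrable_quad M)
  simp only [quad_add M hM]
  rw [integral_add hzw.integrableOn (hbil.const_mul 2).integrableOn,
    integral_add (hz2.integrable_quad M).integrableOn (hw2.integrable_quad M).integrableOn,
    integral_const_mul, hcross, hsq]
  ring

/-! ### Linear images of two independent Gaussian vectors -/

theorem Matrix.inner_act_left (M : Matrix (Fin m) (Fin n) ℝ) (x : Vec n) (y : Vec m) :
    inner ℝ (M.act x) y = inner ℝ x (Mᵀ.act y) := by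
  rw [real_inner_comm, inner_act, bil_comm, inner_act]

theorem Matrix.inner_act_add_act (M : Matrix (Fin l) (Fin n) ℝ) (N : Matrix (Fin l) (Fin m) ℝ)
    (x : Vec n) (y : Vec m) (t : Vec l) :
    inner ℝ (M.act x + N.act y) t = inner ℝ x (Mᵀ.act t) + inner ℝ y (Nᵀ.act t) := by
  rw [inner_add_left, inner_act_left, inner_act_left]

theorem posSemidef_mul_mul_add {T : Matrix (Fin n) (Fin n) ℝ} {V : Matrix (Fin m) (Fin m) ℝ}
    (hT : T.PosSemidef) (hV : V.PosSemidef) (M : Matrix (Fin l) (Fin n) ℝ)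
    (N : Matrix (Fin l) (Fin m) ℝ) : (M * T * Mᵀ + N * V * Nᵀ).PosSemidef := by
  have h1 := hT.mul_mul_conjTranspose_same M
  have h2 := hV.mul_mul_conjTranspose_same N
  rw [conjTranspose_eq_transpose_of_trivial] at h1 h2
  exact h1.add h2

/-- The law of a linear combination of two independent centred Gaussian vectors. -/
theorem map_act_add_act_eq {e : Ω → Vec n} {v : Ω → Vec m} (he : Measurable e)
    (hv : Measurable v) {T : Matrix (Fin n) (Fin n) ℝ} {V : Matrix (Fin m) (Fin m) ℝ}
    (hT : T.PosSemidef) (hV : V.PosSemidef) (hle : μ.map e = multivariateGaussian 0 T)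
    (hlv : μ.map v = multivariateGaussian 0 V) (hind : IndepFun e v μ)
    (M : Matrix (Fin l) (Fin n) ℝ) (N : Matrix (Fin l) (Fin m) ℝ) :
    μ.map (fun ω => M.act (e ω) + N.act (v ω))
      = multivariateGaussian 0 (M * T * Mᵀ + N * V * Nᵀ) := by
  have hm : Measurable fun ω => M.act (e ω) + N.act (v ω) :=
    (M.measurable_act.comp he).add (N.measurable_act.comp hv)
  have := Measure.isProbabilityMeasure_map (μ := μ) hm.aemeasurable
  refine Measure.ext_of_charFun (funext fun t => ?_)
  rw [charFun_multivariateGaussian_zero (posSemidef_mul_mul_add hT hV M N), charFun_apply,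
    integral_map hm.aemeasurable (by fun_prop)]
  simp only [inner_act_add_act]
  rw [integral_cexp_inner_add_inner he hv hT hV hle hlv hind, quad_act, quad_act,
    transpose_transpose, transpose_transpose, add_quad]

/-- Two linear combinations of independent centred Gaussian vectors are independent if they are
uncorrelated, which is the hypothesis `h0`. -/
theorem indepFun_act_add_act {k : ℕ} {e : Ω → Vec n} {v : Ω → Vec m} (he : Measurable e)
    (hv : Measurable v) {T : Matrix (Fin n) (Fin n) ℝ} {V : Matrix (Fin m) (Fin m) ℝ}
    (hT : T.PosSemidef) (hV : V.PosSemidef) (hle : μ.map e = multivariateGaussian 0 T)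
    (hlv : μ.map v = multivariateGaussian 0 V) (hind : IndepFun e v μ)
    (M : Matrix (Fin l) (Fin n) ℝ) (N : Matrix (Fin l) (Fin m) ℝ)
    (M' : Matrix (Fin k) (Fin n) ℝ) (N' : Matrix (Fin k) (Fin m) ℝ)
    (h0 : M * T * M'ᵀ + N * V * N'ᵀ = 0) :
    IndepFun (fun ω => M.act (e ω) + N.act (v ω)) (fun ω => M'.act (e ω) + N'.act (v ω)) μ := by
  have hm : Measurable fun ω => M.act (e ω) + N.act (v ω) :=
    (M.measurable_act.comp he).add (N.measurable_act.comp hv)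
  have hm' : Measurable fun ω => M'.act (e ω) + N'.act (v ω) :=
    (M'.measurable_act.comp he).add (N'.measurable_act.comp hv)
  rw [indepFun_iff_charFun_prod hm.aemeasurable hm'.aemeasurable]
  intro t
  rw [map_act_add_act_eq he hv hT hV hle hlv hind, map_act_add_act_eq he hv hT hV hle hlv hind,
    charFun_multivariateGaussian_zero (posSemidef_mul_mul_add hT hV M N),
    charFun_multivariateGaussian_zero (posSemidef_mul_mul_add hT hV M' N'), charFun_apply,
    integral_map (by fun_prop) (by fun_prop)]
  have e1 : ∀ ω, inner ℝ (WithLp.toLp 2 (M.act (e ω) + N.act (v ω), M'.act (e ω) + N'.act (v ω))) t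
      = inner ℝ (e ω) (Mᵀ.act t.ofLp.1 + M'ᵀ.act t.ofLp.2)
        + inner ℝ (v ω) (Nᵀ.act t.ofLp.1 + N'ᵀ.act t.ofLp.2) := fun ω => by
    rw [WithLp.prod_inner_apply]
    simp only [inner_act_add_act, inner_add_right]
    ring
  simp only [e1]
  rw [integral_cexp_inner_add_inner he hv hT hV hle hlv hind, ← Complex.exp_add,
    quad_add T hT.transpose_eq, quad_add V hV.transpose_eq, add_quad, add_quad]
  simp only [quad_act, bil_act_left, bil_act_right, transpose_transpose]
  have h1 : (M * (T * M'ᵀ)).bil t.ofLp.1 t.ofLp.2 + (N * (V * N'ᵀ)).bil t.ofLp.1 t.ofLp.2 = 0 := by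
    rw [← add_bil, ← Matrix.mul_assoc, ← Matrix.mul_assoc, h0]
    simp [bil]
  congr 1
  simp only [Matrix.mul_assoc] at h1 ⊢
  have h2 := congrArg (fun r : ℝ => (r : ℂ)) h1
  push_cast at h2 ⊢
  linear_combination -h2

end Gaussian

/-! ### The measurement update of the Kalman filter -/

namespace CodesignProblem

variable {nx nu ny : ℕ} (S : CodesignProblem nx nu ny)

/-- The Kalman gain for the a priori error covariance `T`. -/
noncomputable def filterGain (T : Matrix (Fin nx) (Fin nx) ℝ) : Matrix (Fin nx) (Fin ny) ℝ :=
  T * S.Cᵀ * (S.C * T * S.Cᵀ + S.covV)⁻¹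

theorem posDef_innovationCov (hV : S.covV.PosDef) {T : Matrix (Fin nx) (Fin nx) ℝ}
    (hT : T.PosSemidef) : (S.C * T * S.Cᵀ + S.covV).PosDef := by
  have := hT.mul_mul_conjTranspose_same S.C
  rw [conjTranspose_eq_transpose_of_trivial] at this
  exact PosDef.posSemidef_add this hV

theorem filterGain_mul (hV : S.covV.PosDef) {T : Matrix (Fin nx) (Fin nx) ℝ}
    (hT : T.PosSemidef) : S.filterGain T * (S.C * T * S.Cᵀ + S.covV) = T * S.Cᵀ := by
  rw [filterGain, Matrix.mul_assoc,
    nonsing_inv_mul _ (S.posDef_innovationCov hV hT).det_pos.ne'.isUnit, Matrix.mul_one]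

theorem filterGain_mul_mul_transpose (hV : S.covV.PosDef) {T : Matrix (Fin nx) (Fin nx) ℝ}
    (hT : T.PosSemidef) :
    S.filterGain T * (S.C * T * S.Cᵀ + S.covV) * (S.filterGain T)ᵀ = T - S.measurementUpdate T := by
  have hH := (S.posDef_innovationCov hV hT).posSemidef.transpose_eq
  rw [S.filterGain_mul hV hT, filterGain, measurementUpdate, transpose_mul, transpose_mul,
    transpose_nonsing_inv, hH, hT.transpose_eq, transpose_transpose]
  simp [Matrix.mul_assoc]

/-- The updated error `(1 - L C) e - L v` and the innovation `C e + v` are uncorrelated, if `L` is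
the Kalman gain. -/
theorem error_innovation_cov (hV : S.covV.PosDef) {T : Matrix (Fin nx) (Fin nx) ℝ}
    (hT : T.PosSemidef) :
    (1 - S.filterGain T * S.C) * T * S.Cᵀ
      + (-S.filterGain T) * S.covV * (1 : Matrix (Fin ny) (Fin ny) ℝ)ᵀ = 0 := by
  have h := S.filterGain_mul hV hT
  rw [Matrix.mul_add] at h
  simp only [Matrix.sub_mul, Matrix.one_mul, transpose_one, Matrix.mul_one, Matrix.neg_mul,
    Matrix.mul_assoc] at h ⊢
  nth_rewrite 1 [← h]
  abel

/-- The covariance of the updated error `(1 - L C) e - L v`. -/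
theorem error_cov (hV : S.covV.PosDef) {T : Matrix (Fin nx) (Fin nx) ℝ} (hT : T.PosSemidef) :
    (1 - S.filterGain T * S.C) * T * (1 - S.filterGain T * S.C)ᵀ
      + (-S.filterGain T) * S.covV * (-S.filterGain T)ᵀ = S.measurementUpdate T := by
  have h0 := S.error_innovation_cov hV hT
  rw [transpose_one, Matrix.mul_one] at h0
  have h1 : (1 - S.filterGain T * S.C) * T = S.measurementUpdate T := by
    simp [filterGain, measurementUpdate, Matrix.sub_mul, Matrix.mul_assoc]
  rw [transpose_sub, transpose_one, Matrix.mul_sub, Matrix.mul_one, transpose_neg, transpose_mul,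
    ← Matrix.mul_assoc, eq_neg_of_add_eq_zero_left h0, h1]
  simp

/-- The covariance of the correction `L (C e + v)` of the estimate. -/
theorem innovation_cov (hV : S.covV.PosDef) {T : Matrix (Fin nx) (Fin nx) ℝ} (hT : T.PosSemidef) :
    (S.filterGain T * S.C) * T * (S.filterGain T * S.C)ᵀ
      + S.filterGain T * S.covV * (S.filterGain T)ᵀ = T - S.measurementUpdate T := by
  rw [← S.filterGain_mul_mul_transpose hV hT]
  simp [Matrix.mul_add, Matrix.add_mul, Matrix.mul_assoc]

theorem posSemidef_measurementUpdate (hV : S.covV.PosDef) {T : Matrix (Fin nx) (Fin nx) ℝ}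
    (hT : T.PosSemidef) : (S.measurementUpdate T).PosSemidef := by
  rw [← S.error_cov hV hT]
  exact posSemidef_mul_mul_add hT hV.posSemidef _ _

theorem posSemidef_priorCov (hW : S.covW.PosDef) (hV : S.covV.PosDef) (hX : S.covX.PosSemidef)
    (k : ℕ) : (S.priorCov k).PosSemidef := by
  induction k with
  | zero => exact hX
  | succ k ih =>
    have := posSemidef_mul_mul_add (S.posSemidef_measurementUpdate hV ih) hW.posSemidef S.A 1
    simpa [priorCov] using this

theorem priorCov_eq (hS : S.FilterStationary) (k : ℕ) : S.priorCov k = S.covX := by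
  induction k with
  | zero => rfl
  | succ k ih =>
    rw [priorCov, ih]
    conv_rhs => rw [hS]
    simp only [measurementUpdate, Matrix.mul_sub, Matrix.sub_mul, Matrix.mul_assoc]
    abel

theorem postCov_eq (hS : S.FilterStationary) (k : ℕ) :
    S.postCov k = S.measurementUpdate S.covX := by
  rw [postCov, S.priorCov_eq hS]

theorem posDef_covX (hW : S.covW.PosDef) (hV : S.covV.PosDef) (hX : S.covX.PosSemidef)
    (hS : S.FilterStationary) : S.covX.PosDef := by
  rw [← S.priorCov_eq hS 1, priorCov]
  refine PosDef.posSemidef_add ?_ hW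
  have := (S.posSemidef_measurementUpdate hV hX).mul_mul_conjTranspose_same S.A
  rwa [conjTranspose_eq_transpose_of_trivial] at this

/-- The innovations are nondegenerate, because the output matrix is injective. -/
theorem posDef_sub_measurementUpdate (hV : S.covV.PosDef) (hX : S.covX.PosDef)
    (hC : S.C.rank = nx) : (S.covX - S.measurementUpdate S.covX).PosDef := by
  have hH := S.posDef_innovationCov hV hX.posSemidef
  have e : S.covX - S.measurementUpdate S.covX
      = (S.C * S.covX)ᵀ * (S.C * S.covX * S.Cᵀ + S.covV)⁻¹ * (S.C * S.covX) := by
    simp [measurementUpdate, hX.posSemidef.transpose_eq, Matrix.mul_assoc]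
  have hCinj : Function.Injective S.C.mulVec := by
    rw [mulVec_injective_iff, linearIndependent_iff_card_eq_finrank_span, Set.finrank,
      ← rank_eq_finrank_span_cols, hC]
    simp
  rw [e]
  refine posDef_of_quad ?_ fun x hx => ?_
  · rw [transpose_mul, transpose_mul (S.C * S.covX)ᵀ, hH.inv.posSemidef.transpose_eq,
      transpose_transpose, ← Matrix.mul_assoc]
  · rw [← quad_act]
    refine hH.inv.quad_pos fun h0 => hx ?_
    rw [act_mul] at h0
    have h1 : S.covX.act x = 0 := by
      have h0' : S.C *ᵥ (S.covX.act x).ofLp = 0 := congrArg WithLp.ofLp h0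
      rw [← mulVec_zero S.C] at h0'
      exact WithLp.ofLp_injective 2 (hCinj h0')
    by_contra hx'
    have := hX.quad_pos hx'
    rw [quad_eq_bil, bil] at this
    rw [show S.covX *ᵥ x.ofLp = 0 from congrArg WithLp.ofLp h1] at this
    simp at this

section FilterStep

variable {Ω : Type*} {𝓕 𝓕' 𝓝 mΩ : MeasurableSpace Ω} {μ : Measure Ω} [IsProbabilityMeasure μ]

/-- One measurement of the Kalman filter. The state is `m + e` with `m` known, and the prediction
error `e` and the measurement noise `v` are independent of the past information `𝓕`. The new
estimate is `m + η` with `η` independent of `𝓕`, and the new estimation error is independent of the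
information available after the measurement. -/
theorem exists_innovation (h𝓕 : 𝓕 ≤ mΩ) (hV : S.covV.PosDef) {T : Matrix (Fin nx) (Fin nx) ℝ}
    (hT : T.PosSemidef) {e m x : Ω → Vec nx} {v y : Ω → Vec ny} (he : Measurable e)
    (hv : Measurable v) (hle : μ.map e = multivariateGaussian 0 T)
    (hlv : μ.map v = multivariateGaussian 0 S.covV) (hev : IndepFun e v μ)
    (h𝓝 : 𝓝 = MeasurableSpace.comap e inferInstance ⊔ MeasurableSpace.comap v inferInstance)
    (hind : Indep 𝓝 𝓕 μ) (hm : Measurable[𝓕] m) (hmi : Integrable m μ) (hx : ∀ ω, x ω = m ω + e ω)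
    (hy : ∀ ω, y ω = S.C.act (x ω) + v ω)
    (h𝓕' : 𝓕' = 𝓕 ⊔ MeasurableSpace.comap y inferInstance) :
    Indep (MeasurableSpace.comap (fun ω => x ω - (condExp 𝓕' μ x) ω) inferInstance) 𝓕' μ ∧
    μ.map (fun ω => x ω - (condExp 𝓕' μ x) ω) = multivariateGaussian 0 (S.measurementUpdate T) ∧
    ∃ η : Ω → Vec nx, Measurable η ∧
      μ.map η = multivariateGaussian 0 (T - S.measurementUpdate T) ∧
      Indep (MeasurableSpace.comap η inferInstance) 𝓕 μ ∧
      condExp 𝓕' μ x =ᵐ[μ] fun ω => m ω + η ω := by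
  set L := S.filterGain T with hL
  -- `e'` is the error after the measurement, `ν` the innovation, `η` the correction of the estimate
  set e' : Ω → Vec nx := fun ω => (1 - L * S.C).act (e ω) + (-L).act (v ω) with he'
  set ν : Ω → Vec ny := fun ω => S.C.act (e ω) + (1 : Matrix (Fin ny) (Fin ny) ℝ).act (v ω) with hν
  set η : Ω → Vec nx := fun ω => (L * S.C).act (e ω) + L.act (v ω) with hη
  have h𝓝le : 𝓝 ≤ mΩ := h𝓝 ▸ sup_le he.comap_le hv.comap_le
  have heN : Measurable[𝓝] e := (comap_measurable e).mono (h𝓝 ▸ le_sup_left) le_rfl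
  have hvN : Measurable[𝓝] v := (comap_measurable v).mono (h𝓝 ▸ le_sup_right) le_rfl
  have hlin : ∀ {k : ℕ} (M : Matrix (Fin k) (Fin nx) ℝ) (N : Matrix (Fin k) (Fin ny) ℝ),
      Measurable[𝓝] fun ω => M.act (e ω) + N.act (v ω) := fun M N =>
    (M.measurable_act.comp heN).add (N.measurable_act.comp hvN)
  have he'N : Measurable[𝓝] e' := hlin _ _
  have hνN : Measurable[𝓝] ν := hlin _ _
  have hηN : Measurable[𝓝] η := hlin _ _
  have hee : ∀ ω, e ω = η ω + e' ω := fun ω => by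
    simp only [he', hη, sub_act, act_one, neg_act]
    abel
  have hηL : ∀ ω, η ω = L.act (ν ω) := fun ω => by
    simp only [hη, hν, act_add, act_mul, act_one]
  have hyν : ∀ ω, y ω = S.C.act (m ω) + ν ω := fun ω => by
    simp only [hy, hx, hν, act_add, act_one]
    abel
  have hvp := hV.posSemidef
  -- the new error and the innovation are uncorrelated, hence independent
  have hindν : IndepFun e' ν μ :=
    indepFun_act_add_act he hv hT hvp hle hlv hev _ _ _ _ (S.error_innovation_cov hV hT)
  have hle' : μ.map e' = multivariateGaussian 0 (S.measurementUpdate T) := by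
    rw [← S.error_cov hV hT]
    exact map_act_add_act_eq he hv hT hvp hle hlv hev _ _
  have hlη : μ.map η = multivariateGaussian 0 (T - S.measurementUpdate T) := by
    rw [← S.innovation_cov hV hT]
    exact map_act_add_act_eq he hv hT hvp hle hlv hev _ _
  have hm' : Measurable m := hm.mono h𝓕 le_rfl
  have hym : Measurable y := by
    have : y = fun ω => S.C.act (m ω) + ν ω := funext hyν
    rw [this]
    exact (S.C.measurable_act.comp hm').add (hνN.mono h𝓝le le_rfl)
  have h𝓕'le : 𝓕' ≤ mΩ := h𝓕' ▸ sup_le h𝓕 hym.comap_le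
  have h𝓕𝓕' : 𝓕 ≤ 𝓕' := h𝓕' ▸ le_sup_left
  have hνF' : Measurable[𝓕'] ν := by
    have h1 : Measurable[𝓕'] y := (comap_measurable y).mono (h𝓕' ▸ le_sup_right) le_rfl
    have h2 : ν = fun ω => y ω - S.C.act (m ω) := funext fun ω => by rw [hyν]; abel
    rw [h2]
    exact h1.sub (S.C.measurable_act.comp (hm.mono h𝓕𝓕' le_rfl))
  have hηF' : Measurable[𝓕'] η := by
    rw [show η = fun ω => L.act (ν ω) from funext hηL]
    exact L.measurable_act.comp hνF'
  have h𝓕'ν : 𝓕' ≤ 𝓕 ⊔ MeasurableSpace.comap ν inferInstance := by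
    rw [h𝓕']
    refine sup_le le_sup_left ?_
    have : Measurable[𝓕 ⊔ MeasurableSpace.comap ν inferInstance] y := by
      have h1 : Measurable[𝓕 ⊔ MeasurableSpace.comap ν inferInstance] ν :=
        Measurable.of_comap_le le_sup_right
      have h2 : Measurable[𝓕 ⊔ MeasurableSpace.comap ν inferInstance] m :=
        Measurable.of_comap_le (hm.comap_le.trans le_sup_left)
      rw [show y = fun ω => S.C.act (m ω) + ν ω from funext hyν]
      exact (S.C.measurable_act.comp h2).add h1
    exact this.comap_le
  have hindF' : Indep (MeasurableSpace.comap e' inferInstance) 𝓕' μ := by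
    have h1 : Indep (MeasurableSpace.comap ν inferInstance)
        (MeasurableSpace.comap e' inferInstance) μ := ((IndepFun_iff_Indep _ _ _).1 hindν).symm
    have h2 : Indep (MeasurableSpace.comap ν inferInstance ⊔ MeasurableSpace.comap e' inferInstance)
        𝓕 μ := indep_of_indep_of_le_left hind (sup_le hνN.comap_le he'N.comap_le)
    have h3 := h1.sup_left_of_sup (hνN.comap_le.trans h𝓝le) (he'N.comap_le.trans h𝓝le) h𝓕 h2
    exact indep_of_indep_of_le_right h3.symm (h𝓕'ν.trans (sup_comm _ _).le)
  have he'm : Measurable e' := he'N.mono h𝓝le le_rfl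
  have hηm : Measurable η := hηN.mono h𝓝le le_rfl
  have hηi : Integrable η μ := (memLp_two_of_map_eq hηm hlη).integrable one_le_two
  have he'i : Integrable e' μ := (memLp_two_of_map_eq he'm hle').integrable one_le_two
  have hcond : condExp 𝓕' μ x =ᵐ[μ] fun ω => m ω + η ω := by
    have hxe : x = (m + η) + e' := funext fun ω => by
      simp only [Pi.add_apply, hx, hee]
      abel
    have h1 : condExp 𝓕' μ (m + η) = m + η :=
      condExp_of_stronglyMeasurable h𝓕'le
        (((hm.mono h𝓕𝓕' le_rfl).add hηF').stronglyMeasurable) (hmi.add hηi)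
    have h2 : condExp 𝓕' μ e' =ᵐ[μ] fun _ => ∫ ω, e' ω ∂μ :=
      condExp_indep_eq he'm.comap_le h𝓕'le (comap_measurable e').stronglyMeasurable hindF'
    rw [hxe]
    refine (condExp_add (hmi.add hηi) he'i 𝓕').trans ?_
    rw [h1]
    filter_upwards [h2] with ω hω
    rw [Pi.add_apply, hω, integral_eq_of_map_eq he'm hle', add_zero, Pi.add_apply]
  have herr : (fun ω => x ω - (condExp 𝓕' μ x) ω) =ᵐ[μ] e' := by
    filter_upwards [hcond] with ω hω
    rw [hω, hx, hee]
    abel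
  refine ⟨?_, ?_, η, hηm, hlη, ?_, hcond⟩
  · exact hindF'.comap_congr herr.symm
  · rw [Measure.map_congr herr, hle']
  · exact indep_of_indep_of_le_left hind hηN.comap_le

end FilterStep

end CodesignProblem

/-! ### The closed loop -/

namespace CodesignProblem

variable {nx nu ny : ℕ} (S : CodesignProblem nx nu ny)

theorem comap_le_comap_pi {Ω ι E : Type*} [MeasurableSpace E] (f : ι → Ω → E) (i : ι) :
    MeasurableSpace.comap (f i) inferInstance
      ≤ MeasurableSpace.comap (fun ω i => f i ω) inferInstance :=
  ((measurable_pi_apply i).comp (comap_measurable fun ω i => f i ω)).comap_le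

/-- If the `σ`-algebras of `X`, of the whole first noise and of the whole second noise are
independent, and in each noise the part `Wn`, `Vn` is independent of the part `Wp`, `Vp`, then
`Wn ⊔ Vn` is independent of `X ⊔ (Wp ⊔ Vp)`. -/
theorem indep_sup_of_independent_families {Ω : Type*}
    {X Wp Wn Wall Vp Vn Vall mΩ : MeasurableSpace Ω} {μ : Measure Ω} [IsProbabilityMeasure μ]
    (hXl : X ≤ mΩ) (hWl : Wall ≤ mΩ) (hVl : Vall ≤ mΩ) (hWp : Wp ≤ Wall) (hWn : Wn ≤ Wall)
    (hVp : Vp ≤ Vall) (hVn : Vn ≤ Vall) (hW : Indep Wp Wn μ) (hV : Indep Vp Vn μ)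
    (hWV : Indep Wall Vall μ) (hX : Indep X (Wall ⊔ Vall) μ) :
    Indep (Wn ⊔ Vn) (X ⊔ (Wp ⊔ Vp)) μ := by
  have hWpl := hWp.trans hWl
  have hWnl := hWn.trans hWl
  have hVpl := hVp.trans hVl
  have hVnl := hVn.trans hVl
  have h1 : Indep (Wp ⊔ (Vp ⊔ Vn)) Wn μ := hW.sup_left_of_sup hWpl hWnl (sup_le hVpl hVnl)
    (indep_of_indep_of_le hWV (sup_le hWp hWn) (sup_le hVp hVn))
  have h2 : Indep (Vp ⊔ Wp) Vn μ := hV.sup_left_of_sup hVpl hVnl hWpl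
    (indep_of_indep_of_le hWV.symm (sup_le hVp hVn) hWp)
  have h3 : Indep (Vn ⊔ Wn) (Vp ⊔ Wp) μ := h2.symm.sup_left_of_sup hVnl (sup_le hVpl hWpl) hWnl
    (indep_of_indep_of_le_left h1 (by
      refine sup_le ?_ (sup_le ?_ ?_)
      · exact le_sup_right.trans le_sup_right
      · exact le_sup_left.trans le_sup_right
      · exact le_sup_left))
  have h4 : Indep ((Vp ⊔ Wp) ⊔ X) (Vn ⊔ Wn) μ :=
    h3.symm.sup_left_of_sup (sup_le hVpl hWpl) (sup_le hVnl hWnl) hXl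
      (indep_of_indep_of_le_left hX.symm (sup_le
        (sup_le (hVp.trans le_sup_right) (hWp.trans le_sup_left))
        (sup_le (hVn.trans le_sup_right) (hWn.trans le_sup_left))))
  rw [sup_comm Wn, sup_comm X, sup_comm Wp]
  exact h4.symm

theorem map_sub_multivariateGaussian {n : ℕ} (a : Vec n) (T : Matrix (Fin n) (Fin n) ℝ) :
    (multivariateGaussian a T).map (fun x => x - a) = multivariateGaussian 0 T := by
  rw [multivariateGaussian, multivariateGaussian, Measure.map_map (by fun_prop) (by fun_prop)]
  congr 1
  funext x
  simp

section Past

variable {Ω : Type*} (x₀ : Ω → Vec nx) (w : ℕ → Ω → Vec nx) (v : ℕ → Ω → Vec ny)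

/-- The `σ`-algebra of the random variables that have acted on the closed loop up to the measurement
at time `k`. -/
@[reducible] def past (k : ℕ) : MeasurableSpace Ω :=
  MeasurableSpace.comap x₀ inferInstance
    ⊔ ((⨆ i ∈ Set.Iio k, MeasurableSpace.comap (w i) inferInstance)
      ⊔ ⨆ i ∈ Set.Iic k, MeasurableSpace.comap (v i) inferInstance)

variable {x₀ w v} in
theorem measurable_past_x₀ (k : ℕ) : Measurable[past x₀ w v k] x₀ :=
  Measurable.of_comap_le le_sup_left

variable {x₀ w v} in
theorem measurable_past_w {k i : ℕ} (hi : i < k) : Measurable[past x₀ w v k] (w i) :=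
  Measurable.of_comap_le <| le_sup_of_le_right <| le_sup_of_le_left <|
    le_iSup₂_of_le i hi le_rfl

variable {x₀ w v} in
theorem measurable_past_v {k i : ℕ} (hi : i ≤ k) : Measurable[past x₀ w v k] (v i) :=
  Measurable.of_comap_le <| le_sup_of_le_right <| le_sup_of_le_right <|
    le_iSup₂_of_le i hi le_rfl

variable {x₀ w v} in
theorem past_mono {k l : ℕ} (h : k ≤ l) : past x₀ w v k ≤ past x₀ w v l := by
  refine sup_le_sup_left (sup_le_sup ?_ ?_) _
  · exact biSup_mono fun i hi => lt_of_lt_of_le hi h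
  · exact biSup_mono fun i hi => le_trans hi h

end Past

section Loop

variable {Ω : Type*} [mΩ : MeasurableSpace Ω] {μ : Measure Ω} {x₀ : Ω → Vec nx}
  {w : ℕ → Ω → Vec nx} {v : ℕ → Ω → Vec ny} {K : Controller nx nu} {S}

theorem IsGaussianNoise.past_le (hN : S.IsGaussianNoise μ x₀ w v) (k : ℕ) :
    past x₀ w v k ≤ mΩ :=
  sup_le hN.measurable_x₀.comap_le (sup_le (iSup₂_le fun i _ => (hN.measurable_w i).comap_le)
    (iSup₂_le fun i _ => (hN.measurable_v i).comap_le))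

theorem IsGaussianNoise.indepFun_w_v (hN : S.IsGaussianNoise μ x₀ w v) (i j : ℕ) :
    IndepFun (w i) (v j) μ :=
  hN.indep_w_v.comp (measurable_pi_apply i) (measurable_pi_apply j)

theorem IsGaussianNoise.indepFun_x₀_v (hN : S.IsGaussianNoise μ x₀ w v) (j : ℕ) :
    IndepFun x₀ (v j) μ :=
  hN.indep_x₀.comp measurable_id ((measurable_pi_apply j).comp measurable_snd)

/-- The noise that acts after the measurement at time `k` is independent of the past. -/
theorem IsGaussianNoise.indep_past [IsProbabilityMeasure μ]
    (hN : S.IsGaussianNoise μ x₀ w v) (k : ℕ) :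
    Indep (MeasurableSpace.comap (w k) inferInstance
      ⊔ MeasurableSpace.comap (v (k + 1)) inferInstance) (past x₀ w v k) μ := by
  have hW := indep_iSup_of_disjoint (fun i => (hN.measurable_w i).comap_le)
    ((iIndepFun_iff_iIndep _ _ _).1 hN.indep_w) (S := Set.Iio k) (T := {k}) (by simp)
  have hV := indep_iSup_of_disjoint (fun i => (hN.measurable_v i).comap_le)
    ((iIndepFun_iff_iIndep _ _ _).1 hN.indep_v) (S := Set.Iic k) (T := {k + 1}) (by simp)
  rw [iSup_singleton] at hW hV
  have hX : Indep (MeasurableSpace.comap x₀ inferInstance)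
      (MeasurableSpace.comap (fun ω k => w k ω) inferInstance
        ⊔ MeasurableSpace.comap (fun ω k => v k ω) inferInstance) μ := by
    refine indep_of_indep_of_le_right ((IndepFun_iff_Indep _ _ _).1 hN.indep_x₀) (sup_le ?_ ?_)
    · exact (measurable_fst.comp
        (comap_measurable fun ω => ((fun k => w k ω), (fun k => v k ω)))).comap_le
    · exact (measurable_snd.comp
        (comap_measurable fun ω => ((fun k => w k ω), (fun k => v k ω)))).comap_le
  exact indep_sup_of_independent_families hN.measurable_x₀.comap_le
    (measurable_pi_lambda _ hN.measurable_w).comap_le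
    (measurable_pi_lambda _ hN.measurable_v).comap_le
    (iSup₂_le fun i _ => comap_le_comap_pi w i) (comap_le_comap_pi w k)
    (iSup₂_le fun i _ => comap_le_comap_pi v i) (comap_le_comap_pi v (k + 1))
    hW hV ((IndepFun_iff_Indep _ _ _).1 hN.indep_w_v) hX

theorem IsGaussianNoise.indep_w_past [IsProbabilityMeasure μ]
    (hN : S.IsGaussianNoise μ x₀ w v) (k : ℕ) :
    Indep (MeasurableSpace.comap (w k) inferInstance) (past x₀ w v k) μ :=
  indep_of_indep_of_le_left (hN.indep_past k) le_sup_left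

variable (S μ x₀ w v K)

/-- What is known about the closed loop at time `k`: the information is generated by the past, and
the estimation error is independent of it, with the covariance of the Kalman filter. -/
structure LoopInvariant (k : ℕ) : Prop where
  info_le : (S.loop μ x₀ w v K k).info ≤ past x₀ w v k
  measurable_est : ∀ i, Measurable[(S.loop μ x₀ w v K k).info] ((S.loop μ x₀ w v K k).est i)
  measurable_state : Measurable[past x₀ w v k] (S.loop μ x₀ w v K k).state
  memLp_state : MemLp (S.loop μ x₀ w v K k).state 2 μ
  indep_error : Indep (MeasurableSpace.comap (fun ω => (S.loop μ x₀ w v K k).state ω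
    - (S.loop μ x₀ w v K k).est k ω) inferInstance) (S.loop μ x₀ w v K k).info μ
  law_error : μ.map (fun ω => (S.loop μ x₀ w v K k).state ω - (S.loop μ x₀ w v K k).est k ω)
    = multivariateGaussian 0 (S.postCov k)

variable {S μ x₀ w v K}

theorem LoopInvariant.memLp_est {k : ℕ} (h : S.LoopInvariant μ x₀ w v K k)
    (hN : S.IsGaussianNoise μ x₀ w v) : MemLp ((S.loop μ x₀ w v K k).est k) 2 μ := by
  have hm : Measurable fun ω => (S.loop μ x₀ w v K k).state ω - (S.loop μ x₀ w v K k).est k ω :=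
    (h.measurable_state.mono (hN.past_le k) le_rfl).sub
      ((h.measurable_est k).mono (h.info_le.trans (hN.past_le k)) le_rfl)
  have := h.memLp_state.sub (memLp_two_of_map_eq hm h.law_error)
  refine this.congr_norm ?_ (ae_of_all _ fun ω => ?_)
  · exact ((h.measurable_est k).mono (h.info_le.trans (hN.past_le k)) le_rfl).aestronglyMeasurable
  · simp

theorem LoopInvariant.measurable_action {k : ℕ} (h : S.LoopInvariant μ x₀ w v K k)
    (hKm : ∀ k, Measurable (K k)) :
    Measurable[(S.loop μ x₀ w v K k).info]
      fun ω => K k fun i => (S.loop μ x₀ w v K k).est i ω :=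
  (hKm k).comp (@measurable_pi_lambda _ _ _ (S.loop μ x₀ w v K k).info _ _ h.measurable_est)

theorem LoopInvariant.memLp_input {k : ℕ} (h : S.LoopInvariant μ x₀ w v K k)
    (hN : S.IsGaussianNoise μ x₀ w v) (hKm : ∀ k, Measurable (K k))
    (hKb : ∀ k, ∃ c : ℝ, ∀ xs, ‖(K k xs).1‖ ≤ c * ‖xs k‖) :
    MemLp (S.input μ x₀ w v K k) 2 μ := by
  obtain ⟨c, hc⟩ := hKb k
  refine (h.memLp_est hN).of_le_mul (c := c) ?_ (ae_of_all _ fun ω => hc _)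
  exact (measurable_fst.comp ((h.measurable_action hKm).mono
    (h.info_le.trans (hN.past_le k)) le_rfl)).aestronglyMeasurable

variable [IsProbabilityMeasure μ]

/-- Before the first measurement nothing is known, and the error of the prediction `meanX` has the
covariance `covX`. -/
theorem loopInvariant_zero (hN : S.IsGaussianNoise μ x₀ w v)
    (hV : S.covV.PosDef) (hX : S.covX.PosSemidef) : S.LoopInvariant μ x₀ w v K 0 := by
  have hm0 : Measurable fun ω => x₀ ω - S.meanX := hN.measurable_x₀.sub_const _
  have hx2 : MemLp x₀ 2 μ := memLp_two_of_map_eq hN.measurable_x₀ hN.law_x₀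
  have hle : μ.map (fun ω => x₀ ω - S.meanX) = multivariateGaussian 0 S.covX := by
    rw [← map_sub_multivariateGaussian S.meanX, ← hN.law_x₀,
      Measure.map_map (by fun_prop) hN.measurable_x₀]
    rfl
  have hev : IndepFun (fun ω => x₀ ω - S.meanX) (v 0) μ :=
    (hN.indepFun_x₀_v 0).comp (measurable_id.sub_const S.meanX) measurable_id
  obtain ⟨h1, h2, -⟩ := S.exists_innovation (𝓕 := ⊥) bot_le hV hX hm0 (hN.measurable_v 0) hle
    (hN.law_v 0) hev rfl (indep_bot_right _) (m := fun _ => S.meanX) measurable_const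
    (integrable_const _) (x := x₀) (fun ω => by abel)
    (y := fun ω => S.C.act (x₀ ω) + v 0 ω) (fun ω => rfl) (𝓕' := (S.loop μ x₀ w v K 0).info)
    (bot_sup_eq _).symm
  refine ⟨?_, ?_, measurable_past_x₀ 0, hx2, ?_, ?_⟩
  · have : Measurable[past x₀ w v 0] fun ω => S.C.act (x₀ ω) + v 0 ω :=
      (S.C.measurable_act.comp (measurable_past_x₀ 0)).add (measurable_past_v le_rfl)
    exact this.comap_le
  · intro i
    by_cases hi : i = 0
    · subst hi
      simp only [loop, Function.update_self]
      exact stronglyMeasurable_condExp.measurable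
    · simp only [loop, Function.update_of_ne hi]
      exact measurable_const
  · simpa only [loop, Function.update_self] using h1
  · simpa only [loop, Function.update_self, postCov, priorCov] using h2

/-- One step of the closed loop. The action is a function of the known estimates, so the error of
the prediction of the next state does not depend on it, and the measurement update applies. The new
estimate is the prediction plus a Gaussian innovation that is independent of the information. -/
theorem LoopInvariant.succ {k : ℕ} (h : S.LoopInvariant μ x₀ w v K k)
    (hN : S.IsGaussianNoise μ x₀ w v) (hW : S.covW.PosDef) (hV : S.covV.PosDef)
    (hX : S.covX.PosSemidef) (hKm : ∀ k, Measurable (K k))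
    (hKb : ∀ k, ∃ c : ℝ, ∀ xs, ‖(K k xs).1‖ ≤ c * ‖xs k‖) :
    S.LoopInvariant μ x₀ w v K (k + 1) ∧ ∃ η : Ω → Vec nx, Measurable η ∧
      μ.map η = multivariateGaussian 0 (S.priorCov (k + 1) - S.postCov (k + 1)) ∧
      Indep (MeasurableSpace.comap η inferInstance) (S.loop μ x₀ w v K k).info μ ∧
      (S.loop μ x₀ w v K (k + 1)).est (k + 1) =ᵐ[μ] fun ω =>
        S.A.act ((S.loop μ x₀ w v K k).est k ω) + S.B.act (S.input μ x₀ w v K k ω) + η ω := by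
  obtain ⟨c, hc⟩ : ∃ c, c = S.loop μ x₀ w v K k := ⟨_, rfl⟩
  have hinfo := h.info_le
  have hest := h.measurable_est
  have hstate := h.measurable_state
  have hmem := h.memLp_state
  have hind := h.indep_error
  have hlaw := h.law_error
  have hact := h.measurable_action hKm
  have hestL := h.memLp_est hN
  have hinL := h.memLp_input hN hKm hKb
  have hin : ∀ ω, S.input μ x₀ w v K k ω = (K k fun i => c.est i ω).1 := fun ω => by
    rw [hc]; rfl
  rw [funext hin] at hinL
  simp only [hin]
  rw [← hc] at hinfo hest hstate hmem hind hlaw hact hestL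
  rw [← hc]
  set a : Ω → Vec nu × Bool := fun ω => K k fun i => c.est i ω with ha
  set x : Ω → Vec nx := fun ω => S.A.act (c.state ω) + S.B.act (a ω).1 + w k ω with hx
  set y : Ω → Vec ny := fun ω => S.C.act (x ω) + v (k + 1) ω with hy
  have hstate' : (S.loop μ x₀ w v K (k + 1)).state = x := by
    rw [hx, ha, hc]
    rfl
  -- the action is a function of the information, and adds nothing to it
  have hinfo' : (S.loop μ x₀ w v K (k + 1)).info
      = c.info ⊔ MeasurableSpace.comap y inferInstance := by
    rw [← sup_eq_left.2 hact.comap_le, hy, hx, ha, hc]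
    rfl
  have hest' : (S.loop μ x₀ w v K (k + 1)).est = Function.update c.est (k + 1)
      (condExp (S.loop μ x₀ w v K (k + 1)).info μ x) := by
    rw [hx, ha, hc]
    rfl
  have hpast := hN.past_le k
  have hW' := hN.measurable_w k
  have hV' := hN.measurable_v (k + 1)
  have hEpast : Measurable[past x₀ w v k] fun ω => c.state ω - c.est k ω :=
    hstate.sub ((hest k).mono hinfo le_rfl)
  have hE : Measurable fun ω => c.state ω - c.est k ω := hEpast.mono hpast le_rfl
  -- `E` is the estimation error at time `k`, and `e` the error of the prediction of the next state
  set E : Ω → Vec nx := fun ω => c.state ω - c.est k ω with hEdef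
  set e : Ω → Vec nx := fun ω => S.A.act (E ω) + (1 : Matrix (Fin nx) (Fin nx) ℝ).act (w k ω)
    with he
  have hem : Measurable e := (S.A.measurable_act.comp hE).add
    ((1 : Matrix (Fin nx) (Fin nx) ℝ).measurable_act.comp hW')
  have hT := S.posSemidef_priorCov hW hV hX
  have hEw : IndepFun E (w k) μ := by
    rw [IndepFun_iff_Indep]
    exact (indep_of_indep_of_le_right (hN.indep_w_past k) hEpast.comap_le).symm
  have hpost : (S.postCov k).PosSemidef := S.posSemidef_measurementUpdate hV (hT k)
  have hlaw_e : μ.map e = multivariateGaussian 0 (S.priorCov (k + 1)) := by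
    rw [map_act_add_act_eq hE hW' hpost hW.posSemidef hlaw (hN.law_w k) hEw]
    simp [priorCov, postCov]
  have hecomap : MeasurableSpace.comap e inferInstance ≤ MeasurableSpace.comap (w k) inferInstance
      ⊔ MeasurableSpace.comap E inferInstance := by
    have h1 : Measurable[MeasurableSpace.comap (w k) inferInstance
      ⊔ MeasurableSpace.comap E inferInstance] (w k) := Measurable.of_comap_le le_sup_left
    have h2 : Measurable[MeasurableSpace.comap (w k) inferInstance
      ⊔ MeasurableSpace.comap E inferInstance] E := Measurable.of_comap_le le_sup_right
    exact ((S.A.measurable_act.comp h2).add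
      ((1 : Matrix (Fin nx) (Fin nx) ℝ).measurable_act.comp h1)).comap_le
  have hev : IndepFun e (v (k + 1)) μ := by
    rw [IndepFun_iff_Indep]
    refine indep_of_indep_of_le_left ?_ hecomap
    exact Indep.sup_left_of_sup hW'.comap_le hV'.comap_le hE.comap_le
      ((IndepFun_iff_Indep _ _ _).1 (hN.indepFun_w_v k (k + 1)))
      (indep_of_indep_of_le_right (hN.indep_past k) hEpast.comap_le)
  have hindN : Indep (MeasurableSpace.comap e inferInstance
      ⊔ MeasurableSpace.comap (v (k + 1)) inferInstance) c.info μ := by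
    refine indep_of_indep_of_le_left (hind.sup_left_of_sup hE.comap_le (hinfo.trans hpast)
      (sup_le hW'.comap_le hV'.comap_le)
      (indep_of_indep_of_le_left (hN.indep_past k).symm (sup_le hEpast.comap_le hinfo))) ?_
    refine sup_le (hecomap.trans (sup_le ?_ le_sup_left)) ?_
    · exact le_sup_left.trans le_sup_right
    · exact le_sup_right.trans le_sup_right
  have hmm : Measurable[c.info] fun ω => S.A.act (c.est k ω) + S.B.act (a ω).1 :=
    (S.A.measurable_act.comp (hest k)).add (S.B.measurable_act.comp (measurable_fst.comp hact))
  have hmL : MemLp (fun ω => S.A.act (c.est k ω) + S.B.act (a ω).1) 2 μ :=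
    (hestL.act S.A).add (hinL.act S.B)
  obtain ⟨h1, h2, η, h3, h4, h5, h6⟩ := S.exists_innovation (hinfo.trans hpast) hV (hT (k + 1)) hem
    hV' hlaw_e (hN.law_v (k + 1)) hev rfl hindN hmm (hmL.integrable one_le_two) (x := x)
    (fun ω => by simp only [hx, he, hEdef, act_sub, act_one]; abel) (y := y) (fun ω => rfl) hinfo'
  have hxpast : Measurable[past x₀ w v (k + 1)] x :=
    ((S.A.measurable_act.comp (hstate.mono (past_mono k.le_succ) le_rfl)).add
      (S.B.measurable_act.comp (measurable_fst.comp
        (hact.mono (hinfo.trans (past_mono k.le_succ)) le_rfl)))).add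
      (measurable_past_w k.lt_succ_self)
  have hypast : Measurable[past x₀ w v (k + 1)] y :=
    (S.C.measurable_act.comp hxpast).add (measurable_past_v le_rfl)
  refine ⟨⟨?_, fun i => ?_, ?_, ?_, ?_, ?_⟩, η, h3, h4, h5, ?_⟩
  · rw [hinfo']
    exact sup_le (hinfo.trans (past_mono k.le_succ)) hypast.comap_le
  · rw [hest']
    by_cases hi : i = k + 1
    · subst hi
      rw [Function.update_self]
      exact stronglyMeasurable_condExp.measurable
    · rw [Function.update_of_ne hi]
      exact (hest i).mono (hinfo'.symm ▸ le_sup_left) le_rfl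
  · rw [hstate']
    exact hxpast
  · rw [hstate']
    exact ((hmem.act S.A).add (hinL.act S.B)).add (memLp_two_of_map_eq hW' (hN.law_w k))
  · rw [hstate', hest', Function.update_self]
    exact h1
  · rw [hstate', hest', Function.update_self]
    exact h2
  · rw [hest', Function.update_self]
    exact h6

theorem loopInvariant (hN : S.IsGaussianNoise μ x₀ w v) (hW : S.covW.PosDef) (hV : S.covV.PosDef)
    (hX : S.covX.PosSemidef) (hKm : ∀ k, Measurable (K k))
    (hKb : ∀ k, ∃ c : ℝ, ∀ xs, ‖(K k xs).1‖ ≤ c * ‖xs k‖) (k : ℕ) :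
    S.LoopInvariant μ x₀ w v K k := by
  induction k with
  | zero => exact loopInvariant_zero hN hV hX
  | succ k ih => exact (ih.succ hN hW hV hX hKm hKb).1

end Loop

end CodesignProblem

/-! ### One block of the rollout policy -/

namespace CodesignProblem

variable {nx nu ny : ℕ} (S : CodesignProblem nx nu ny)

/-- The gain that the rollout policy applies at step `s` of the schedule `m`. -/
noncomputable def inputGain (m : S.Schedule) (s : ℕ) : Matrix (Fin nu) (Fin nx) ℝ :=
  if S.entry m s then S.rolloutGain m s else 0

/-- The closed loop matrix at step `s` of the schedule `m`. -/
noncomputable def stepMatrix (m : S.Schedule) (s : ℕ) : Matrix (Fin nx) (Fin nx) ℝ :=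
  S.A + S.B * S.inputGain m s

/-- The product of the closed loop matrices of the steps `0, …, s - 1` of the schedule `m`. -/
noncomputable def transition (m : S.Schedule) : ℕ → Matrix (Fin nx) (Fin nx) ℝ
  | 0 => 1
  | s + 1 => S.stepMatrix m s * transition m s

/-- The stationary covariance of the estimation error. -/
noncomputable def errorCov : Matrix (Fin nx) (Fin nx) ℝ := S.measurementUpdate S.covX

/-- The stationary covariance of the innovations of the estimate. -/
noncomputable def innovCov : Matrix (Fin nx) (Fin nx) ℝ := S.covX - S.errorCov

/-- The covariance of the noise that the estimate collects in the steps `0, …, s - 1` of the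
schedule `m`. -/
noncomputable def transitionCov (m : S.Schedule) : ℕ → Matrix (Fin nx) (Fin nx) ℝ
  | 0 => 0
  | s + 1 => S.stepMatrix m s * transitionCov m s * (S.stepMatrix m s)ᵀ + S.innovCov

/-- The part of the cost of a block under the schedule `m` that does not depend on the estimate. -/
noncomputable def blockNoiseCost (m : S.Schedule) : ℝ :=
  ∑ s ∈ Finset.range S.h,
    ((S.Q * S.errorCov).trace + (S.costMatrix m (s + 1) * S.innovCov).trace)

theorem stepMatrix_act (m : S.Schedule) (s : ℕ) (z : Vec nx) :
    (S.stepMatrix m s).act z = S.A.act z + S.B.act ((S.inputGain m s).act z) := by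
  rw [stepMatrix, add_act, act_mul]

theorem costMatrix_horizon (m : S.Schedule) : S.costMatrix m S.h = S.Pper := by
  rw [costMatrix, Nat.sub_self, costMatrixToGo]

theorem costMatrix_eq_riccatiStep (m : S.Schedule) {s : ℕ} (hs : s < S.h) :
    S.costMatrix m s = S.riccatiStep (S.entry m s) (S.costMatrix m (s + 1)) := by
  obtain ⟨j, hj⟩ : ∃ j, S.h - s = j + 1 := ⟨S.h - s - 1, by omega⟩
  have h1 : S.h - (s + 1) = j := by omega
  have h2 : S.h - (j + 1) = s := by omega
  rw [costMatrix, costMatrix, hj, h1, costMatrixToGo, h2]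

variable {S}

theorem posDef_costMatrix (hR : S.R.PosDef) (hQ : S.Q.PosDef) (hP : S.Pper.PosDef)
    (m : S.Schedule) (s : ℕ) : (S.costMatrix m s).PosDef := by
  rw [costMatrix]
  induction S.h - s with
  | zero => exact hP
  | succ j ih => exact S.posDef_riccatiStep hR hQ _ ih.posSemidef

/-- The cost matrices evaluate the schedule: cost of a step plus cost-to-go after it. -/
theorem quad_costMatrix (hR : S.R.PosDef) (hQ : S.Q.PosDef) (hP : S.Pper.PosDef)
    (m : S.Schedule) {s : ℕ} (hs : s < S.h) (z : Vec nx) :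
    (S.costMatrix m s).quad z = S.Q.quad z + S.R.quad ((S.inputGain m s).act z)
      + (S.costMatrix m (s + 1)).quad ((S.stepMatrix m s).act z) := by
  have e : (S.inputGain m s).act z
      = if S.entry m s then (S.stepGain (S.costMatrix m (s + 1))).act z else 0 := by
    rw [inputGain]
    split_ifs
    · rfl
    · exact zero_act z
  rw [S.costMatrix_eq_riccatiStep m hs, stepMatrix_act, e]
  exact S.riccatiStep_quad hR _ (posDef_costMatrix hR hQ hP m (s + 1)).posSemidef z

/-- The estimation penalty is what actuation gains over an uncontrolled step. -/
theorem costMatrix_add_estimationPenalty (hR : S.R.PosDef) (hQ : S.Q.PosDef) (hP : S.Pper.PosDef)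
    (m : S.Schedule) {s : ℕ} (hs : s < S.h) :
    S.costMatrix m s + S.estimationPenalty m s = S.Q + S.Aᵀ * S.costMatrix m (s + 1) * S.A := by
  have hPs := (posDef_costMatrix hR hQ hP m (s + 1)).posSemidef
  rw [S.costMatrix_eq_riccatiStep m hs, estimationPenalty]
  cases S.entry m s
  · simp [riccatiStep]
  · have hT := S.riccatiStep_transpose hR hQ true hPs
    refine eq_of_quad ?_ ?_ fun z => ?_
    · rw [transpose_add, hT]
      simp [transpose_mul, hPs.transpose_eq, hR.posSemidef.transpose_eq, Matrix.mul_assoc]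
    · simp [hQ.posSemidef.transpose_eq, hPs.transpose_eq, Matrix.mul_assoc]
    · have := S.stage_add_costToGo hR hPs z 0
      rw [if_pos rfl, add_quad, add_quad, ← quad_act, ← quad_act, rolloutGain]
      rw [quad_zero, act_zero, zero_sub, add_zero, add_zero, ← neg_one_smul ℝ, quad_smul] at this
      linarith

/-- The Kalman filter is stationary: the error of the prediction splits into the new estimation
error and the innovation. -/
theorem mul_errorCov_mul_add (hS : S.FilterStationary) :
    S.A * S.errorCov * S.Aᵀ + S.covW = S.errorCov + S.innovCov := by
  have := S.priorCov_eq hS 1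
  rw [priorCov, priorCov] at this
  rw [errorCov, this, innovCov, errorCov]
  abel

/-- The lookahead cost in terms of the innovations: the terms with the process noise and the
estimation penalties telescope. -/
theorem lookaheadCost_eq (hR : S.R.PosDef) (hQ : S.Q.PosDef) (hP : S.Pper.PosDef)
    (hS : S.FilterStationary) (k : ℕ) (m : S.Schedule) (z : Vec nx) :
    S.lookaheadCost k m z = (S.costMatrix m 0).quad z + S.blockNoiseCost m
      + (S.Pper * S.errorCov).trace + S.actuationCost m := by
  have hstep : ∀ s ∈ Finset.range S.h, (S.costMatrix m (s + 1) * S.covW).trace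
      + (S.estimationPenalty m s * S.postCov (k + s)).trace
      = ((S.Q * S.errorCov).trace + (S.costMatrix m (s + 1) * S.innovCov).trace)
        + ((S.costMatrix m (s + 1) * S.errorCov).trace
          - (S.costMatrix m s * S.errorCov).trace) := by
    intro s hs
    have h1 := congrArg (fun M => (M * S.errorCov).trace)
      (costMatrix_add_estimationPenalty hR hQ hP m (Finset.mem_range.1 hs))
    have h2 := congrArg (fun M => (S.costMatrix m (s + 1) * M).trace) (mul_errorCov_mul_add hS)
    have h3 : (S.Aᵀ * S.costMatrix m (s + 1) * S.A * S.errorCov).trace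
        = (S.costMatrix m (s + 1) * (S.A * S.errorCov * S.Aᵀ)).trace := by
      rw [Matrix.mul_assoc, Matrix.mul_assoc, trace_mul_comm]
      simp [Matrix.mul_assoc]
    simp only [Matrix.add_mul, Matrix.mul_add, trace_add] at h1 h2
    rw [S.postCov_eq hS, ← errorCov]
    linarith
  rw [lookaheadCost, noiseCost, Finset.sum_congr rfl hstep, Finset.sum_add_distrib,
    Finset.sum_range_sub fun s => (S.costMatrix m s * S.errorCov).trace, costMatrix_horizon,
    S.postCov_eq hS, ← errorCov, blockNoiseCost]
  ring

/-- Over a block the value decreases at least by the form `Q` of the initial estimate, compared with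
the cost of the schedule. -/
theorem quad_transition_le (hR : S.R.PosDef) (hQ : S.Q.PosDef) (hP : S.Pper.PosDef) (hh : 0 < S.h)
    (m : S.Schedule) (z : Vec nx) :
    S.Pper.quad ((S.transition m S.h).act z) ≤ (S.costMatrix m 0).quad z - S.Q.quad z := by
  have key : ∀ s, s < S.h → (S.costMatrix m (s + 1)).quad ((S.transition m (s + 1)).act z)
      ≤ (S.costMatrix m 0).quad z - S.Q.quad z := by
    intro s
    induction s with
    | zero =>
      intro hs
      have h1 := quad_costMatrix hR hQ hP m hs z
      have h2 := hR.posSemidef.quad_nonneg ((S.inputGain m 0).act z)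
      simp only [transition, Matrix.mul_one]
      linarith
    | succ s ih =>
      intro hs
      have h1 := quad_costMatrix hR hQ hP m hs ((S.transition m (s + 1)).act z)
      have h2 := hR.posSemidef.quad_nonneg
        ((S.inputGain m (s + 1)).act ((S.transition m (s + 1)).act z))
      have h3 := hQ.posSemidef.quad_nonneg ((S.transition m (s + 1)).act z)
      have h4 := ih (by omega)
      rw [transition, act_mul]
      linarith
  obtain ⟨s, hs⟩ : ∃ s, S.h = s + 1 := ⟨S.h - 1, by omega⟩
  have := key s (by omega)
  rwa [← hs, costMatrix_horizon] at this

theorem posSemidef_transitionCov (hΓ : S.innovCov.PosSemidef) (m : S.Schedule) (s : ℕ) :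
    (S.transitionCov m s).PosSemidef := by
  induction s with
  | zero => exact PosSemidef.zero
  | succ s ih =>
    rw [transitionCov]
    simpa using posSemidef_mul_mul_add ih hΓ (S.stepMatrix m s) 1

theorem posDef_transitionCov (hΓ : S.innovCov.PosDef) (hh : 0 < S.h) (m : S.Schedule) :
    (S.transitionCov m S.h).PosDef := by
  obtain ⟨s, hs⟩ : ∃ s, S.h = s + 1 := ⟨S.h - 1, by omega⟩
  rw [hs, transitionCov]
  refine PosDef.posSemidef_add ?_ hΓ
  simpa using posSemidef_mul_mul_add (posSemidef_transitionCov hΓ.posSemidef m s)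
    (PosSemidef.zero (n := Fin nx) (R := ℝ)) (S.stepMatrix m s) 1

end CodesignProblem

/-! ### Laws of the estimate over one block -/

section Fibers

-- a random schedule takes finitely many values; integrals that involve it are sums over its fibers

theorem iUnion_fiber_eq_univ {Ω ι : Type*} [Fintype ι] (ψ : Ω → ι) :
    (⋃ i ∈ (Finset.univ : Finset ι), {ω | ψ ω = i}) = Set.univ := by
  ext ω
  simp

theorem pairwiseDisjoint_fiber {Ω ι : Type*} (ψ : Ω → ι) (s : Set ι) :
    s.PairwiseDisjoint fun i => {ω | ψ ω = i} :=
  fun _ _ _ _ hij => Set.disjoint_left.2 fun _ hi hj => hij (hi.symm.trans hj)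

variable {Ω : Type*} [MeasurableSpace Ω] {μ : Measure Ω} {ι : Type*} [Fintype ι]
  [MeasurableSpace ι] [MeasurableSingletonClass ι]

theorem integrable_of_fibers {ψ : Ω → ι} (hψ : Measurable ψ) {f : ι → Ω → ℝ}
    (hf : ∀ i, Integrable (f i) μ) : Integrable (fun ω => f (ψ ω) ω) μ := by
  rw [← integrableOn_univ, ← iUnion_fiber_eq_univ ψ, integrableOn_finset_iUnion]
  intro i _
  refine (hf i).integrableOn.congr_fun (fun ω hω => ?_) (hψ (measurableSet_singleton i))
  rw [show ψ ω = i from hω]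

theorem integral_eq_sum_fibers {ψ : Ω → ι} (hψ : Measurable ψ) {f : ι → Ω → ℝ}
    (hf : ∀ i, Integrable (f i) μ) :
    ∫ ω, f (ψ ω) ω ∂μ = ∑ i, ∫ ω in {ω | ψ ω = i}, f i ω ∂μ := by
  have hm : ∀ i ∈ (Finset.univ : Finset ι), MeasurableSet {ω | ψ ω = i} :=
    fun i _ => hψ (measurableSet_singleton i)
  rw [← setIntegral_univ, ← iUnion_fiber_eq_univ ψ,
    integral_biUnion_finset _ hm (pairwiseDisjoint_fiber ψ _)
      fun i _ => (integrable_of_fibers hψ hf).integrableOn]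
  refine Finset.sum_congr rfl fun i _ => ?_
  refine setIntegral_congr_fun (hψ (measurableSet_singleton i)) fun ω hω => ?_
  simp only [show ψ ω = i from hω]

theorem lintegral_eq_sum_fibers {ψ : Ω → ι} (hψ : Measurable ψ) (f : ι → Ω → ℝ≥0∞) :
    ∫⁻ ω, f (ψ ω) ω ∂μ = ∑ i, ∫⁻ ω in {ω | ψ ω = i}, f i ω ∂μ := by
  rw [← setLIntegral_univ, ← iUnion_fiber_eq_univ ψ, lintegral_biUnion_finset
    (pairwiseDisjoint_fiber ψ _) fun i _ => hψ (measurableSet_singleton i)]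
  refine Finset.sum_congr rfl fun i _ => ?_
  refine setLIntegral_congr_fun (hψ (measurableSet_singleton i)) fun ω hω => ?_
  simp only [show ψ ω = i from hω]

end Fibers

section Gaussian

variable {n : ℕ}

theorem multivariateGaussian_zero_zero :
    multivariateGaussian (0 : Vec n) 0 = Measure.dirac 0 := by
  rw [multivariateGaussian]
  simp

/-- The noise of two successive linear steps. -/
theorem lintegral_lintegral_act_add {T V : Matrix (Fin n) (Fin n) ℝ} (hT : T.PosSemidef)
    (hV : V.PosSemidef) (M : Matrix (Fin n) (Fin n) ℝ) {f : Vec n → ℝ≥0∞} (hf : Measurable f)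
    (c : Vec n) :
    ∫⁻ a, ∫⁻ b, f (M.act (c + a) + b) ∂multivariateGaussian 0 V ∂multivariateGaussian 0 T
      = ∫⁻ a, f (M.act c + a) ∂multivariateGaussian 0 (M * T * Mᵀ + V) := by
  have hind : IndepFun (Prod.fst : Vec n × Vec n → Vec n) Prod.snd
      ((multivariateGaussian 0 T).prod (multivariateGaussian 0 V)) := 
    indepFun_prod (X := id) (Y := id) measurable_id measurable_id
  have h := map_act_add_act_eq measurable_fst measurable_snd hT hV
    (by rw [Measure.map_fst_prod]; simp) (by rw [Measure.map_snd_prod]; simp) hind M 1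
  rw [transpose_one, Matrix.one_mul, Matrix.mul_one] at h
  have hm : Measurable fun p : Vec n × Vec n =>
      M.act p.1 + (1 : Matrix (Fin n) (Fin n) ℝ).act p.2 :=
    (M.measurable_act.comp measurable_fst).add
      ((1 : Matrix (Fin n) (Fin n) ℝ).measurable_act.comp measurable_snd)
  have hfc : Measurable fun a => f (M.act c + a) := hf.comp (measurable_const_add _)
  have hfm : Measurable fun p : Vec n × Vec n =>
      f (M.act c + (M.act p.1 + (1 : Matrix (Fin n) (Fin n) ℝ).act p.2)) := hfc.comp hm
  rw [← h, lintegral_map hfc hm, lintegral_prod _ hfm.aemeasurable]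
  simp only [act_add, act_one, add_assoc]

variable {Ω : Type*} {𝓖 mΩ : MeasurableSpace Ω} {μ : Measure Ω} [IsProbabilityMeasure μ]

/-- A random vector independent of `𝓖` is integrated out, on an event of `𝓖`. -/
theorem setLIntegral_add_of_indep {E : Type*} [MeasurableSpace E] (h𝓖 : 𝓖 ≤ mΩ) {z : Ω → E}
    {η : Ω → Vec n} (hη : Measurable η)
    (hind : Indep (MeasurableSpace.comap η inferInstance) 𝓖 μ) (hz : Measurable[𝓖] z) {D : Set Ω}
    (hD : MeasurableSet[𝓖] D) {f : E × Vec n → ℝ≥0∞} (hf : Measurable f) :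
    ∫⁻ ω in D, f (z ω, η ω) ∂μ = ∫⁻ ω in D, ∫⁻ b, f (z ω, b) ∂(μ.map η) ∂μ := by
  have hz' : Measurable z := hz.mono h𝓖 le_rfl
  have hD' : MeasurableSet D := h𝓖 _ hD
  have := Measure.isProbabilityMeasure_map (μ := μ) hη.aemeasurable
  have key : ((μ.restrict D).map z).prod (μ.map η) = (μ.restrict D).map fun ω => (z ω, η ω) := by
    refine Measure.prod_eq fun s t hs ht => ?_
    rw [Measure.map_apply (hz'.prodMk hη) (hs.prod ht), Measure.map_apply hz' hs,
      Measure.map_apply hη ht, Measure.restrict_apply (hz' hs),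
      Measure.restrict_apply ((hz'.prodMk hη) (hs.prod ht))]
    rw [Indep_iff] at hind
    rw [mul_comm, ← hind (η ⁻¹' t) (z ⁻¹' s ∩ D) ⟨t, ht, rfl⟩ (hz hs |>.inter hD)]
    congr 1
    ext ω
    simp only [Set.mem_inter_iff, Set.mem_preimage, Set.mem_prod]
    tauto
  rw [← lintegral_map hf (hz'.prodMk hη), ← key, lintegral_prod _ hf.aemeasurable,
    lintegral_map hf.lintegral_prod_right' hz']

end Gaussian

/-! ### The estimate under a rollout policy -/

namespace CodesignProblem

variable {nx nu ny : ℕ} {S : CodesignProblem nx nu ny} {φ : Vec nx → S.Schedule}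

theorem block_index {h : ℕ} (l : ℕ) {s : ℕ} (hs : s < h) :
    (l * h + s) / h = l ∧ (l * h + s) % h = s :=
  ⟨by rw [mul_comm, Nat.mul_add_div (by omega), Nat.div_eq_of_lt hs, add_zero],
    by rw [mul_comm, Nat.mul_add_mod, Nat.mod_eq_of_lt hs]⟩

theorem measurable_rolloutController (hφ : Measurable φ) (k : ℕ) :
    Measurable (S.rolloutController φ k) := by
  have h : Measurable fun p : S.Schedule × Vec nx =>
      ((if S.entry p.1 (k % S.h) then (S.rolloutGain p.1 (k % S.h)).act p.2 else 0 : Vec nu),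
        S.entry p.1 (k % S.h)) := by
    refine measurable_from_prod_countable_right fun m => ?_
    refine (?_ : Measurable fun y : Vec nx =>
      (if S.entry m (k % S.h) then (S.rolloutGain m (k % S.h)).act y else 0 : Vec nu)).prodMk
        (measurable_const : Measurable fun _ => S.entry m (k % S.h))
    split_ifs
    · exact (S.rolloutGain m (k % S.h)).measurable_act
    · exact measurable_const
  have h' : Measurable fun xs : ℕ → Vec nx => (φ (xs (k / S.h * S.h)), xs k) :=
    (hφ.comp (measurable_pi_apply (k / S.h * S.h))).prodMk (measurable_pi_apply k)
  exact h.comp h'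

theorem rolloutController_fst (φ : Vec nx → S.Schedule) (k : ℕ) (xs : ℕ → Vec nx) :
    (S.rolloutController φ k xs).1
      = (S.inputGain (φ (xs (k / S.h * S.h))) (k % S.h)).act (xs k) := by
  simp only [rolloutController, inputGain]
  split_ifs
  · rfl
  · rw [zero_act]

theorem exists_norm_rolloutController_le (φ : Vec nx → S.Schedule) (k : ℕ) :
    ∃ c : ℝ, ∀ xs, ‖(S.rolloutController φ k xs).1‖ ≤ c * ‖xs k‖ := by
  choose c hc0 hc using fun m => (S.inputGain m (k % S.h)).exists_norm_act_le
  refine ⟨∑ m, c m, fun xs => ?_⟩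
  rw [rolloutController_fst]
  refine (hc _ _).trans ?_
  gcongr
  exact Finset.single_le_sum (fun m _ => hc0 m) (Finset.mem_univ _)

/-- Two processes `x`, `z` adapted to a filtration `I` that behave as the state and its Kalman
estimate under the rollout policy with the selection rule `φ`: the estimation error `x k - z k` is
Gaussian and independent of `I k`, and `z` moves according to the selected schedule, driven by
Gaussian innovations that are independent of `I k`. -/
structure IsRolloutEstimate {Ω : Type*} [mΩ : MeasurableSpace Ω] (μ : Measure Ω)
    (φ : Vec nx → S.Schedule) (I : ℕ → MeasurableSpace Ω) (x z : ℕ → Ω → Vec nx) : Prop where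
  le : ∀ k, I k ≤ mΩ
  mono : Monotone I
  measurable_state : ∀ k, Measurable (x k)
  memLp_state : ∀ k, MemLp (x k) 2 μ
  measurable_est : ∀ k, Measurable[I k] (z k)
  memLp_est : ∀ k, MemLp (z k) 2 μ
  indep_error : ∀ k, Indep (MeasurableSpace.comap (fun ω => x k ω - z k ω) inferInstance) (I k) μ
  law_error : ∀ k, μ.map (fun ω => x k ω - z k ω) = multivariateGaussian 0 S.errorCov
  exists_innovation : ∀ k, ∃ η : Ω → Vec nx, Measurable η ∧
    μ.map η = multivariateGaussian 0 S.innovCov ∧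
    Indep (MeasurableSpace.comap η inferInstance) (I k) μ ∧
    z (k + 1) =ᵐ[μ] fun ω =>
      (S.stepMatrix (φ (z (k / S.h * S.h) ω)) (k % S.h)).act (z k ω) + η ω

section Loop

variable {Ω : Type*} [MeasurableSpace Ω] {μ : Measure Ω} {x₀ : Ω → Vec nx}
  {w : ℕ → Ω → Vec nx} {v : ℕ → Ω → Vec ny} {K : Controller nx nu}

/-- Estimates are not revised later. -/
theorem loop_est_eq {i k : ℕ} (hik : i ≤ k) :
    (S.loop μ x₀ w v K k).est i = (S.loop μ x₀ w v K i).est i := by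
  induction k, hik using Nat.le_induction with
  | base => rfl
  | succ k hik ih =>
    rw [← ih]
    exact Function.update_of_ne (by omega) _ _

theorem input_rolloutController (k : ℕ) (ω : Ω) :
    S.input μ x₀ w v (S.rolloutController φ) k ω
      = (S.inputGain (φ ((S.loop μ x₀ w v (S.rolloutController φ) (k / S.h * S.h)).est
          (k / S.h * S.h) ω)) (k % S.h)).act
        ((S.loop μ x₀ w v (S.rolloutController φ) k).est k ω) := by
  rw [input, rolloutController_fst, loop_est_eq (Nat.div_mul_le_self k S.h)]

theorem trigger_rolloutController (k : ℕ) (ω : Ω) :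
    S.trigger μ x₀ w v (S.rolloutController φ) k ω
      = S.entry (φ ((S.loop μ x₀ w v (S.rolloutController φ) (k / S.h * S.h)).est
          (k / S.h * S.h) ω)) (k % S.h) := by
  rw [trigger, rolloutController, loop_est_eq (Nat.div_mul_le_self k S.h)]

/-- The closed loop under a rollout policy, with a stationary Kalman filter, is of the form
described by `IsRolloutEstimate`. -/
theorem isRolloutEstimate [IsProbabilityMeasure μ] (hN : S.IsGaussianNoise μ x₀ w v)
    (hW : S.covW.PosDef) (hV : S.covV.PosDef) (hX : S.covX.PosSemidef) (hS : S.FilterStationary)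
    (hφ : Measurable φ) :
    IsRolloutEstimate μ φ (fun k => (S.loop μ x₀ w v (S.rolloutController φ) k).info)
      (S.state μ x₀ w v (S.rolloutController φ))
      (fun k => (S.loop μ x₀ w v (S.rolloutController φ) k).est k) := by
  have hKm := measurable_rolloutController (S := S) hφ
  have hKb := exists_norm_rolloutController_le (S := S) φ
  have hinv := loopInvariant hN hW hV hX hKm hKb
  refine ⟨fun k => (hinv k).info_le.trans (hN.past_le k), monotone_nat_of_le_succ fun k => ?_,
    fun k => (hinv k).measurable_state.mono (hN.past_le k) le_rfl, fun k => (hinv k).memLp_state,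
    fun k => (hinv k).measurable_est k, fun k => (hinv k).memLp_est hN,
    fun k => (hinv k).indep_error, fun k => ?_, fun k => ?_⟩
  · exact le_sup_left.trans le_sup_left
  · rw [errorCov, ← S.postCov_eq hS k]
    exact (hinv k).law_error
  · obtain ⟨η, h1, h2, h3, h4⟩ := ((hinv k).succ hN hW hV hX hKm hKb).2
    rw [S.priorCov_eq hS, S.postCov_eq hS] at h2
    refine ⟨η, h1, h2, h3, h4.trans (ae_of_all _ fun ω => ?_)⟩
    simp only [input_rolloutController, stepMatrix_act]

end Loop

namespace IsRolloutEstimate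

variable {Ω : Type*} [mΩ : MeasurableSpace Ω] {μ : Measure Ω}
  {I : ℕ → MeasurableSpace Ω} {x z : ℕ → Ω → Vec nx}

theorem measurable_z (h : IsRolloutEstimate μ φ I x z) (k : ℕ) : Measurable (z k) :=
  (h.measurable_est k).mono (h.le k) le_rfl

theorem measurableSet_fiber (h : IsRolloutEstimate μ φ I x z) (hφ : Measurable φ) (l s : ℕ)
    (m : S.Schedule) : MeasurableSet[I (l * S.h + s)] {ω | φ (z (l * S.h) ω) = m} :=
  h.mono (Nat.le_add_right _ _) _ (hφ.comp (h.measurable_est (l * S.h)) (measurableSet_singleton m))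

/-- On the event that the schedule `m` has been selected, the estimate moves with the closed loop
matrices of `m`. -/
theorem exists_innovation_fiber (h : IsRolloutEstimate μ φ I x z) (l : ℕ) {s : ℕ} (hs : s < S.h)
    (m : S.Schedule) : ∃ η : Ω → Vec nx, Measurable η ∧
      μ.map η = multivariateGaussian 0 S.innovCov ∧
      Indep (MeasurableSpace.comap η inferInstance) (I (l * S.h + s)) μ ∧
      ∀ᵐ ω ∂μ, φ (z (l * S.h) ω) = m → z (l * S.h + s + 1) ω
        = (S.stepMatrix m s).act (z (l * S.h + s) ω) + η ω := by
  obtain ⟨η, h1, h2, h3, h4⟩ := h.exists_innovation (l * S.h + s)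
  refine ⟨η, h1, h2, h3, ?_⟩
  filter_upwards [h4] with ω hω hm
  rw [hω, (block_index l hs).1, (block_index l hs).2, hm]

variable [IsProbabilityMeasure μ]

/-- The law of the estimate within a block, on the event that the schedule `m` has been selected. -/
theorem setLIntegral_est (h : IsRolloutEstimate μ φ I x z) (hφ : Measurable φ)
    (hΓ : S.innovCov.PosSemidef) (l : ℕ) (m : S.Schedule) {s : ℕ} (hs : s ≤ S.h)
    {f : Vec nx → ℝ≥0∞} (hf : Measurable f) :
    ∫⁻ ω in {ω | φ (z (l * S.h) ω) = m}, f (z (l * S.h + s) ω) ∂μ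
      = ∫⁻ ω in {ω | φ (z (l * S.h) ω) = m}, ∫⁻ a, f ((S.transition m s).act (z (l * S.h) ω) + a)
          ∂multivariateGaussian 0 (S.transitionCov m s) ∂μ := by
  induction s generalizing f with
  | zero =>
    simp only [transition, transitionCov, multivariateGaussian_zero_zero, act_one, add_zero]
    refine lintegral_congr fun ω => ?_
    rw [lintegral_dirac, add_zero]
  | succ s ih =>
    obtain ⟨η, h1, h2, h3, h4⟩ := h.exists_innovation_fiber l (by omega : s < S.h) m
    have hD := h.measurableSet_fiber hφ l s m
    have hg : Measurable fun p : Vec nx × Vec nx => f ((S.stepMatrix m s).act p.1 + p.2) :=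
      hf.comp (((S.stepMatrix m s).measurable_act.comp measurable_fst).add measurable_snd)
    have e1 : ∫⁻ ω in {ω | φ (z (l * S.h) ω) = m}, f (z (l * S.h + (s + 1)) ω) ∂μ
        = ∫⁻ ω in {ω | φ (z (l * S.h) ω) = m},
          f ((S.stepMatrix m s).act (z (l * S.h + s) ω) + η ω) ∂μ := by
      refine setLIntegral_congr_fun_ae (h.le _ _ hD) ?_
      filter_upwards [h4] with ω hω hm
      rw [← hω hm, add_assoc]
    rw [e1, setLIntegral_add_of_indep (h.le _) h1 h3 (h.measurable_est _) hD hg, h2,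
      ih (by omega) (f := fun y => ∫⁻ b, f ((S.stepMatrix m s).act y + b)
        ∂multivariateGaussian 0 S.innovCov) hg.lintegral_prod_right']
    refine lintegral_congr fun ω => ?_
    rw [lintegral_lintegral_act_add (posSemidef_transitionCov hΓ m s) hΓ _ hf, transition,
      transitionCov, act_mul]

/-- The control cost of one step, on the event that the schedule `m` has been selected. The
estimation error adds `tr (Q Σ)` to the state cost, the innovation adds `tr (P_{s+1} Γ)` to the
cost-to-go. -/
theorem setIntegral_stage (h : IsRolloutEstimate μ φ I x z) (hφ : Measurable φ)
    (hR : S.R.PosDef) (hQ : S.Q.PosDef) (hP : S.Pper.PosDef)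
    (hE : S.errorCov.PosSemidef) (hΓ : S.innovCov.PosSemidef) (l : ℕ) (m : S.Schedule) {s : ℕ}
    (hs : s < S.h) :
    ∫ ω in {ω | φ (z (l * S.h) ω) = m}, (S.Q.quad (x (l * S.h + s) ω)
        + S.R.quad ((S.inputGain m s).act (z (l * S.h + s) ω))) ∂μ
      + ∫ ω in {ω | φ (z (l * S.h) ω) = m},
          (S.costMatrix m (s + 1)).quad (z (l * S.h + s + 1) ω) ∂μ
    = ∫ ω in {ω | φ (z (l * S.h) ω) = m}, (S.costMatrix m s).quad (z (l * S.h + s) ω) ∂μ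
      + μ.real {ω | φ (z (l * S.h) ω) = m}
        * ((S.Q * S.errorCov).trace + (S.costMatrix m (s + 1) * S.innovCov).trace) := by
  obtain ⟨η, h1, h2, h3, h4⟩ := h.exists_innovation_fiber l hs m
  have hD := h.measurableSet_fiber hφ l s m
  have hPs := (posDef_costMatrix hR hQ hP m (s + 1)).posSemidef
  have hz := h.memLp_est (l * S.h + s)
  have e1 : ∫ ω in {ω | φ (z (l * S.h) ω) = m},
        (S.costMatrix m (s + 1)).quad (z (l * S.h + s + 1) ω) ∂μ
      = ∫ ω in {ω | φ (z (l * S.h) ω) = m},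
        (S.costMatrix m (s + 1)).quad ((S.stepMatrix m s).act (z (l * S.h + s) ω) + η ω) ∂μ := by
    refine setIntegral_congr_ae (h.le _ _ hD) ?_
    filter_upwards [h4] with ω hω hm
    rw [hω hm]
  have e2 := setIntegral_quad_add (h.le _)
    ((h.measurable_state (l * S.h + s)).sub (h.measurable_z (l * S.h + s))) hE
    (h.law_error (l * S.h + s)) (h.indep_error (l * S.h + s)) hQ.posSemidef.transpose_eq
    (h.measurable_est (l * S.h + s)) hz hD
  simp only [Pi.sub_apply, add_sub_cancel] at e2
  rw [e1, setIntegral_quad_add (h.le _) h1 hΓ h2 h3 hPs.transpose_eq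
    (z := fun ω => (S.stepMatrix m s).act (z (l * S.h + s) ω))
    ((S.stepMatrix m s).measurable_act.comp (h.measurable_est _)) (hz.act _) hD,
    integral_add ((h.memLp_state _).integrable_quad _).integrableOn
      ((hz.act _).integrable_quad _).integrableOn, e2]
  have e3 : ∫ ω in {ω | φ (z (l * S.h) ω) = m}, (S.costMatrix m s).quad (z (l * S.h + s) ω) ∂μ
      = ∫ ω in {ω | φ (z (l * S.h) ω) = m}, S.Q.quad (z (l * S.h + s) ω) ∂μ
        + ∫ ω in {ω | φ (z (l * S.h) ω) = m},
            S.R.quad ((S.inputGain m s).act (z (l * S.h + s) ω)) ∂μ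
        + ∫ ω in {ω | φ (z (l * S.h) ω) = m},
            (S.costMatrix m (s + 1)).quad ((S.stepMatrix m s).act (z (l * S.h + s) ω)) ∂μ := by
    have hi : Integrable (fun ω => S.Q.quad (z (l * S.h + s) ω)
        + S.R.quad ((S.inputGain m s).act (z (l * S.h + s) ω))) μ :=
      (hz.integrable_quad _).add ((hz.act _).integrable_quad _)
    rw [← integral_add (hz.integrable_quad _).integrableOn
        ((hz.act _).integrable_quad _).integrableOn,
      ← integral_add hi.integrableOn ((hz.act _).integrable_quad _).integrableOn]
    refine integral_congr_ae (ae_of_all _ fun ω => ?_)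
    exact quad_costMatrix hR hQ hP m hs _
  rw [e3]
  ring

end IsRolloutEstimate

end CodesignProblem

/-! ### The cost of a block -/

namespace CodesignProblem

variable {nx nu ny : ℕ} {S : CodesignProblem nx nu ny} {φ : Vec nx → S.Schedule}

/-- The expected control cost at time `k`. -/
noncomputable def stageCost {Ω : Type*} [MeasurableSpace Ω] (μ : Measure Ω)
    (φ : Vec nx → S.Schedule) (x z : ℕ → Ω → Vec nx) (k : ℕ) : ℝ :=
  ∫ ω, (S.Q.quad (x k ω)
    + S.R.quad ((S.inputGain (φ (z (k / S.h * S.h) ω)) (k % S.h)).act (z k ω))) ∂μ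

/-- The probability of an actuation at time `k`. -/
noncomputable def actuationProb {Ω : Type*} [MeasurableSpace Ω] (μ : Measure Ω)
    (φ : Vec nx → S.Schedule) (z : ℕ → Ω → Vec nx) (k : ℕ) : ℝ :=
  ∫ ω, (if S.entry (φ (z (k / S.h * S.h) ω)) (k % S.h) then 1 else 0) ∂μ

variable (S) in
/-- The number of actuations in a schedule. -/
noncomputable def actuationCount (m : S.Schedule) : ℝ :=
  ∑ s ∈ Finset.range S.h, (if S.entry m s then 1 else 0)

variable (S) in
/-- The lookahead cost for a stationary filter, up to a term that is the same for all schedules. -/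
noncomputable def blockCost (m : S.Schedule) (y : Vec nx) : ℝ :=
  (S.costMatrix m 0).quad y + S.blockNoiseCost m + S.θ * S.actuationCount m

namespace IsRolloutEstimate

variable {Ω : Type*} [mΩ : MeasurableSpace Ω] {μ : Measure Ω}
  {I : ℕ → MeasurableSpace Ω} {x z : ℕ → Ω → Vec nx}

theorem stageCost_eq (h : IsRolloutEstimate μ φ I x z) (hφ : Measurable φ) (l : ℕ) {s : ℕ}
    (hs : s < S.h) :
    stageCost μ φ x z (l * S.h + s) = ∑ m, ∫ ω in {ω | φ (z (l * S.h) ω) = m},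
      (S.Q.quad (x (l * S.h + s) ω)
        + S.R.quad ((S.inputGain m s).act (z (l * S.h + s) ω))) ∂μ := by
  rw [stageCost]
  simp only [(block_index l hs).1, (block_index l hs).2]
  exact integral_eq_sum_fibers (ψ := fun ω => φ (z (l * S.h) ω)) (hφ.comp (h.measurable_z _))
    (f := fun m ω => S.Q.quad (x (l * S.h + s) ω)
        + S.R.quad ((S.inputGain m s).act (z (l * S.h + s) ω)))
    fun _ => ((h.memLp_state _).integrable_quad _).add (((h.memLp_est _).act _).integrable_quad _)

theorem integrable_stage (h : IsRolloutEstimate μ φ I x z) (hφ : Measurable φ) (k : ℕ) :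
    Integrable (fun ω => S.Q.quad (x k ω)
      + S.R.quad ((S.inputGain (φ (z (k / S.h * S.h) ω)) (k % S.h)).act (z k ω))) μ :=
  integrable_of_fibers (ψ := fun ω => φ (z (k / S.h * S.h) ω)) (hφ.comp (h.measurable_z _))
    (f := fun m ω => S.Q.quad (x k ω) + S.R.quad ((S.inputGain m (k % S.h)).act (z k ω)))
    fun _ => ((h.memLp_state _).integrable_quad _).add (((h.memLp_est _).act _).integrable_quad _)

variable [IsProbabilityMeasure μ]

theorem integrable_actuation (h : IsRolloutEstimate μ φ I x z) (hφ : Measurable φ) (k : ℕ) :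
    Integrable (fun ω =>
      (if S.entry (φ (z (k / S.h * S.h) ω)) (k % S.h) then 1 else 0 : ℝ)) μ :=
  integrable_of_fibers (ψ := fun ω => φ (z (k / S.h * S.h) ω)) (hφ.comp (h.measurable_z _))
    (f := fun m _ => if S.entry m (k % S.h) then 1 else 0) fun _ => integrable_const _

theorem sum_actuationProb (h : IsRolloutEstimate μ φ I x z) (hφ : Measurable φ) (l : ℕ) :
    ∑ s ∈ Finset.range S.h, actuationProb μ φ z (l * S.h + s)
      = ∫ ω, S.actuationCount (φ (z (l * S.h) ω)) ∂μ := by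
  simp only [actuationCount, actuationProb]
  rw [integral_finsetSum]
  · refine Finset.sum_congr rfl fun s hs => ?_
    simp only [(block_index l (Finset.mem_range.1 hs)).1,
      (block_index l (Finset.mem_range.1 hs)).2]
  · intro s _
    exact integrable_of_fibers (ψ := fun ω => φ (z (l * S.h) ω)) (hφ.comp (h.measurable_z _))
      (f := fun m _ => if S.entry m s then 1 else 0) fun _ => integrable_const _

theorem integrable_blockCost (h : IsRolloutEstimate μ φ I x z) (hφ : Measurable φ) (k : ℕ) :
    Integrable (fun ω => S.blockCost (φ (z k ω)) (z k ω)) μ :=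
  integrable_of_fibers (ψ := fun ω => φ (z k ω)) (hφ.comp (h.measurable_z _))
    (f := fun m ω => S.blockCost m (z k ω)) fun _ =>
      (((h.memLp_est k).integrable_quad _).add (integrable_const _)).add (integrable_const _)

/-- The expected cost of a block, plus the expected value of the estimate at its end, is the expected
lookahead cost without its constant term. -/
theorem sum_stageCost_add (h : IsRolloutEstimate μ φ I x z) (hφ : Measurable φ)
    (hR : S.R.PosDef) (hQ : S.Q.PosDef) (hP : S.Pper.PosDef)
    (hE : S.errorCov.PosSemidef) (hΓ : S.innovCov.PosSemidef) (l : ℕ) :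
    ∑ s ∈ Finset.range S.h, stageCost μ φ x z (l * S.h + s)
      + ∫ ω, S.Pper.quad (z ((l + 1) * S.h) ω) ∂μ
      + S.θ * ∑ s ∈ Finset.range S.h, actuationProb μ φ z (l * S.h + s)
    = ∫ ω, S.blockCost (φ (z (l * S.h) ω)) (z (l * S.h) ω) ∂μ := by
  have hψ : Measurable fun ω => φ (z (l * S.h) ω) := hφ.comp (h.measurable_z _)
  have hfib : ∀ m, ∑ s ∈ Finset.range S.h, ∫ ω in {ω | φ (z (l * S.h) ω) = m},
      (S.Q.quad (x (l * S.h + s) ω) + S.R.quad ((S.inputGain m s).act (z (l * S.h + s) ω))) ∂μ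
      + ∫ ω in {ω | φ (z (l * S.h) ω) = m}, S.Pper.quad (z ((l + 1) * S.h) ω) ∂μ
      = ∫ ω in {ω | φ (z (l * S.h) ω) = m},
        ((S.costMatrix m 0).quad (z (l * S.h) ω) + S.blockNoiseCost m) ∂μ := by
    intro m
    have hstep : ∀ s ∈ Finset.range S.h, ∫ ω in {ω | φ (z (l * S.h) ω) = m},
        (S.Q.quad (x (l * S.h + s) ω)
          + S.R.quad ((S.inputGain m s).act (z (l * S.h + s) ω))) ∂μ
        = μ.real {ω | φ (z (l * S.h) ω) = m}
          * ((S.Q * S.errorCov).trace + (S.costMatrix m (s + 1) * S.innovCov).trace)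
        - (∫ ω in {ω | φ (z (l * S.h) ω) = m},
            (S.costMatrix m (s + 1)).quad (z (l * S.h + (s + 1)) ω) ∂μ
          - ∫ ω in {ω | φ (z (l * S.h) ω) = m},
            (S.costMatrix m s).quad (z (l * S.h + s) ω) ∂μ) := by
      intro s hs
      have := h.setIntegral_stage hφ hR hQ hP hE hΓ l m (Finset.mem_range.1 hs)
      rw [add_assoc (l * S.h) s 1] at this
      linarith
    rw [Finset.sum_congr rfl hstep, Finset.sum_sub_distrib, Finset.sum_range_sub fun s =>
      ∫ ω in {ω | φ (z (l * S.h) ω) = m}, (S.costMatrix m s).quad (z (l * S.h + s) ω) ∂μ,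
      ← Finset.mul_sum, costMatrix_horizon, integral_add
        ((h.memLp_est _).integrable_quad _).integrableOn (integrable_const _), setIntegral_const,
      blockNoiseCost, Nat.add_mul, one_mul, add_zero, smul_eq_mul]
    ring
  rw [h.sum_actuationProb hφ, Finset.sum_congr rfl fun s hs =>
    h.stageCost_eq hφ l (Finset.mem_range.1 hs), Finset.sum_comm,
    integral_eq_sum_fibers hψ (f := fun _ ω => S.Pper.quad (z ((l + 1) * S.h) ω))
      fun _ => (h.memLp_est _).integrable_quad _, ← Finset.sum_add_distrib,
    Finset.sum_congr rfl fun m _ => hfib m,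
    ← integral_eq_sum_fibers hψ (f := fun m ω => (S.costMatrix m 0).quad (z (l * S.h) ω)
      + S.blockNoiseCost m)
      fun _ => ((h.memLp_est _).integrable_quad _).add (integrable_const _),
    ← integral_const_mul, ← integral_add]
  · rfl
  · exact integrable_of_fibers hψ (f := fun m ω => (S.costMatrix m 0).quad (z (l * S.h) ω)
      + S.blockNoiseCost m)
      fun _ => ((h.memLp_est _).integrable_quad _).add (integrable_const _)
  · exact integrable_of_fibers hψ (f := fun m _ => S.θ * S.actuationCount m)
      fun _ => integrable_const _

end IsRolloutEstimate

end CodesignProblem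

/-! ### The Markov chain of the estimates at the block times -/

namespace CodesignProblem

variable {nx nu ny : ℕ} {S : CodesignProblem nx nu ny} {φ : Vec nx → S.Schedule}

variable (S) in
/-- The law of the estimate at the end of a block with schedule `m` that starts at the estimate `y`.
-/
noncomputable def scheduleLaw (m : S.Schedule) (y : Vec nx) : Measure (Vec nx) :=
  (multivariateGaussian 0 (S.transitionCov m S.h)).map fun a => (S.transition m S.h).act y + a

theorem lintegral_scheduleLaw (m : S.Schedule) (y : Vec nx) {f : Vec nx → ℝ≥0∞}
    (hf : Measurable f) : ∫⁻ a, f a ∂S.scheduleLaw m y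
      = ∫⁻ a, f ((S.transition m S.h).act y + a)
        ∂multivariateGaussian 0 (S.transitionCov m S.h) := by
  rw [scheduleLaw, lintegral_map hf (measurable_const_add _)]

theorem measurable_scheduleLaw (m : S.Schedule) : Measurable (S.scheduleLaw m) := by
  refine Measure.measurable_of_measurable_coe _ fun t ht => ?_
  have hf : Measurable (t.indicator (1 : Vec nx → ℝ≥0∞)) := measurable_one.indicator ht
  simp only [← lintegral_indicator_one ht, lintegral_scheduleLaw m _ hf]
  have hm : Measurable fun p : Vec nx × Vec nx =>
      t.indicator (1 : Vec nx → ℝ≥0∞) ((S.transition m S.h).act p.1 + p.2) :=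
    hf.comp (((S.transition m S.h).measurable_act.comp measurable_fst).add measurable_snd)
  exact hm.lintegral_prod_right' (ν := multivariateGaussian 0 (S.transitionCov m S.h))

theorem measurable_scheduleLaw_comp (hφ : Measurable φ) :
    Measurable fun y => S.scheduleLaw (φ y) y := by
  have h : Measurable (Function.uncurry S.scheduleLaw) :=
    measurable_from_prod_countable_right measurable_scheduleLaw
  have h' : Measurable fun y : Vec nx => (φ y, y) := hφ.prodMk measurable_id
  have e : (fun y => S.scheduleLaw (φ y) y)
      = fun y => Function.uncurry S.scheduleLaw (φ y, y) := rfl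
  rw [e]
  exact h.comp h'

/-- The transition kernel of the estimate from one selection of a schedule to the next. -/
noncomputable def blockKernel (hφ : Measurable φ) : Kernel (Vec nx) (Vec nx) where
  toFun y := S.scheduleLaw (φ y) y
  measurable' := measurable_scheduleLaw_comp hφ

theorem blockKernel_apply (hφ : Measurable φ) (y : Vec nx) :
    blockKernel hφ y = S.scheduleLaw (φ y) y := rfl

instance (m : S.Schedule) (y : Vec nx) : IsProbabilityMeasure (S.scheduleLaw m y) :=
  Measure.isProbabilityMeasure_map (measurable_const_add _).aemeasurable

instance (hφ : Measurable φ) : IsMarkovKernel (blockKernel hφ) :=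
  ⟨fun y => by
    rw [blockKernel_apply]
    infer_instance⟩

theorem memLp_const_add_multivariateGaussian {n : ℕ} (c a : Vec n)
    (T : Matrix (Fin n) (Fin n) ℝ) :
    MemLp (fun x => c + x) 2 (multivariateGaussian a T) :=
  (memLp_const c).add (memLp_two_of_map_eq (w := fun x => x) measurable_id Measure.map_id)

theorem integrable_quad_scheduleLaw (P : Matrix (Fin nx) (Fin nx) ℝ) (m : S.Schedule)
    (y : Vec nx) : Integrable P.quad (S.scheduleLaw m y) := by
  have h := (memLp_const_add_multivariateGaussian ((S.transition m S.h).act y) 0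
    (S.transitionCov m S.h)).integrable_quad P
  rw [scheduleLaw, integrable_map_measure P.continuous_quad.aestronglyMeasurable
    (measurable_const_add _).aemeasurable]
  exact h

/-- The expectation of a quadratic form of the estimate at the end of a block. -/
theorem integral_quad_scheduleLaw (hΓ : S.innovCov.PosSemidef)
    {P : Matrix (Fin nx) (Fin nx) ℝ} (hP : Pᵀ = P) (m : S.Schedule) (y : Vec nx) :
    ∫ a, P.quad a ∂S.scheduleLaw m y = P.quad ((S.transition m S.h).act y)
      + (P * S.transitionCov m S.h).trace := by
  have h := setIntegral_quad_add (μ := multivariateGaussian 0 (S.transitionCov m S.h)) (𝓖 := ⊥)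
    bot_le (w := fun a => a) measurable_id (posSemidef_transitionCov hΓ m S.h) Measure.map_id
    (indep_bot_right _) hP (z := fun _ => (S.transition m S.h).act y) measurable_const
    (memLp_const _) (D := Set.univ) MeasurableSet.univ
  rw [setIntegral_univ, setIntegral_univ, integral_const, probReal_univ, one_smul, one_mul] at h
  rw [← h, scheduleLaw, integral_map (measurable_const_add _).aemeasurable
    P.continuous_quad.aestronglyMeasurable]

/-- Since `Q` is positive definite, subtracting it decreases the value by a fixed proportion. -/
theorem exists_quad_sub_quad_le (hQ : S.Q.PosDef) :
    ∃ γ : ℝ, 0 < γ ∧ γ < 1 ∧ ∀ y, S.Pper.quad y - S.Q.quad y ≤ γ * S.Pper.quad y := by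
  obtain ⟨c, hc, hcQ⟩ := hQ.exists_mul_norm_sq_le
  obtain ⟨d, hd, hdP⟩ := S.Pper.exists_abs_quad_le
  have hpos : 0 < c + d + 1 := by linarith
  refine ⟨1 - c / (c + d + 1), ?_, ?_, fun y => ?_⟩
  · rw [sub_pos, div_lt_one hpos]
    linarith
  · linarith [div_pos hc hpos]
  · have h1 := hcQ y
    have h2 := (le_abs_self _).trans (hdP y)
    have h3 : c / (c + d + 1) * S.Pper.quad y ≤ c * ‖y‖ ^ 2 := by
      rw [div_mul_eq_mul_div, div_le_iff₀ hpos, mul_assoc]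
      gcongr
      nlinarith [sq_nonneg ‖y‖]
    linarith

/-- The block kernel contracts the quadratic form of the periodic policy, up to a constant. -/
theorem exists_integral_quad_blockKernel_le (hφ : Measurable φ) (hR : S.R.PosDef) (hQ : S.Q.PosDef)
    (hP : S.Pper.PosDef) (hΓ : S.innovCov.PosSemidef) (hh : 0 < S.h) {C : ℝ}
    (hC : ∀ y, S.blockCost (φ y) y ≤ S.Pper.quad y + C) :
    ∃ γ K : ℝ, 0 < γ ∧ γ < 1 ∧ 0 ≤ K ∧
      ∀ y, ∫ a, S.Pper.quad a ∂blockKernel hφ y ≤ γ * S.Pper.quad y + K := by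
  obtain ⟨γ, hγ0, hγ1, hγ⟩ := exists_quad_sub_quad_le hQ
  let d : S.Schedule → ℝ := fun m => C - S.blockNoiseCost m - S.θ * S.actuationCount m
    + (S.Pper * S.transitionCov m S.h).trace
  refine ⟨γ, ∑ m, |d m|, hγ0, hγ1, Finset.sum_nonneg fun m _ => abs_nonneg _, fun y => ?_⟩
  rw [blockKernel_apply, integral_quad_scheduleLaw hΓ hP.posSemidef.transpose_eq]
  have h1 := quad_transition_le hR hQ hP hh (φ y) y
  have h2 := hC y
  have h3 : d (φ y) ≤ ∑ m, |d m| := (le_abs_self _).trans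
    (Finset.single_le_sum (f := fun m => |d m|) (fun m _ => abs_nonneg _) (Finset.mem_univ _))
  have h4 := hγ y
  simp only [blockCost] at h2
  simp only [d] at h3
  linarith

/-- The sublevel sets of the quadratic form are small sets of the block kernel. -/
theorem exists_le_blockKernel (hφ : Measurable φ) (hP : S.Pper.PosDef) (hΓ : S.innovCov.PosDef)
    (hh : 0 < S.h) (r : ℝ) :
    ∃ ρ : Measure (Vec nx), IsFiniteMeasure ρ ∧ ρ ≠ 0 ∧
      ∀ y, S.Pper.quad y ≤ r → ρ ≤ blockKernel hφ y := by
  obtain ⟨c, hc, hcP⟩ := hP.exists_mul_norm_sq_le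
  choose b hb0 hb using fun m => (S.transition m S.h).exists_norm_act_le
  choose ε hε0 hε using fun m => exists_smul_volume_restrict_le_map_add
    (posDef_transitionCov hΓ hh m) ((∑ m', b m') * √(r / c))
  -- the minimum over the finitely many schedules; the bound by `1` makes the measure finite
  refine ⟨(min 1 (⨅ m, ε m)) • volume.restrict (Metric.ball 0 1), ?_, ?_, fun y hy => ?_⟩
  · refine ⟨?_⟩
    rw [Measure.smul_apply, smul_eq_mul, Measure.restrict_apply_univ]
    exact ENNReal.mul_lt_top ((min_le_left _ _).trans_lt ENNReal.one_lt_top)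
      Metric.isBounded_ball.measure_lt_top
  · have hinf : (⨅ m, ε m) ≠ 0 := by
      obtain ⟨m, hm⟩ := exists_eq_ciInf_of_finite (f := ε)
      rw [← hm]
      exact hε0 m
    intro h0
    have h1 := congrArg (fun ρ : Measure (Vec nx) => ρ Set.univ) h0
    simp only [Measure.smul_apply, smul_eq_mul, Measure.restrict_apply_univ, Measure.coe_zero,
      Pi.zero_apply, mul_eq_zero] at h1
    rcases h1 with h1 | h1
    · rcases min_choice 1 (⨅ m, ε m) with h2 | h2
      · exact one_ne_zero (h2.symm.trans h1)
      · exact hinf (h2.symm.trans h1)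
    · exact (Metric.measure_ball_pos volume (0 : Vec nx) one_pos).ne' h1
  · have hnorm : ‖y‖ ≤ √(r / c) := by
      refine Real.le_sqrt_of_sq_le ?_
      rw [le_div_iff₀ hc, mul_comm]
      exact (hcP y).trans hy
    have hΨ : ‖(S.transition (φ y) S.h).act y‖ ≤ (∑ m', b m') * √(r / c) := by
      refine (hb _ y).trans ?_
      gcongr
      · exact Finset.sum_nonneg fun m _ => hb0 m
      · exact Finset.single_le_sum (fun m _ => hb0 m) (Finset.mem_univ _)
    refine le_trans ?_ (hε (φ y) _ hΨ)
    refine Measure.le_iff.2 fun t ht => ?_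
    rw [Measure.smul_apply, Measure.smul_apply]
    exact mul_le_mul_left ((min_le_right _ _).trans (iInf_le _ _)) _

namespace IsRolloutEstimate

variable {Ω : Type*} [mΩ : MeasurableSpace Ω] {μ : Measure Ω} [IsProbabilityMeasure μ]
  {I : ℕ → MeasurableSpace Ω} {x z : ℕ → Ω → Vec nx}

/-- The estimates at the block times form a Markov chain, and its law is propagated by the block
kernel. -/
theorem map_block_succ (h : IsRolloutEstimate μ φ I x z) (hφ : Measurable φ)
    (hΓ : S.innovCov.PosSemidef) (l : ℕ) :
    μ.map (z ((l + 1) * S.h)) = (μ.map (z (l * S.h))).bind (blockKernel hφ) := by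
  ext t ht
  have hf : Measurable (t.indicator (1 : Vec nx → ℝ≥0∞)) := measurable_one.indicator ht
  rw [Measure.bind_apply ht (blockKernel hφ).aemeasurable,
    lintegral_map ((blockKernel hφ).measurable_coe ht) (h.measurable_z _),
    ← lintegral_indicator_one ht, lintegral_map hf (h.measurable_z _),
    lintegral_eq_sum_fibers (ψ := fun ω => φ (z (l * S.h) ω)) (hφ.comp (h.measurable_z _))
      (fun _ ω => t.indicator (1 : Vec nx → ℝ≥0∞) (z ((l + 1) * S.h) ω))]
  have e : ∀ ω, blockKernel hφ (z (l * S.h) ω) t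
      = ∫⁻ a, t.indicator (1 : Vec nx → ℝ≥0∞)
        ((S.transition (φ (z (l * S.h) ω)) S.h).act (z (l * S.h) ω) + a)
        ∂multivariateGaussian 0 (S.transitionCov (φ (z (l * S.h) ω)) S.h) := fun ω => by
    rw [← lintegral_indicator_one ht, blockKernel_apply, lintegral_scheduleLaw _ _ hf]
  simp only [e]
  rw [lintegral_eq_sum_fibers (ψ := fun ω => φ (z (l * S.h) ω)) (hφ.comp (h.measurable_z _))
    (fun m ω => ∫⁻ a, t.indicator (1 : Vec nx → ℝ≥0∞)
        ((S.transition m S.h).act (z (l * S.h) ω) + a)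
        ∂multivariateGaussian 0 (S.transitionCov m S.h))]
  refine Finset.sum_congr rfl fun m _ => ?_
  rw [Nat.add_mul, one_mul]
  exact h.setLIntegral_est hφ hΓ l m le_rfl hf

/-- The expected number of actuations in a block converges, by Harris' theorem. -/
theorem exists_tendsto_sum_actuationProb (h : IsRolloutEstimate μ φ I x z) (hφ : Measurable φ)
    (hR : S.R.PosDef) (hQ : S.Q.PosDef) (hP : S.Pper.PosDef) (hΓ : S.innovCov.PosDef)
    (hh : 0 < S.h) {C : ℝ} (hC : ∀ y, S.blockCost (φ y) y ≤ S.Pper.quad y + C) :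
    ∃ b, Tendsto (fun l => ∑ s ∈ Finset.range S.h, actuationProb μ φ z (l * S.h + s)) atTop
      (nhds b) := by
  obtain ⟨γ, K, hγ0, hγ1, hK, hdrift⟩ :=
    exists_integral_quad_blockKernel_le hφ hR hQ hP hΓ.posSemidef hh hC
  have : ∀ l, IsProbabilityMeasure (μ.map (z (l * S.h))) := fun l =>
    Measure.isProbabilityMeasure_map (h.measurable_z _).aemeasurable
  have hg : Measurable fun y => S.actuationCount (φ y) :=
    (measurable_of_finite S.actuationCount).comp hφ
  obtain ⟨b, hb⟩ := exists_tendsto_integral (blockKernel hφ) (V := S.Pper.quad)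
    hP.posSemidef.quad_nonneg hγ0 hγ1 hK (fun y => integrable_quad_scheduleLaw S.Pper (φ y) y)
    hdrift
    (exists_le_blockKernel hφ hP hΓ hh) (fun l => μ.map (z (l * S.h)))
    (h.map_block_succ hφ hΓ.posSemidef)
    ((integrable_map_measure S.Pper.continuous_quad.aestronglyMeasurable
      (h.measurable_z _).aemeasurable).2 ((h.memLp_est _).integrable_quad _))
    (g := fun y => S.actuationCount (φ y)) hg (M := ∑ m, |S.actuationCount m|) fun y =>
      Finset.single_le_sum (f := fun m => |S.actuationCount m|) (fun m _ => abs_nonneg _)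
        (Finset.mem_univ _)
  refine ⟨b, hb.congr fun l => ?_⟩
  rw [integral_map (h.measurable_z _).aemeasurable hg.aestronglyMeasurable,
    h.sum_actuationProb hφ]

end IsRolloutEstimate

end CodesignProblem

/-! ### Averages over blocks -/

section Averages

theorem sum_range_mul_add (f : ℕ → ℝ) (h L : ℕ) :
    ∑ k ∈ Finset.range (L * h), f k
      = ∑ l ∈ Finset.range L, ∑ s ∈ Finset.range h, f (l * h + s) := by
  induction L with
  | zero => simp
  | succ L ih => rw [Nat.succ_mul, Finset.sum_range_add, ih, Finset.sum_range_succ]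

theorem tendsto_div_div {h : ℕ} (hh : 0 < h) (r : ℕ) :
    Tendsto (fun N : ℕ => ((N / h + r : ℕ) : ℝ) / N) atTop (nhds (1 / h)) := by
  have h0 : (0 : ℝ) < h := by exact_mod_cast hh
  have hr : Tendsto (fun N : ℕ => ((r : ℝ) + 1) / N) atTop (nhds 0) :=
    tendsto_const_div_atTop_nhds_zero_nat _
  have hlow : Tendsto (fun N : ℕ => 1 / (h : ℝ) - (r + 1) / N) atTop (nhds (1 / h)) := by
    simpa using tendsto_const_nhds.sub hr
  have hup : Tendsto (fun N : ℕ => 1 / (h : ℝ) + (r + 1) / N) atTop (nhds (1 / h)) := by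
    simpa using tendsto_const_nhds.add hr
  refine tendsto_of_tendsto_of_tendsto_of_le_of_le' hlow hup ?_ ?_
  · filter_upwards [eventually_gt_atTop 0] with N hN
    have hN' : (0 : ℝ) < N := by exact_mod_cast hN
    have h1 : (N : ℝ) ≤ h * (N / h : ℕ) + h := by
      exact_mod_cast (Nat.lt_mul_div_succ N hh).le
    have h2 : (N : ℝ) / h ≤ (N / h : ℕ) + 1 := by
      rw [div_le_iff₀ h0]; linarith
    have h3 : 1 / (h : ℝ) * N = N / h := by ring
    have h4 : (0 : ℝ) ≤ r := Nat.cast_nonneg r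
    rw [Nat.cast_add, le_div_iff₀ hN', sub_mul, div_mul_cancel₀ _ hN'.ne', h3]
    linarith
  · filter_upwards [eventually_gt_atTop 0] with N hN
    have hN' : (0 : ℝ) < N := by exact_mod_cast hN
    have h1 : ((N / h : ℕ) : ℝ) ≤ N / h := Nat.cast_div_le
    rw [Nat.cast_add, div_le_iff₀ hN', add_mul, div_mul_cancel₀ _ hN'.ne']
    have : 1 / (h : ℝ) * N = N / h := by ring
    rw [this]
    linarith

/-- Averages, over whole blocks, of a sequence whose block sums converge. -/
theorem tendsto_average_of_tendsto_block {d : ℕ → ℝ} {h : ℕ} (hh : 0 < h)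
    {b : ℝ} (hb : Tendsto (fun l => ∑ s ∈ Finset.range h, d (l * h + s)) atTop (nhds b)) (r : ℕ) :
    Tendsto (fun N : ℕ => (∑ k ∈ Finset.range ((N / h + r) * h), d k) / N) atTop
      (nhds (b / h)) := by
  have hq : Tendsto (fun N : ℕ => N / h + r) atTop atTop :=
    tendsto_atTop_mono (fun N => Nat.le_add_right _ _) (Nat.tendsto_div_const_atTop hh.ne')
  have h1 := (hb.cesaro.comp hq).mul (tendsto_div_div hh r)
  rw [mul_one_div] at h1
  refine h1.congr' ?_
  filter_upwards [hq.eventually_gt_atTop 0] with N hN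
  have hN' : ((N / h + r : ℕ) : ℝ) ≠ 0 := by exact_mod_cast hN.ne'
  simp only [Function.comp_apply, sum_range_mul_add]
  field_simp

theorem sum_range_le_of_le {f : ℕ → ℝ} (hf : ∀ k, 0 ≤ f k) {M N : ℕ} (hMN : M ≤ N) :
    ∑ k ∈ Finset.range M, f k ≤ ∑ k ∈ Finset.range N, f k :=
  Finset.sum_le_sum_of_subset_of_nonneg (Finset.range_mono hMN) fun _ _ _ => hf _

theorem le_div_add_one_mul {h : ℕ} (hh : 0 < h) (N : ℕ) : N ≤ (N / h + 1) * h := by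
  rw [mul_comm]
  exact (Nat.lt_mul_div_succ N hh).le

/-- Averages of a nonnegative sequence whose block sums converge. -/
theorem tendsto_average_of_tendsto_block_sum {d : ℕ → ℝ} (hd : ∀ k, 0 ≤ d k) {h : ℕ} (hh : 0 < h)
    {b : ℝ} (hb : Tendsto (fun l => ∑ s ∈ Finset.range h, d (l * h + s)) atTop (nhds b)) :
    Tendsto (fun N : ℕ => (∑ k ∈ Finset.range N, d k) / N) atTop (nhds (b / h)) := by
  refine tendsto_of_tendsto_of_tendsto_of_le_of_le (tendsto_average_of_tendsto_block hh hb 0)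
    (tendsto_average_of_tendsto_block hh hb 1) (fun N => ?_) (fun N => ?_)
  · exact div_le_div_of_nonneg_right
      (sum_range_le_of_le hd (show (N / h + 0) * h ≤ N from Nat.div_mul_le_self N h))
      (Nat.cast_nonneg N)
  · exact div_le_div_of_nonneg_right (sum_range_le_of_le hd (le_div_add_one_mul hh N))
      (Nat.cast_nonneg N)

variable {c d V : ℕ → ℝ} {h : ℕ} {θ C : ℝ}

/-- The stage costs `c`, the actuations `d` and the values `V` at the block times telescope. -/
theorem sum_block_add_le (hstep : ∀ l, ∑ s ∈ Finset.range h, c (l * h + s) + V (l + 1)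
      + θ * ∑ s ∈ Finset.range h, d (l * h + s) ≤ V l + C) (L : ℕ) :
    ∑ k ∈ Finset.range (L * h), c k + V L + θ * ∑ k ∈ Finset.range (L * h), d k
      ≤ V 0 + L * C := by
  induction L with
  | zero => simp
  | succ L ih =>
    have := hstep L
    rw [Nat.succ_mul, Finset.sum_range_add, Finset.sum_range_add]
    push_cast
    linarith

theorem le_sum_block_add (hstep : ∀ l, V l + C ≤ ∑ s ∈ Finset.range h, c (l * h + s) + V (l + 1)
      + θ * ∑ s ∈ Finset.range h, d (l * h + s)) (L : ℕ) :
    V 0 + L * C ≤ ∑ k ∈ Finset.range (L * h), c k + V L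
      + θ * ∑ k ∈ Finset.range (L * h), d k := by
  induction L with
  | zero => simp
  | succ L ih =>
    have := hstep L
    rw [Nat.succ_mul, Finset.sum_range_add, Finset.sum_range_add]
    push_cast
    linarith

/-- The average cost is at most the cost `C` per block, divided by the length of a block. The upper
limit of a sum may be smaller than the sum of the upper limits; it is the convergence of the block
sums of `d` that excludes this. -/
theorem limsup_average_add_le (hc : ∀ k, 0 ≤ c k) (hd : ∀ k, 0 ≤ d k) (hV : ∀ l, 0 ≤ V l)
    (hh : 0 < h) (hθ : 0 ≤ θ)
    (hstep : ∀ l, ∑ s ∈ Finset.range h, c (l * h + s) + V (l + 1)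
      + θ * ∑ s ∈ Finset.range h, d (l * h + s) ≤ V l + C) {b : ℝ}
    (hb : Tendsto (fun l => ∑ s ∈ Finset.range h, d (l * h + s)) atTop (nhds b)) :
    limsup (fun N : ℕ => ENNReal.ofReal ((∑ k ∈ Finset.range N, c k) / N)) atTop
      + ENNReal.ofReal θ
        * limsup (fun N : ℕ => ENNReal.ofReal ((∑ k ∈ Finset.range N, d k) / N)) atTop
      ≤ ENNReal.ofReal (C / h) := by
  have hdlim := tendsto_average_of_tendsto_block_sum hd hh hb
  have hup : Tendsto (fun N : ℕ => V 0 / N + ((N / h + 1 : ℕ) : ℝ) / N * C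
      - θ * ((∑ k ∈ Finset.range ((N / h + 1) * h), d k) / N)) atTop
      (nhds (C / h - θ * (b / h))) := by
    have h1 := ((tendsto_const_div_atTop_nhds_zero_nat (V 0)).add
      ((tendsto_div_div hh 1).mul_const C)).sub
      ((tendsto_average_of_tendsto_block hh hb 1).const_mul θ)
    convert h1 using 2
    ring
  have hle : ∀ N : ℕ, (∑ k ∈ Finset.range N, c k) / N ≤ V 0 / N + ((N / h + 1 : ℕ) : ℝ) / N * C
      - θ * ((∑ k ∈ Finset.range ((N / h + 1) * h), d k) / N) := fun N => by
    have h1 := sum_block_add_le hstep (N / h + 1)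
    have h2 := hV (N / h + 1)
    have h3 := sum_range_le_of_le hc (le_div_add_one_mul hh N)
    have h4 : (∑ k ∈ Finset.range N, c k) ≤ V 0 + ((N / h + 1 : ℕ) : ℝ) * C
      - θ * ∑ k ∈ Finset.range ((N / h + 1) * h), d k := by linarith
    calc (∑ k ∈ Finset.range N, c k) / N ≤ (V 0 + ((N / h + 1 : ℕ) : ℝ) * C
      - θ * ∑ k ∈ Finset.range ((N / h + 1) * h), d k) / N :=
          div_le_div_of_nonneg_right h4 (Nat.cast_nonneg N)
      _ = _ := by ring
  have hnn : 0 ≤ C / h - θ * (b / h) := ge_of_tendsto' hup fun N =>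
    (div_nonneg (Finset.sum_nonneg fun k _ => hc k) (Nat.cast_nonneg N)).trans (hle N)
  have hbnn : 0 ≤ b / h := ge_of_tendsto' hdlim fun N =>
    div_nonneg (Finset.sum_nonneg fun k _ => hd k) (Nat.cast_nonneg N)
  have e1 : limsup (fun N : ℕ => ENNReal.ofReal ((∑ k ∈ Finset.range N, c k) / N)) atTop
      ≤ ENNReal.ofReal (C / h - θ * (b / h)) := by
    rw [← (ENNReal.tendsto_ofReal hup).limsup_eq]
    exact limsup_le_limsup (Eventually.of_forall fun N => ENNReal.ofReal_le_ofReal (hle N))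
  rw [(ENNReal.tendsto_ofReal hdlim).limsup_eq, ← ENNReal.ofReal_mul hθ]
  calc _ ≤ ENNReal.ofReal (C / h - θ * (b / h)) + ENNReal.ofReal (θ * (b / h)) := by gcongr
    _ = ENNReal.ofReal (C / h) := by
      rw [← ENNReal.ofReal_add hnn (mul_nonneg hθ hbnn)]
      congr 1
      ring

/-- The average cost is at least the cost per block, divided by the length of a block, if the values
stay bounded. -/
theorem le_limsup_average_add (hd : ∀ k, 0 ≤ d k) {M : ℝ} (hV : ∀ l, V l ≤ M)
    (hh : 0 < h) (hθ : 0 ≤ θ)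
    (hstep : ∀ l, V l + C ≤ ∑ s ∈ Finset.range h, c (l * h + s) + V (l + 1)
      + θ * ∑ s ∈ Finset.range h, d (l * h + s)) {b : ℝ}
    (hb : Tendsto (fun l => ∑ s ∈ Finset.range h, d (l * h + s)) atTop (nhds b)) :
    ENNReal.ofReal (C / h)
      ≤ limsup (fun N : ℕ => ENNReal.ofReal ((∑ k ∈ Finset.range N, c k) / N)) atTop
        + ENNReal.ofReal θ
          * limsup (fun N : ℕ => ENNReal.ofReal ((∑ k ∈ Finset.range N, d k) / N)) atTop := by
  have h0 : (0 : ℝ) < h := by exact_mod_cast hh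
  have hmul : Tendsto (fun L : ℕ => L * h) atTop atTop := tendsto_id.atTop_mul_const' hh
  have hdlim := tendsto_average_of_tendsto_block_sum hd hh hb
  have hlow : Tendsto (fun L : ℕ => (V 0 - M) / (L : ℝ) / h + C / h
      - θ * ((∑ k ∈ Finset.range (L * h), d k) / (L * h : ℕ))) atTop
      (nhds (C / h - θ * (b / h))) := by
    have h1 :=
      ((tendsto_const_div_atTop_nhds_zero_nat (V 0 - M)).div_const (h : ℝ)).add_const (C / h)
    simpa using h1.sub ((hdlim.comp hmul).const_mul θ)
  have e1 : ENNReal.ofReal (C / h - θ * (b / h))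
      ≤ limsup (fun N : ℕ => ENNReal.ofReal ((∑ k ∈ Finset.range N, c k) / N)) atTop := by
    rw [← (ENNReal.tendsto_ofReal hlow).limsup_eq]
    refine le_trans ?_ hmul.limsup_comp_le_limsup
    refine limsup_le_limsup ?_
    filter_upwards [eventually_gt_atTop 0] with L hL
    have hL' : (0 : ℝ) < L := by exact_mod_cast hL
    have h1 := le_sum_block_add hstep L
    have h2 := hV L
    refine ENNReal.ofReal_le_ofReal ?_
    have e : (V 0 - M) / (L : ℝ) / h + C / h
        - θ * ((∑ k ∈ Finset.range (L * h), d k) / (L * h : ℕ))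
        = (V 0 - M + L * C - θ * ∑ k ∈ Finset.range (L * h), d k) / (L * h : ℕ) := by
      push_cast
      field_simp
    rw [e]
    exact div_le_div_of_nonneg_right (by linarith) (Nat.cast_nonneg _)
  have hbnn : 0 ≤ b / h := ge_of_tendsto' hdlim fun N =>
    div_nonneg (Finset.sum_nonneg fun k _ => hd k) (Nat.cast_nonneg N)
  rw [(ENNReal.tendsto_ofReal hdlim).limsup_eq, ← ENNReal.ofReal_mul hθ]
  calc ENNReal.ofReal (C / h)
      = ENNReal.ofReal ((C / h - θ * (b / h)) + θ * (b / h)) := by rw [sub_add_cancel]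
    _ ≤ ENNReal.ofReal (C / h - θ * (b / h)) + ENNReal.ofReal (θ * (b / h)) :=
        ENNReal.ofReal_add_le
    _ ≤ _ := by gcongr

/-- An affine contraction keeps a sequence bounded. -/
theorem le_of_le_mul_add {V : ℕ → ℝ} {γ K : ℝ} (hγ0 : 0 < γ) (hγ1 : γ < 1)
    (h : ∀ l, V (l + 1) ≤ γ * V l + K) (l : ℕ) : V l ≤ max (V 0) (K / (1 - γ)) := by
  induction l with
  | zero => exact le_max_left _ _
  | succ l ih =>
    have h1 : K / (1 - γ) ≤ max (V 0) (K / (1 - γ)) := le_max_right _ _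
    rw [div_le_iff₀ (by linarith)] at h1
    have h2 := mul_le_mul_of_nonneg_left ih hγ0.le
    have h3 := h l
    linarith

end Averages

/-! ### Average cost of rollout policies -/

namespace CodesignProblem

variable {nx nu ny : ℕ} {S : CodesignProblem nx nu ny} {φ : Vec nx → S.Schedule}
  {Ω : Type*} [MeasurableSpace Ω] {μ : Measure Ω}
  {x₀ : Ω → Vec nx} {w : ℕ → Ω → Vec nx} {v : ℕ → Ω → Vec ny}

theorem stageCost_nonneg (hR : S.R.PosDef) (hQ : S.Q.PosDef) (x z : ℕ → Ω → Vec nx) (k : ℕ) :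
    0 ≤ stageCost μ φ x z k :=
  integral_nonneg fun _ => add_nonneg (hQ.posSemidef.quad_nonneg _) (hR.posSemidef.quad_nonneg _)

theorem actuationProb_nonneg (z : ℕ → Ω → Vec nx) (k : ℕ) : 0 ≤ actuationProb μ φ z k :=
  integral_nonneg fun _ => by
    simp only [Pi.zero_apply]
    split_ifs <;> norm_num

theorem ofReal_div_natCast_eventuallyEq (a : ℕ → ℝ) :
    (fun N : ℕ => ENNReal.ofReal (a N) / N) =ᶠ[atTop] fun N => ENNReal.ofReal (a N / N) := by
  filter_upwards [eventually_gt_atTop 0] with N hN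
  rw [ENNReal.ofReal_div_of_pos (by exact_mod_cast hN), ENNReal.ofReal_natCast]

variable [IsProbabilityMeasure μ]

/-- The average cost in terms of expectations. The stage costs are integrable, so that the extended
nonnegative integrals are real ones. -/
theorem averageCost_rolloutController (hN : S.IsGaussianNoise μ x₀ w v)
    (hW : S.covW.PosDef) (hV : S.covV.PosDef) (hX : S.covX.PosSemidef) (hS : S.FilterStationary)
    (hR : S.R.PosDef) (hQ : S.Q.PosDef) (hφ : Measurable φ) :
    S.averageCost μ x₀ w v (S.rolloutController φ)
      = limsup (fun N : ℕ => ENNReal.ofReal ((∑ k ∈ Finset.range N,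
          stageCost μ φ (S.state μ x₀ w v (S.rolloutController φ))
            (fun k => (S.loop μ x₀ w v (S.rolloutController φ) k).est k) k) / N)) atTop
        + ENNReal.ofReal S.θ * limsup (fun N : ℕ => ENNReal.ofReal ((∑ k ∈ Finset.range N,
          actuationProb μ φ (fun k => (S.loop μ x₀ w v (S.rolloutController φ) k).est k) k) / N))
            atTop := by
  have h := isRolloutEstimate hN hW hV hX hS hφ
  rw [averageCost, averageControlCost, averageActuationRate]
  congr 1
  · rw [← limsup_congr (ofReal_div_natCast_eventuallyEq _)]
    congr 1
    funext N
    simp only [stageCost, input_rolloutController]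
    rw [← integral_finsetSum _ fun k _ => h.integrable_stage hφ k,
      ofReal_integral_eq_lintegral_ofReal
        (integrable_finsetSum _ fun k _ => h.integrable_stage hφ k)]
    exact ae_of_all _ fun ω => Finset.sum_nonneg fun k _ =>
      add_nonneg (hQ.posSemidef.quad_nonneg _) (hR.posSemidef.quad_nonneg _)
  · congr 1
    rw [← limsup_congr (ofReal_div_natCast_eventuallyEq _)]
    congr 1
    funext N
    simp only [actuationProb, trigger_rolloutController]
    rw [← integral_finsetSum _ fun k _ => h.integrable_actuation hφ k,
      ofReal_integral_eq_lintegral_ofReal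
        (integrable_finsetSum _ fun k _ => h.integrable_actuation hφ k)]
    · congr 1
      refine lintegral_congr fun ω => ?_
      rw [ENNReal.ofReal_sum_of_nonneg fun k _ => by split_ifs <;> norm_num]
      refine Finset.sum_congr rfl fun k _ => ?_
      split_ifs <;> simp
    · exact ae_of_all _ fun ω => Finset.sum_nonneg fun k _ => by
        split_ifs <;> norm_num

/-- A selection rule whose lookahead cost is at most that of the periodic policy has an average cost
of at most `C / h`, where `C` is the constant part of the cost of a block. -/
theorem averageCost_rolloutController_le (hN : S.IsGaussianNoise μ x₀ w v)
    (hW : S.covW.PosDef) (hV : S.covV.PosDef) (hX : S.covX.PosSemidef) (hS : S.FilterStationary)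
    (hR : S.R.PosDef) (hQ : S.Q.PosDef) (hC : S.C.rank = nx) (hP : S.Pper.PosDef) (hh : 0 < S.h)
    (hθ : 0 ≤ S.θ) (hφ : Measurable φ) {C : ℝ}
    (hle : ∀ y, S.blockCost (φ y) y ≤ S.Pper.quad y + C) :
    S.averageCost μ x₀ w v (S.rolloutController φ) ≤ ENNReal.ofReal (C / S.h) := by
  have h := isRolloutEstimate hN hW hV hX hS hφ
  have hE : S.errorCov.PosSemidef := S.posSemidef_measurementUpdate hV hX
  have hΓ : S.innovCov.PosDef := S.posDef_sub_measurementUpdate hV (S.posDef_covX hW hV hX hS) hC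
  obtain ⟨b, hb⟩ := h.exists_tendsto_sum_actuationProb hφ hR hQ hP hΓ hh hle
  rw [averageCost_rolloutController hN hW hV hX hS hR hQ hφ]
  refine limsup_average_add_le (V := fun l => ∫ ω, S.Pper.quad
    ((S.loop μ x₀ w v (S.rolloutController φ) (l * S.h)).est (l * S.h) ω) ∂μ)
    (fun k => stageCost_nonneg hR hQ _ _ k) (fun k => actuationProb_nonneg _ k)
    (fun l => integral_nonneg fun ω => hP.posSemidef.quad_nonneg _) hh hθ (fun l => ?_) hb
  rw [h.sum_stageCost_add hφ hR hQ hP hE hΓ.posSemidef l]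
  have hVi : Integrable (fun ω => S.Pper.quad
    ((S.loop μ x₀ w v (S.rolloutController φ) (l * S.h)).est (l * S.h) ω)) μ :=
    (h.memLp_est (l * S.h)).integrable_quad _
  calc _ ≤ ∫ ω, (S.Pper.quad
        ((S.loop μ x₀ w v (S.rolloutController φ) (l * S.h)).est (l * S.h) ω) + C) ∂μ :=
        integral_mono (h.integrable_blockCost hφ (l * S.h)) (hVi.add (integrable_const _))
          fun ω => hle _
    _ = _ := by
      rw [integral_add hVi (integrable_const _)]
      simp

/-- The expected value of the estimate at the block times stays bounded. -/
theorem IsRolloutEstimate.exists_integral_quad_le {I : ℕ → MeasurableSpace Ω}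
    {x z : ℕ → Ω → Vec nx} (h : IsRolloutEstimate μ φ I x z) (hφ : Measurable φ)
    (hR : S.R.PosDef) (hQ : S.Q.PosDef) (hP : S.Pper.PosDef) (hΓ : S.innovCov.PosSemidef)
    (hh : 0 < S.h) {C : ℝ} (hle : ∀ y, S.blockCost (φ y) y ≤ S.Pper.quad y + C) :
    ∃ M, ∀ l, ∫ ω, S.Pper.quad (z (l * S.h) ω) ∂μ ≤ M := by
  obtain ⟨γ, K, hγ0, hγ1, -, hdrift⟩ := exists_integral_quad_blockKernel_le hφ hR hQ hP hΓ hh hle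
  refine ⟨_, le_of_le_mul_add hγ0 hγ1 (K := K) fun l => ?_⟩
  have hm := S.Pper.continuous_quad.aestronglyMeasurable
    (μ := μ.map (z ((l + 1) * S.h)))
  have hi : Integrable S.Pper.quad (μ.map (z ((l + 1) * S.h))) :=
    (integrable_map_measure hm (h.measurable_z _).aemeasurable).2
      ((h.memLp_est _).integrable_quad _)
  have hi0 : Integrable S.Pper.quad (μ.map (z (l * S.h))) :=
    (integrable_map_measure S.Pper.continuous_quad.aestronglyMeasurable
      (h.measurable_z _).aemeasurable).2 ((h.memLp_est _).integrable_quad _)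
  have := Measure.isProbabilityMeasure_map (μ := μ) (h.measurable_z (l * S.h)).aemeasurable
  have e1 : ∫ ω, S.Pper.quad (z (l * S.h) ω) ∂μ = ∫ y, S.Pper.quad y ∂μ.map (z (l * S.h)) :=
    (integral_map (h.measurable_z _).aemeasurable
      S.Pper.continuous_quad.aestronglyMeasurable).symm
  have e2 : ∫ ω, S.Pper.quad (z ((l + 1) * S.h) ω) ∂μ
      = ∫ y, ∫ a, S.Pper.quad a ∂blockKernel hφ y ∂μ.map (z (l * S.h)) := by
    have e : μ.map (z ((l + 1) * S.h))
        = (blockKernel hφ ∘ₖ Kernel.const Unit (μ.map (z (l * S.h)))) () := by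
      rw [h.map_block_succ hφ hΓ, Kernel.comp_apply, Kernel.const_apply]
    rw [← integral_map (h.measurable_z _).aemeasurable hm]
    rw [e] at hi ⊢
    rw [Kernel.integral_comp hi, Kernel.const_apply]
  rw [e1, e2]
  calc _ ≤ ∫ y, (γ * S.Pper.quad y + K) ∂μ.map (z (l * S.h)) := by
        refine integral_mono_of_nonneg (ae_of_all _ fun y => integral_nonneg fun a =>
          hP.posSemidef.quad_nonneg a) ((hi0.const_mul γ).add (integrable_const K))
          (ae_of_all _ hdrift)
    _ = _ := by
      rw [integral_add (hi0.const_mul γ) (integrable_const K), integral_const_mul]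
      simp

/-- A selection rule whose lookahead cost is that of the periodic policy has an average cost of at
least `C / h`. -/
theorem le_averageCost_rolloutController (hN : S.IsGaussianNoise μ x₀ w v)
    (hW : S.covW.PosDef) (hV : S.covV.PosDef) (hX : S.covX.PosSemidef) (hS : S.FilterStationary)
    (hR : S.R.PosDef) (hQ : S.Q.PosDef) (hC : S.C.rank = nx) (hP : S.Pper.PosDef) (hh : 0 < S.h)
    (hθ : 0 ≤ S.θ) (hφ : Measurable φ) {C : ℝ}
    (heq : ∀ y, S.blockCost (φ y) y = S.Pper.quad y + C) :
    ENNReal.ofReal (C / S.h) ≤ S.averageCost μ x₀ w v (S.rolloutController φ) := by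
  have h := isRolloutEstimate hN hW hV hX hS hφ
  have hE : S.errorCov.PosSemidef := S.posSemidef_measurementUpdate hV hX
  have hΓ : S.innovCov.PosDef := S.posDef_sub_measurementUpdate hV (S.posDef_covX hW hV hX hS) hC
  obtain ⟨b, hb⟩ := h.exists_tendsto_sum_actuationProb hφ hR hQ hP hΓ hh fun y => (heq y).le
  obtain ⟨M, hM⟩ := h.exists_integral_quad_le hφ hR hQ hP hΓ.posSemidef hh fun y => (heq y).le
  rw [averageCost_rolloutController hN hW hV hX hS hR hQ hφ]
  refine le_limsup_average_add (V := fun l => ∫ ω, S.Pper.quad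
    ((S.loop μ x₀ w v (S.rolloutController φ) (l * S.h)).est (l * S.h) ω) ∂μ)
    (fun k => actuationProb_nonneg _ k) hM hh hθ (fun l => ?_) hb
  rw [h.sum_stageCost_add hφ hR hQ hP hE hΓ.posSemidef l]
  have hVi : Integrable (fun ω => S.Pper.quad
    ((S.loop μ x₀ w v (S.rolloutController φ) (l * S.h)).est (l * S.h) ω)) μ :=
    (h.memLp_est (l * S.h)).integrable_quad _
  simp only [heq]
  rw [integral_add hVi (integrable_const _)]
  simp

end CodesignProblem

theorem theorem1 {nx nu ny : ℕ} (S : CodesignProblem nx nu ny)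
    {Ω : Type*} [MeasurableSpace Ω] (μ : Measure Ω) [IsProbabilityMeasure μ]
    (x₀ : Ω → Vec nx) (w : ℕ → Ω → Vec nx) (v : ℕ → Ω → Vec ny)
    (hnoise : S.IsGaussianNoise μ x₀ w v)
    (hcovW : S.covW.PosDef) (hcovV : S.covV.PosDef) (hcovX : S.covX.PosSemidef)
    (hAB : IsControllable S.A S.B)
    (hR : S.R.PosDef) (hθ : 0 < S.θ)
    (hp : 0 < S.p) (hh : 0 < S.h) (hph : S.p ∣ S.h)
    (heig : EigenvalueNonresonant S.A S.p)
    (hC : S.C.rank = nx) (hQ : S.Q.PosDef) (hfilter : S.FilterStationary)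
    (φ : Vec nx → S.Schedule) (hφ : S.IsArgminRule φ) :
    S.averageCost μ x₀ w v S.periodicController < ⊤ ∧
      S.averageCost μ x₀ w v (S.rolloutController φ)
        ≤ S.averageCost μ x₀ w v S.periodicController + 1 / (S.h : ℝ≥0∞) := by
  obtain ⟨hP, hfix⟩ := S.posDef_Pper_and_periodStep_Pper hR hQ hp hAB heig
  rw [← S.rolloutController_periodicSchedule hQ hp hh hph hfix]
  set c : ℝ := S.blockNoiseCost S.periodicSchedule + S.θ * S.actuationCount S.periodicSchedule
  have heq : ∀ y, S.blockCost S.periodicSchedule y = S.Pper.quad y + c := fun y => by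
    rw [CodesignProblem.blockCost, S.costMatrix_periodicSchedule_zero hp hph hfix, add_assoc]
  have hle : ∀ y, S.blockCost (φ y) y ≤ S.Pper.quad y + c := fun y => by
    rw [← heq]
    have h1 := hφ.2 0 y S.periodicSchedule
    rw [CodesignProblem.lookaheadCost_eq hR hQ hP hfilter,
      CodesignProblem.lookaheadCost_eq hR hQ hP hfilter] at h1
    -- the terms of the lookahead cost that do not depend on the schedule cancel
    have e : ∀ m, S.actuationCost m = S.θ * S.actuationCount m := fun m => rfl
    rw [e, e] at h1
    rw [CodesignProblem.blockCost, CodesignProblem.blockCost]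
    linarith
  refine ⟨?_, ?_⟩
  · exact (CodesignProblem.averageCost_rolloutController_le hnoise hcovW hcovV hcovX hfilter hR hQ
      hC hP hh hθ.le measurable_const fun y => (heq y).le).trans_lt ENNReal.ofReal_lt_top
  · calc _ ≤ ENNReal.ofReal (c / S.h) := CodesignProblem.averageCost_rolloutController_le hnoise
          hcovW hcovV hcovX hfilter hR hQ hC hP hh hθ.le hφ.1 hle
      _ ≤ _ := CodesignProblem.le_averageCost_rolloutController hnoise hcovW hcovV hcovX hfilter hR
          hQ hC hP hh hθ.le measurable_const heq
      _ ≤ _ := le_self_add
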